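/- Let $J=(-1,1)\subset\mathbb R$ and let $X$ be a smooth manifold of dimension $n$. A smooth semi-stable degeneration is a proper smooth map $\pi\colon X\to J$ which is submersive over $J\setminus\{0\}$ and such that every $p\in X$ with $\pi(p)=0$ is the centre of a chart of $X$ (a normal crossing chart) in which $\pi(x)=x_1\cdots x_k$ for some $1\le k\le n$. Put $X_t=\pi^{-1}(t)$. The real-oriented blow-up $\alpha\colon\widetilde X\to X$ of $X$ along $X_0$ is the space whose points over $x\in X$ are the local connected components of $X\setminus X_0$ at $x$ (compatible choices of a connected component of $U\setminus X_0$ for all open neighbourhoods $U$ of $x$), with the topology generated by the sets of all points over an open set $U$ with prescribed component of $U\setminus X_0$; in a normal crossing chart it is $(\mathbb R_{\le 0}\sqcup\mathbb R_{\ge 0})^k\times\mathbb R^{n-k}\to\mathbb R^n$. Let $\widetilde\pi\colon\widetilde X\to\widetilde J=(-1,0]\sqcup[0,1)$ be the unique continuous lift of $\pi\circ\alpha$ along $\widetilde J\to J$, let $0^+$ be the zero of $[0,1)\subset\widetilde J$, and put $\widetilde X^+=\widetilde\pi^{-1}([0^+,1))$ and $\widetilde X^+_0=\widetilde\pi^{-1}(0^+)$.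 For $p\in X$ let $H_{p,1},\dots,H_{p,k}\subset T_pX$ be the hyperplanes whose union is the tangent cone at $p$ of the fibre of $\pi$ through $p$: if $\pi(p)\ne0$, then $k=1$ and $H_{p,1}=\ker d\pi_p$; if $\pi(p)=0$, then $H_{p,j}=\ker (dx_j)_p$, $1\le j\le k$, in a normal crossing chart at $p$. Closed submanifolds $X_1,\dots,X_m\subset X$ form a transversal collection if for every $p\in X$ the codimension in $T_pX$ of the intersection of $H_{p,1},\dots,H_{p,k}$ and of all $T_pX_i$ with $p\in X_i$ is the sum of the codimensions of these subspaces. Theorem. Let $\pi\colon X\to J$ be a smooth semi-stable degeneration and $X_1,\dots,X_m\subset X$ a transversal collection of closed submanifolds. For $I\subset\{1,\dots,m\}$ let $X_I=\bigcap_{i\in I}X_i$ (with $X_\emptyset=X$). (a) If $X_I\neq\emptyset$, then $X_I$ is a submanifold of $X$ and $\pi_I=\pi|_{X_I}\colon X_I\to J$ is a smooth semi-stable degeneration. (b) For every $I$ the canonical map $\widetilde X_I\to\widetilde X$ from the real-oriented blow-up of $X_I$ along $X_I\cap X_0$, induced by the inclusion $X_I\subset X$, is a topological embedding, by which $\widetilde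 X_I$ and its subsets $\widetilde X_I^+=\widetilde\pi_I^{-1}([0^+,1))$ and $\widetilde X_{I,0}^+=\widetilde\pi_I^{-1}(0^+)$ are regarded as subsets of $\widetilde X$. There exists a homeomorphism $$H\colon\widetilde X^+_0\times[0,1)\to\widetilde X^+$$ such that $\widetilde\pi(H(x,t))=t$ for all $(x,t)\in\widetilde X_0^+\times[0,1)$, and such that for every $I\subset\{1,\dots,m\}$ $$H\bigl(\widetilde X^+_{I,0}\times[0,1)\bigr)=\widetilde X^+_I .$$ -/

import Mathlib

open Set Topology TopologicalSpace
open scoped Manifold ContDiff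

noncomputable section

/-! ## Smooth semi-stable degenerations -/

/-- `φ` is a chart of the smooth `n`-manifold `X`, centred in `p`, in which the function `ρ` is the
product `x₁ ⋯ x_k` of the first `k` coordinates, where `1 ≤ k ≤ n`. -/
structure IsNormalCrossingChart {n : ℕ} {X : Type*} [TopologicalSpace X]
    [ChartedSpace (EuclideanSpace ℝ (Fin n)) X] (ρ : X → ℝ) (p : X) (k : ℕ) (hk : k ≤ n)
    (φ : OpenPartialHomeomorph X (EuclideanSpace ℝ (Fin n))) : Prop where
  mem_maximalAtlas : φ ∈ IsManifold.maximalAtlas (𝓡 n) ∞ X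
  mem_source : p ∈ φ.source
  map_eq_zero : φ p = 0
  one_le : 1 ≤ k
  eq_prod : ∀ x ∈ φ.source, ρ x = ∏ j : Fin k, φ x (Fin.castLE hk j)

/-- A smooth function having a normal crossing chart at each of its zeros. -/
structure IsNormalCrossingFunction (n : ℕ) {X : Type*} [TopologicalSpace X]
    [ChartedSpace (EuclideanSpace ℝ (Fin n)) X] (ρ : X → ℝ) : Prop where
  contMDiff : ContMDiff (𝓡 n) 𝓘(ℝ, ℝ) ∞ ρ
  exists_chart : ∀ p, ρ p = 0 → ∃ (k : ℕ) (hk : k ≤ n)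
    (φ : OpenPartialHomeomorph X (EuclideanSpace ℝ (Fin n))), IsNormalCrossingChart ρ p k hk φ

/-- A smooth semi-stable degeneration: a proper normal crossing function `π : X → (-1, 1)` which
is submersive over `(-1, 1) ∖ {0}`. -/
structure IsSmoothSemistableDegeneration (n : ℕ) {X : Type*} [TopologicalSpace X]
    [ChartedSpace (EuclideanSpace ℝ (Fin n)) X] (π : C(X, Ioo (-1 : ℝ) 1)) : Prop where
  isProperMap : IsProperMap π
  isNormalCrossingFunction : IsNormalCrossingFunction n (fun x => (π x : ℝ))
  submersive : ∀ p, (π p : ℝ) ≠ 0 →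
    Function.Surjective (mfderiv (𝓡 n) 𝓘(ℝ, ℝ) (fun x => (π x : ℝ)) p)

/-! ## Transversal collections of submanifolds -/

/-- `S` is an embedded submanifold of dimension `d` of the smooth `n`-manifold `X`: at each point
of `S` there is a chart of `X` in which `S` is given by the vanishing of the last `n - d`
coordinates. -/
def IsSubmanifold (n : ℕ) {X : Type*} [TopologicalSpace X]
    [ChartedSpace (EuclideanSpace ℝ (Fin n)) X] (d : ℕ) (S : Set X) : Prop :=
  d ≤ n ∧ ∀ p ∈ S, ∃ φ ∈ IsManifold.maximalAtlas (𝓡 n) ∞ X, p ∈ φ.source ∧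
    ∀ x ∈ φ.source, (x ∈ S ↔ ∀ j : Fin n, d ≤ (j : ℕ) → φ x j = 0)

/-- The tangent space `T_p S ⊆ T_p X` of a submanifold `S` at `p ∈ S`: the velocities at `p` of the
smooth curves contained in `S`. (For a submanifold they already form a linear subspace.) -/
def submanifoldTangentSpace {n : ℕ} {X : Type*} [TopologicalSpace X]
    [ChartedSpace (EuclideanSpace ℝ (Fin n)) X] (S : Set X) (p : X) :
    Submodule ℝ (TangentSpace (𝓡 n) p) :=
  Submodule.span ℝ {v | ∃ γ : ℝ → X, γ 0 = p ∧ ContMDiffAt 𝓘(ℝ, ℝ) (𝓡 n) ∞ γ 0 ∧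
    (∀ᶠ t in 𝓝 0, γ t ∈ S) ∧ v = mfderiv 𝓘(ℝ, ℝ) (𝓡 n) γ 0 (1 : ℝ)}

/-- `H₁, …, H_k` are the hyperplanes in `T_p X` whose union is the tangent cone at `p` of the fibre
of `π` through `p`. If `π p ≠ 0`, then the fibre is smooth at `p` and its only tangent
hyperplane is `ker dπ_p`; if `π p = 0`, then these are the tangent hyperplanes of the `k` branches
`x₁ = 0, …, x_k = 0` of the special fibre in a normal crossing chart (another normal crossing
chart only permutes them). -/
def IsFibreTangentHyperplanes {n : ℕ} {X : Type*} [TopologicalSpace X]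
    [ChartedSpace (EuclideanSpace ℝ (Fin n)) X] (π : C(X, Ioo (-1 : ℝ) 1)) (p : X) (k : ℕ)
    (H : Fin k → Submodule ℝ (TangentSpace (𝓡 n) p)) : Prop :=
  ((π p : ℝ) ≠ 0 ∧ k = 1 ∧
    ∀ j, H j = (mfderiv (𝓡 n) 𝓘(ℝ, ℝ) (fun x => (π x : ℝ)) p).ker) ∨
  ((π p : ℝ) = 0 ∧ ∃ (hk : k ≤ n) (φ : OpenPartialHomeomorph X (EuclideanSpace ℝ (Fin n))),
    IsNormalCrossingChart (fun x => (π x : ℝ)) p k hk φ ∧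
    ∀ j, H j = (mfderiv (𝓡 n) 𝓘(ℝ, ℝ) (fun x => φ x (Fin.castLE hk j)) p).ker)

/-- A finite family of subspaces is transversal if the codimension of the intersection is the sum
of the codimensions. -/
def IsTransversalFamily {ι E : Type*} [Fintype ι] [AddCommGroup E] [Module ℝ E]
    (W : ι → Submodule ℝ E) : Prop :=
  Module.finrank ℝ (E ⧸ ⨅ i, W i) = ∑ i, Module.finrank ℝ (E ⧸ W i)

open scoped Classical in
/-- The collection `S₁, …, S_m` is transversal (with respect to `π`): at each point `p`, the tangent
hyperplanes of the fibre of `π` through `p` together with the tangent spaces of those `S_i` that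
contain `p` form a transversal family of subspaces of `T_p X`. -/
def IsTransversalCollection (n : ℕ) {m : ℕ} {X : Type*} [TopologicalSpace X]
    [ChartedSpace (EuclideanSpace ℝ (Fin n)) X] (π : C(X, Ioo (-1 : ℝ) 1))
    (S : Fin m → Set X) : Prop :=
  ∀ (p : X) (k : ℕ) (H : Fin k → Submodule ℝ (TangentSpace (𝓡 n) p)),
    IsFibreTangentHyperplanes π p k H →
      IsTransversalFamily
        (Sum.elim H (fun i : {i : Fin m // p ∈ S i} => submanifoldTangentSpace (S i) p))

/-! ## Real-oriented blow-ups -/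

/-- The real-oriented blow-up of `X` along a normal crossing divisor `D`. A point over `x ∈ X` is a
local connected component of `X ∖ D` at `x`, that is, a choice, for every open neighbourhood `U`
of `x`, of a connected component `side U` of `U ∖ D`, compatible with inclusions.
(For `U` not containing `x` we put `side U = ∅`.)

If `D` is `x₁ ⋯ x_k = 0` in `ℝⁿ`, the local components at a point of `D` at which exactly `l` of
the `x_j` vanish are the `2 ^ l` adjacent open orthants, and one obtains the disjoint union of the
`2 ^ k` closed orthants `(ℝ_{≤0} ⊔ ℝ_{≥0})ᵏ × ℝⁿ⁻ᵏ`. -/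
@[ext]
structure RealOrientedBlowup {X : Type*} [TopologicalSpace X] (D : Set X) where
  /-- The image of the point under the blow-down map `α`. -/
  blowDown : X
  /-- The component of `U ∖ D` on which the point lies. -/
  side : Opens X → Set X
  side_eq_empty : ∀ U : Opens X, blowDown ∉ U → side U = ∅
  exists_side_eq : ∀ U : Opens X, blowDown ∈ U →
    ∃ y ∈ (U : Set X) \ D, side U = connectedComponentIn ((U : Set X) \ D) y
  side_mono : ∀ U V : Opens X, U ≤ V → side U ⊆ side V

namespace RealOrientedBlowup

/-- The topology generated by the sets of all points over an open set `U` that lie on a given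
side `K` in `U`. -/
instance {X : Type*} [TopologicalSpace X] (D : Set X) : TopologicalSpace (RealOrientedBlowup D) :=
  generateFrom {W | ∃ (U : Opens X) (K : Set X),
    W = {b : RealOrientedBlowup D | b.blowDown ∈ U ∧ b.side U = K}}

theorem isOpen_basic {X : Type*} [TopologicalSpace X] {D : Set X} (U : Opens X) (K : Set X) :
    IsOpen {b : RealOrientedBlowup D | b.blowDown ∈ U ∧ b.side U = K} :=
  isOpen_generateFrom_of_mem ⟨U, K, rfl⟩

theorem continuous_blowDown {X : Type*} [TopologicalSpace X] {D : Set X} :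
    Continuous (blowDown : RealOrientedBlowup D → X) := by
  refine continuous_def.2 fun U hU => ?_
  have h : (blowDown : RealOrientedBlowup D → X) ⁻¹' U =
      ⋃ K : Set X, {b | b.blowDown ∈ (⟨U, hU⟩ : Opens X) ∧ b.side ⟨U, hU⟩ = K} := by
    ext b
    simp only [mem_preimage, mem_iUnion, mem_ofPred_eq, exists_and_left, exists_eq', and_true]
    rfl
  rw [h]
  exact isOpen_iUnion fun K => isOpen_basic _ K

theorem side_subset {X : Type*} [TopologicalSpace X] {D : Set X} (b : RealOrientedBlowup D)
    (U : Opens X) : b.side U ⊆ (U : Set X) \ D := by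
  by_cases h : b.blowDown ∈ U
  · obtain ⟨y, -, hy⟩ := b.exists_side_eq U h
    rw [hy]
    exact connectedComponentIn_subset _ _
  · rw [b.side_eq_empty U h]
    exact empty_subset _

theorem side_nonempty {X : Type*} [TopologicalSpace X] {D : Set X} (b : RealOrientedBlowup D)
    {U : Opens X} (h : b.blowDown ∈ U) : (b.side U).Nonempty := by
  obtain ⟨y, hyU, hy⟩ := b.exists_side_eq U h
  exact ⟨y, hy ▸ mem_connectedComponentIn hyU⟩

theorem isPreconnected_side {X : Type*} [TopologicalSpace X] {D : Set X}
    (b : RealOrientedBlowup D) (U : Opens X) : IsPreconnected (b.side U) := by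
  by_cases h : b.blowDown ∈ U
  · obtain ⟨y, -, hy⟩ := b.exists_side_eq U h
    rw [hy]
    exact isPreconnected_connectedComponentIn
  · rw [b.side_eq_empty U h]
    exact isPreconnected_empty

theorem blowDown_mem_closure_side {X : Type*} [TopologicalSpace X] {D : Set X}
    (b : RealOrientedBlowup D) : b.blowDown ∈ closure (b.side ⊤) := by
  refine mem_closure_iff.2 fun U hU hb => ?_
  obtain ⟨y, hy⟩ := b.side_nonempty (U := ⟨U, hU⟩) hb
  exact ⟨y, (b.side_subset _ hy).1, b.side_mono _ ⊤ le_top hy⟩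

/-- The canonical map of real-oriented blow-ups induced by a continuous map `f : Y → X` that maps
`Y ∖ E` to `X ∖ D`: it sends a local component `C` of `Y ∖ E` at `y` to the local component
of `X ∖ D` at `f y` that contains the images under `f` of the points of `C`. -/
def map {X Y : Type*} [TopologicalSpace X] [TopologicalSpace Y] {D : Set X} {E : Set Y}
    (f : C(Y, X)) (hf : MapsTo f Eᶜ Dᶜ) (b : RealOrientedBlowup E) : RealOrientedBlowup D where
  blowDown := f b.blowDown
  side U := ⋃ y ∈ b.side (Opens.comap f U), connectedComponentIn ((U : Set X) \ D) (f y)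
  side_eq_empty U hU := by
    rw [b.side_eq_empty (Opens.comap f U) hU]
    simp
  exists_side_eq U hU := by
    have hsub : f '' b.side (Opens.comap f U) ⊆ (U : Set X) \ D := by
      rintro _ ⟨y, hy, rfl⟩
      exact ⟨(b.side_subset _ hy).1, hf (b.side_subset _ hy).2⟩
    have hpre : IsPreconnected (f '' b.side (Opens.comap f U)) :=
      (b.isPreconnected_side _).image _ f.continuous.continuousOn
    obtain ⟨y, hy⟩ := b.side_nonempty (U := Opens.comap f U) hU
    refine ⟨f y, hsub (mem_image_of_mem f hy), subset_antisymm ?_ ?_⟩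
    · refine iUnion₂_subset fun z hz => ?_
      rw [connectedComponentIn_eq (hpre.subset_connectedComponentIn (mem_image_of_mem f hy) hsub
        (mem_image_of_mem f hz))]
    · exact subset_biUnion_of_mem (u := fun z => connectedComponentIn ((U : Set X) \ D) (f z)) hy
  side_mono U V hUV :=
    iUnion₂_subset fun y hy =>
      (connectedComponentIn_mono (f y) (sdiff_subset_sdiff_left hUV)).trans
        (subset_biUnion_of_mem (u := fun z => connectedComponentIn ((V : Set X) \ D) (f z))
          (b.side_mono _ _ (Opens.comap_mono f hUV) hy))

end RealOrientedBlowup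

/-! ## The blow-up of a degeneration -/

/-- The special fibre `X₀ = π⁻¹(0)`. -/
def specialFibre {X : Type*} [TopologicalSpace X] (π : C(X, Ioo (-1 : ℝ) 1)) : Set X :=
  {x | (π x : ℝ) = 0}

/-- The real-oriented blow-up `(-1, 0] ⊔ [0, 1)` of the interval `(-1, 1)` along `{0}`. -/
abbrev BlownUpInterval : Type := Ioc (-1 : ℝ) 0 ⊕ Ico (0 : ℝ) 1

/-- The positive copy `0⁺ ∈ [0, 1)` of zero in the blown-up interval. -/
def zeroPlus : BlownUpInterval := Sum.inr ⟨0, le_rfl, zero_lt_one⟩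

theorem pos_on_side {X : Type*} [TopologicalSpace X] (π : C(X, Ioo (-1 : ℝ) 1))
    (b : RealOrientedBlowup (specialFibre π)) (h : ∃ y ∈ b.side ⊤, 0 < (π y : ℝ)) :
    ∀ y ∈ b.side ⊤, 0 < (π y : ℝ) := by
  obtain ⟨y, hy, hpos⟩ := h
  intro z hz
  by_contra hneg
  obtain ⟨w, hw, hw0⟩ := (b.isPreconnected_side ⊤).intermediate_value hz hy
    (f := fun x => (π x : ℝ)) (by fun_prop) ⟨not_lt.1 hneg, hpos.le⟩
  exact (b.side_subset _ hw).2 hw0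

theorem nonneg_blowDown {X : Type*} [TopologicalSpace X] (π : C(X, Ioo (-1 : ℝ) 1))
    (b : RealOrientedBlowup (specialFibre π)) (h : ∃ y ∈ b.side ⊤, 0 < (π y : ℝ)) :
    0 ≤ (π b.blowDown : ℝ) :=
  (isClosed_le (f := fun _ : X => (0 : ℝ)) (g := fun x => (π x : ℝ)) (by fun_prop)
    (by fun_prop)).closure_subset_iff.2 (fun y hy => (pos_on_side π b h y hy).le)
    b.blowDown_mem_closure_side

theorem nonpos_blowDown {X : Type*} [TopologicalSpace X] (π : C(X, Ioo (-1 : ℝ) 1))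
    (b : RealOrientedBlowup (specialFibre π)) (h : ¬ ∃ y ∈ b.side ⊤, 0 < (π y : ℝ)) :
    (π b.blowDown : ℝ) ≤ 0 :=
  (isClosed_le (f := fun x => (π x : ℝ)) (g := fun _ : X => (0 : ℝ)) (by fun_prop)
    (by fun_prop)).closure_subset_iff.2 (fun y hy => not_lt.1 fun hpos => h ⟨y, hy, hpos⟩)
    b.blowDown_mem_closure_side

open scoped Classical in
/-- The blow-up `π̃ : X̃ → (-1, 0] ⊔ [0, 1)` of `π`, where `X̃` is the real-oriented blow-up of `X`
along the special fibre: the point is mapped to its value under `π`, in the copy given by the sign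
of `π` on the side of the special fibre on which the point lies. -/
def blownUpMap {X : Type*} [TopologicalSpace X] (π : C(X, Ioo (-1 : ℝ) 1))
    (b : RealOrientedBlowup (specialFibre π)) : BlownUpInterval :=
  if h : ∃ y ∈ b.side ⊤, 0 < (π y : ℝ) then
    Sum.inr ⟨π b.blowDown, nonneg_blowDown π b h, (π b.blowDown).2.2⟩
  else
    Sum.inl ⟨π b.blowDown, (π b.blowDown).2.1, nonpos_blowDown π b h⟩

/-- `π̃` is compatible with `π` via the blow-down maps. -/
theorem blownUpMap_blowDown {X : Type*} [TopologicalSpace X] (π : C(X, Ioo (-1 : ℝ) 1))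
    (b : RealOrientedBlowup (specialFibre π)) :
    Sum.elim Subtype.val Subtype.val (blownUpMap π b) = (π b.blowDown : ℝ) := by
  unfold blownUpMap
  split_ifs <;> rfl

theorem continuous_blownUpMap {X : Type*} [TopologicalSpace X] (π : C(X, Ioo (-1 : ℝ) 1)) :
    Continuous (blownUpMap π) := by
  have hc : Continuous fun b : RealOrientedBlowup (specialFibre π) => (π b.blowDown : ℝ) :=
    continuous_subtype_val.comp (π.continuous.comp RealOrientedBlowup.continuous_blowDown)
  refine continuous_iff_continuousAt.2 fun b₀ => ?_
  have hN : {b : RealOrientedBlowup (specialFibre π) | b.side ⊤ = b₀.side ⊤} ∈ 𝓝 b₀ :=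
    Filter.mem_of_superset ((RealOrientedBlowup.isOpen_basic ⊤ (b₀.side ⊤)).mem_nhds
      ⟨trivial, rfl⟩) fun b hb => hb.2
  refine ContinuousOn.continuousAt (continuousOn_iff_continuous_domRestrict.2 ?_) hN
  by_cases h : ∃ y ∈ b₀.side ⊤, 0 < (π y : ℝ)
  · have h' (b : {b : RealOrientedBlowup (specialFibre π) | b.side ⊤ = b₀.side ⊤}) :
        ∃ y ∈ b.1.side ⊤, 0 < (π y : ℝ) := by rw [b.2]; exact h
    refine (continuous_inr.comp (Continuous.subtype_mk (hc.comp continuous_subtype_val)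
      fun b => ⟨nonneg_blowDown π b.1 (h' b), (π b.1.blowDown).2.2⟩)).congr fun b => ?_
    rw [domRestrict_apply, blownUpMap, dif_pos (h' b)]
    rfl
  · have h' (b : {b : RealOrientedBlowup (specialFibre π) | b.side ⊤ = b₀.side ⊤}) :
        ¬ ∃ y ∈ b.1.side ⊤, 0 < (π y : ℝ) := by rw [b.2]; exact h
    refine (continuous_inl.comp (Continuous.subtype_mk (hc.comp continuous_subtype_val)
      fun b => ⟨(π b.1.blowDown).2.1, nonpos_blowDown π b.1 (h' b)⟩)).congr fun b => ?_
    rw [domRestrict_apply, blownUpMap, dif_neg (h' b)]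
    rfl

/-- The positive part `X̃⁺ = π̃⁻¹([0⁺, 1))`. -/
def positivePart {X : Type*} [TopologicalSpace X] (π : C(X, Ioo (-1 : ℝ) 1)) :
    Set (RealOrientedBlowup (specialFibre π)) :=
  blownUpMap π ⁻¹' range Sum.inr

/-- The positive special fibre `X̃⁺₀ = π̃⁻¹(0⁺)`. -/
def positiveSpecialFibre {X : Type*} [TopologicalSpace X] (π : C(X, Ioo (-1 : ℝ) 1)) :
    Set (RealOrientedBlowup (specialFibre π)) :=
  blownUpMap π ⁻¹' {zeroPlus}

/-- The restriction `π|_S : S → (-1, 1)`. -/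
def restrictTo {X : Type*} [TopologicalSpace X] (π : C(X, Ioo (-1 : ℝ) 1)) (S : Set X) :
    C(S, Ioo (-1 : ℝ) 1) :=
  π.restrict S

/-- The canonical map `S̃ → X̃` from the real-oriented blow-up of `S` along `S ∩ X₀` to the
real-oriented blow-up of `X` along `X₀`, induced by the inclusion `S ⊆ X`. -/
def blowupInclusion {X : Type*} [TopologicalSpace X] (π : C(X, Ioo (-1 : ℝ) 1)) (S : Set X) :
    RealOrientedBlowup (specialFibre (restrictTo π S)) → RealOrientedBlowup (specialFibre π) :=
  RealOrientedBlowup.map ⟨Subtype.val, continuous_subtype_val⟩ (fun _ hx => hx)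

end

/-! ## Charts with prescribed coordinates -/

/-! The trivialisation comes from a flow on the positive part of the blow-up. Transversality gives
charts in which `π` is the product of the first `k` coordinates and each `S i` is the vanishing of a
block of the others (`exists_adaptedChart`). A point of the blow-up selects an orthant adjacent to
it. On the positive part, after sign changes, the blow-up is locally a closed orthant times a
Euclidean space, with `π` the product of the orthant coordinates. The constant field `(1, …, 1, 0,
…, 0)` then points into the orthant, is tangent to every `S i`, and makes `π` strictly increase
along its orbits.

Pointing inward at a point is a convex condition and does not depend on the adapted chart
(`IsAdaptedChart.fderiv_orthantCoord_pos`), and tangency is linear, so such fields can be patched by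
a partition of unity. The result depends on the side of the special fibre, but on one side it is
locally a `C¹` field on `X`, to which Picard–Lindelöf applies.

Where two or more branches meet, `dπ` vanishes, so the field cannot be rescaled to make `π` grow at
unit speed. Instead the orbits are reparametrised by the value of `π`. Strict monotonicity makes
this possible and continuous (`exists_orbitBox`), and this is why a homeomorphism results. To allow
for orbits that leave the orthant backwards in time, the product is extended to a strictly
increasing function on the whole space, the `orthantGauge`. The reparametrised orbit germs are
unique (`AdaptedAtlas.IsFlowGerm.eventuallyEq`) and exist in boxes
(`AdaptedAtlas.exists_flowGermBox`). Properness lets the boxes be glued over all of `[0, 1)`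
(`exists_homeomorph_of_flowBox`). A closed set invariant under the germs is a product in this
trivialisation.

For the strata, the coordinates outside the blocks give normal crossing charts with the same `k`
first coordinates. Hence the sides in a stratum are the traces of the sides in `X`, and the blow-up
of a stratum is the set of all points of the blow-up of `X` lying over it
(`isEmbedding_blowupInclusion`, `range_blowupInclusion`). -/

theorem exists_continuousLinearEquiv_extending {n : ℕ} {J : Type*} [Finite J] (o : J ↪ Fin n)
    (Λ : EuclideanSpace ℝ (Fin n) →ₗ[ℝ] (J → ℝ)) (hΛ : Function.Surjective Λ) :
    ∃ L : EuclideanSpace ℝ (Fin n) ≃L[ℝ] EuclideanSpace ℝ (Fin n),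
      ∀ v j, L v (o j) = Λ v j := by
  classical
  have := Fintype.ofFinite J
  obtain ⟨R, hR⟩ := Λ.exists_rightInverse_of_surjective (LinearMap.range_eq_top.2 hΛ)
  have hR' (v) : Λ (R v) = v := LinearMap.congr_fun hR v
  -- Coordinates on the kernel of `Λ` fill exactly the slots outside `range o`. They are extended to
  -- the whole space by the projection `P` onto the kernel along the range of `R`.
  have hdim : Module.finrank ℝ (LinearMap.ker Λ) =
      Module.finrank ℝ ({x : Fin n // x ∉ range o} → ℝ) := by
    have h1 := Λ.finrank_range_add_finrank_ker
    rw [LinearMap.range_eq_top.2 hΛ, finrank_top, finrank_euclideanSpace_fin,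
      Module.finrank_fintype_fun_eq_card] at h1
    rw [Module.finrank_fintype_fun_eq_card, Fintype.card_subtype_compl, Fintype.card_fin]
    have h2 : Fintype.card {x // x ∈ range o} = Fintype.card J :=
      Fintype.card_congr (Equiv.ofInjective o o.injective).symm
    omega
  let κ := LinearEquiv.ofFinrankEq _ _ hdim
  let P : EuclideanSpace ℝ (Fin n) →ₗ[ℝ] LinearMap.ker Λ :=
    (LinearMap.id - R ∘ₗ Λ).codRestrict _ fun v => by simp [hR']
  let f : EuclideanSpace ℝ (Fin n) →ₗ[ℝ] (Fin n → ℝ) := LinearMap.pi fun i =>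
    if h : i ∈ range o then LinearMap.proj h.choose ∘ₗ Λ
    else LinearMap.proj ⟨i, h⟩ ∘ₗ κ.toLinearMap ∘ₗ P
  have hf (v j) : f v (o j) = Λ v j := by
    have h : o j ∈ range o := mem_range_self j
    simp only [f, LinearMap.pi_apply, dif_pos h, LinearMap.comp_apply, LinearMap.proj_apply]
    rw [o.injective h.choose_spec]
  have hf' (v) (i : {x : Fin n // x ∉ range o}) : f v i = κ (P v) i := by
    simp only [f, LinearMap.pi_apply, dif_neg i.2, LinearMap.comp_apply, LinearMap.proj_apply]
    rfl
  have hinj : Function.Injective f := by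
    refine (injective_iff_map_eq_zero f).2 fun v hv => ?_
    have h1 : Λ v = 0 := by ext j; rw [← hf, hv]; rfl
    have h2 : κ (P v) = 0 := by ext i; rw [← hf', hv]; rfl
    have h3 : P v = 0 := by simpa using h2
    have h4 : ((P v : LinearMap.ker Λ) : EuclideanSpace ℝ (Fin n)) = v := by
      simp [P, h1]
    rw [← h4, h3]; rfl
  let g := LinearEquiv.ofInjectiveOfFinrankEq f hinj (by simp)
  refine ⟨(g.trans (WithLp.linearEquiv 2 ℝ (Fin n → ℝ)).symm).toContinuousLinearEquiv,
    fun v j => ?_⟩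
  rw [← hf]
  rfl

/-- Invertibility of the derivative is an open condition. Restricting to the set where it holds
makes the inverse smooth on the whole target, as charts of the maximal atlas require. -/
theorem exists_openPartialHomeomorph_of_contDiffOn {E : Type*} [NormedAddCommGroup E]
    [NormedSpace ℝ E] [CompleteSpace E] {F : E → E} {Ω : Set E} (hΩ : IsOpen Ω) {z : E} (hz : z ∈ Ω)
    (hF : ContDiffOn ℝ ∞ F Ω) (L : E ≃L[ℝ] E) (hL : HasFDerivAt F (L : E →L[ℝ] E) z) :
    ∃ θ : OpenPartialHomeomorph E E, (θ : E → E) = F ∧ z ∈ θ.source ∧ θ.source ⊆ Ω ∧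
      ContDiffOn ℝ ∞ θ.symm θ.target := by
  have hFz : ContDiffAt ℝ ∞ F z := hF.contDiffAt (hΩ.mem_nhds hz)
  let θ := hFz.toOpenPartialHomeomorph F hL (by simp)
  have hθ : (θ : E → E) = F := hFz.toOpenPartialHomeomorph_coe hL _
  let V : Set E := Ω ∩ (fderiv ℝ F) ⁻¹' range ((↑) : (E ≃L[ℝ] E) → E →L[ℝ] E)
  have hV : IsOpen V :=
    (hF.continuousOn_fderiv_of_isOpen hΩ (by simp)).isOpen_inter_preimage hΩ
      ContinuousLinearEquiv.isOpen
  have hzV : z ∈ V := ⟨hz, L, hL.fderiv.symm⟩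
  refine ⟨θ.restrOpen V hV, hθ, ⟨hFz.mem_toOpenPartialHomeomorph_source hL _, hzV⟩,
    fun x hx => hx.2.1, fun y hy => ?_⟩
  have hy' : θ.symm y ∈ V := ((θ.restrOpen V hV).map_target hy).2
  obtain ⟨hyΩ, L', hL'⟩ := hy'
  have hc : ContDiffAt ℝ ∞ F (θ.symm y) := hF.contDiffAt (hΩ.mem_nhds hyΩ)
  refine (OpenPartialHomeomorph.contDiffAt_symm (f := θ) (f₀' := L') (n := ∞) ?_ ?_ ?_).contDiffWithinAt
  · exact hy.1
  · rw [hθ, hL']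
    exact (hc.differentiableAt (by simp)).hasFDerivAt
  · rwa [hθ]

section Manifold

variable {n : ℕ} {X : Type*} [TopologicalSpace X] [ChartedSpace (EuclideanSpace ℝ (Fin n)) X]

theorem contDiffOn_comp_chart_symm {χ : OpenPartialHomeomorph X (EuclideanSpace ℝ (Fin n))}
    (hχ : χ ∈ IsManifold.maximalAtlas (𝓡 n) ∞ X) {U : Set X} {F : Type*} [NormedAddCommGroup F]
    [NormedSpace ℝ F] {g : X → F} (hg : ContMDiffOn (𝓡 n) 𝓘(ℝ, F) ∞ g U) :
    ContDiffOn ℝ ∞ (g ∘ χ.symm) (χ.target ∩ χ.symm ⁻¹' U) := by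
  rw [← contMDiffOn_iff_contDiffOn]
  exact hg.comp ((contMDiffOn_symm_of_mem_maximalAtlas hχ).mono inter_subset_left)
    fun x hx => hx.2

variable [IsManifold (𝓡 n) ∞ X]

/-- The restriction of a chart to the preimage of an open subset of the target. -/
theorem exists_chart_target_eq {χ : OpenPartialHomeomorph X (EuclideanSpace ℝ (Fin n))}
    (hχ : χ ∈ IsManifold.maximalAtlas (𝓡 n) ∞ X) {V : Set (EuclideanSpace ℝ (Fin n))}
    (hV : IsOpen V) (hVχ : V ⊆ χ.target) :
    ∃ φ ∈ IsManifold.maximalAtlas (𝓡 n) ∞ X, (φ : X → _) = χ ∧ (φ.symm : _ → X) = χ.symm ∧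
      φ.target = V ∧ φ.source = χ.source ∩ χ ⁻¹' V := by
  have hT : (χ.symm.restrOpen V hV).symm.target = V := inter_eq_self_of_subset_right hVχ
  have hS : (χ.symm.restrOpen V hV).symm.source = χ.source ∩ χ ⁻¹' V := by
    ext x
    refine ⟨fun hx => ?_, fun hx => ?_⟩
    · have h := (χ.symm.restrOpen V hV).symm.map_source hx
      exact ⟨hx.1, h.2⟩
    · refine ⟨hx.1, ?_⟩
      exact hx.2
  refine ⟨(χ.symm.restrOpen V hV).symm, ?_, rfl, rfl, hT, hS⟩
  refine OpenPartialHomeomorph.mem_maximalAtlas_of_contMDiffOn _ ?_ ?_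
  · exact (contMDiffOn_of_mem_maximalAtlas hχ).mono (hS.trans_subset inter_subset_left)
  · exact (contMDiffOn_symm_of_mem_maximalAtlas hχ).mono (hT.trans_subset hVχ)

/-- Independent differentials extend to a basis of the cotangent space, so by the inverse function
theorem the functions can serve as coordinates in prescribed slots. -/
theorem exists_chart_of_independent {J : Type*} [Finite J] (o : J ↪ Fin n) {p : X} {U : Set X}
    (hU : IsOpen U) (hp : p ∈ U) (g : J → X → ℝ)
    (hg : ∀ j, ContMDiffOn (𝓡 n) 𝓘(ℝ, ℝ) ∞ (g j) U)
    (hsurj : Function.Surjective fun (v : TangentSpace (𝓡 n) p) (j : J) =>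
      (mfderiv (𝓡 n) 𝓘(ℝ, ℝ) (g j) p v : ℝ)) :
    ∃ φ ∈ IsManifold.maximalAtlas (𝓡 n) ∞ X, p ∈ φ.source ∧ φ.source ⊆ U ∧
      (∀ x ∈ φ.source, ∀ j, φ x (o j) = g j x) ∧ ((∀ j, g j p = 0) → φ p = 0) := by
  classical
  have := Fintype.ofFinite J
  let χ := chartAt (EuclideanSpace ℝ (Fin n)) p
  have hχ : χ ∈ IsManifold.maximalAtlas (𝓡 n) ∞ X := IsManifold.chart_mem_maximalAtlas p
  have hpχ : p ∈ χ.source := mem_chart_source _ p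
  let Ω := χ.target ∩ χ.symm ⁻¹' U
  have hΩ : IsOpen Ω := χ.isOpen_inter_preimage_symm hU
  have hz : χ p ∈ Ω := ⟨χ.map_source hpχ, by simpa [χ.left_inv hpχ] using hp⟩
  have hgc (j) : ContDiffOn ℝ ∞ (g j ∘ χ.symm) Ω := contDiffOn_comp_chart_symm hχ (hg j)
  let D (j) := fderiv ℝ (g j ∘ χ.symm) (χ p)
  have hD (j) : HasFDerivAt (g j ∘ χ.symm) (D j) (χ p) :=
    (((hgc j).contDiffAt (hΩ.mem_nhds hz)).differentiableAt (by simp)).hasFDerivAt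
  let Λ : EuclideanSpace ℝ (Fin n) →ₗ[ℝ] (J → ℝ) := LinearMap.pi fun j => (D j : _ →ₗ[ℝ] ℝ)
  have hΛ : Function.Surjective Λ := by
    intro w
    obtain ⟨v, hv⟩ := hsurj w
    have hχd : MDifferentiableAt (𝓡 n) (𝓡 n) χ p :=
      (contMDiffAt_of_mem_maximalAtlas hχ hpχ).mdifferentiableAt (by simp)
    refine ⟨mfderiv (𝓡 n) (𝓡 n) χ p v, ?_⟩
    ext j
    rw [← hv]
    have hg' : HasMFDerivAt (𝓡 n) 𝓘(ℝ, ℝ) ((g j ∘ χ.symm) ∘ χ) p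
        ((D j).comp (mfderiv (𝓡 n) (𝓡 n) χ p)) :=
      HasMFDerivAt.comp p (hD j).hasMFDerivAt hχd.hasMFDerivAt
    have heq : (g j ∘ χ.symm) ∘ χ =ᶠ[𝓝 p] g j := by
      filter_upwards [χ.open_source.mem_nhds hpχ] with x hx
      simp [χ.left_inv hx]
    have h1 := (hg'.congr_of_eventuallyEq heq.symm).mfderiv
    simp only [h1]
    rfl
  obtain ⟨L, hL⟩ := exists_continuousLinearEquiv_extending o Λ hΛ
  -- `F` replaces the coordinate `o j` of the linear map `L` by `g j` itself. Both have the same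
  -- derivative at `χ p`, so the correction does not change the derivative `L` of `F` there.
  let F : EuclideanSpace ℝ (Fin n) → EuclideanSpace ℝ (Fin n) := fun z =>
    L (z - χ p) + ∑ j, ((g j ∘ χ.symm) z - D j (z - χ p)) • EuclideanSpace.single (o j) (1 : ℝ)
  have hFc : ContDiffOn ℝ ∞ F Ω := by
    refine (L.contDiff.comp (contDiff_id.sub contDiff_const)).contDiffOn.add
      (ContDiffOn.sum fun j _ => ?_)
    exact ((hgc j).sub ((D j).contDiff.comp
      (contDiff_id.sub contDiff_const)).contDiffOn).smul contDiffOn_const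
  have hFd : HasFDerivAt F (L : _ →L[ℝ] _) (χ p) := by
    have hid := (hasFDerivAt_id (𝕜 := ℝ) (χ p)).sub_const (χ p)
    have h := (L.hasFDerivAt.comp (χ p) hid).add (HasFDerivAt.fun_sum (u := Finset.univ) fun j _ =>
      ((hD j).sub ((D j).hasFDerivAt.comp (χ p) hid)).smul_const
        (EuclideanSpace.single (o j) (1 : ℝ)))
    refine h.congr_fderiv ?_
    ext v
    simp
  have hFo (z j) : F z (o j) = g j (χ.symm z) := by
    have h1 : (∑ i, ((g i ∘ χ.symm) z - D i (z - χ p)) • EuclideanSpace.single (o i) (1 : ℝ)) (o j) =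
        (g j ∘ χ.symm) z - D j (z - χ p) := by
      simp [Finset.sum_apply, Pi.single_apply, o.injective.eq_iff]
    have h2 : F z (o j) = L (z - χ p) (o j) +
      (∑ i, ((g i ∘ χ.symm) z - D i (z - χ p)) • EuclideanSpace.single (o i) (1 : ℝ)) (o j) := rfl
    rw [h2, h1, hL]
    simp [Λ]
  obtain ⟨θ, hθF, hzθ, hθΩ, hθ⟩ := exists_openPartialHomeomorph_of_contDiffOn hΩ hz hFc L hFd
  have hsrc : (χ.trans θ).source ⊆ χ.source ∩ U := fun x hx => by
    rw [OpenPartialHomeomorph.trans_source] at hx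
    refine ⟨hx.1, ?_⟩
    have := (hθΩ hx.2).2
    rwa [mem_preimage, χ.left_inv hx.1] at this
  refine ⟨χ.trans θ, OpenPartialHomeomorph.mem_maximalAtlas_of_contMDiffOn _ ?_ ?_, ?_,
    fun x hx => (hsrc hx).2, fun x hx j => ?_, fun h0 => ?_⟩
  · refine ContMDiffOn.comp (t := θ.source) (g := θ) ?_
      ((contMDiffOn_of_mem_maximalAtlas hχ).mono fun x hx => (hsrc hx).1) fun x hx => ?_
    · rw [contMDiffOn_iff_contDiffOn, hθF]
      exact hFc.mono hθΩ
    · rw [OpenPartialHomeomorph.trans_source] at hx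
      exact hx.2
  · refine ContMDiffOn.comp (t := χ.target) (g := χ.symm) (contMDiffOn_symm_of_mem_maximalAtlas hχ)
      (f := θ.symm) ?_ fun x hx => ?_
    · rw [contMDiffOn_iff_contDiffOn]
      exact hθ.mono fun x hx => (by rw [OpenPartialHomeomorph.trans_target] at hx; exact hx.1)
    · rw [OpenPartialHomeomorph.trans_target] at hx
      exact hx.2
  · rw [OpenPartialHomeomorph.trans_source]
    exact ⟨hpχ, hzθ⟩
  · have h : (χ.trans θ) x = F (χ x) := by rw [OpenPartialHomeomorph.coe_trans, hθF]; rfl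
    rw [h, hFo, χ.left_inv (hsrc hx).1]
  · have h : (χ.trans θ) p = F (χ p) := by rw [OpenPartialHomeomorph.coe_trans, hθF]; rfl
    rw [h]
    simp [F, χ.left_inv hpχ, h0]

end Manifold

/-! ### Tangent vectors and tangent spaces in charts -/

section TangentSpace

variable {n : ℕ} {X : Type*} [TopologicalSpace X] [ChartedSpace (EuclideanSpace ℝ (Fin n)) X]

/-- The differential at `p` of a real-valued function, as a functional on the model space. -/
noncomputable def differential (g : X → ℝ) (p : X) : EuclideanSpace ℝ (Fin n) →L[ℝ] ℝ :=
  mfderiv (𝓡 n) 𝓘(ℝ, ℝ) g p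

theorem mdifferentiableAt_coord {ψ : OpenPartialHomeomorph X (EuclideanSpace ℝ (Fin n))}
    (hψ : ψ ∈ IsManifold.maximalAtlas (𝓡 n) ∞ X) {p : X} (hp : p ∈ ψ.source) (j : Fin n) :
    MDifferentiableAt (𝓡 n) 𝓘(ℝ, ℝ) (fun x => ψ x j) p :=
  ((EuclideanSpace.proj (𝕜 := ℝ) j).contMDiff.contMDiffAt.comp p
    (contMDiffAt_of_mem_maximalAtlas hψ hp)).mdifferentiableAt (n := ∞) (by simp)

theorem contMDiffOn_coord {ψ : OpenPartialHomeomorph X (EuclideanSpace ℝ (Fin n))}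
    (hψ : ψ ∈ IsManifold.maximalAtlas (𝓡 n) ∞ X) (j : Fin n) :
    ContMDiffOn (𝓡 n) 𝓘(ℝ, ℝ) ∞ (fun x => ψ x j) ψ.source :=
  (EuclideanSpace.proj (𝕜 := ℝ) j).contMDiff.comp_contMDiffOn (contMDiffOn_of_mem_maximalAtlas hψ)

/-- The curve is a straight line in the chart. It shows that the coordinate differentials are
independent, and it provides curves inside coordinate planes. -/
theorem exists_velocity_eq {ψ : OpenPartialHomeomorph X (EuclideanSpace ℝ (Fin n))}
    (hψ : ψ ∈ IsManifold.maximalAtlas (𝓡 n) ∞ X) {p : X} (hp : p ∈ ψ.source)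
    (w : EuclideanSpace ℝ (Fin n)) :
    ∃ γ : ℝ → X, γ 0 = p ∧ ContMDiffAt 𝓘(ℝ, ℝ) (𝓡 n) ∞ γ 0 ∧
      (∀ᶠ t in 𝓝 0, γ t ∈ ψ.source ∧ ψ (γ t) = ψ p + t • w) ∧
      ∀ j, differential (fun x => ψ x j) p (mfderiv 𝓘(ℝ, ℝ) (𝓡 n) γ 0 (1 : ℝ))
        = w j := by
  let c : ℝ → EuclideanSpace ℝ (Fin n) := fun t => ψ p + t • w
  have hc : ContDiff ℝ ∞ c := by fun_prop
  have hc0 : c 0 = ψ p := by simp [c]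
  have hγ0 : (ψ.symm ∘ c) 0 = p := by simp [hc0, ψ.left_inv hp]
  have hγ : ContMDiffAt 𝓘(ℝ, ℝ) (𝓡 n) ∞ (ψ.symm ∘ c) 0 := by
    refine ContMDiffAt.comp (0 : ℝ) ?_ hc.contMDiff.contMDiffAt
    rw [hc0]
    exact contMDiffAt_symm_of_mem_maximalAtlas hψ (ψ.map_source hp)
  have hev : ∀ᶠ t in 𝓝 (0 : ℝ), c t ∈ ψ.target :=
    hc.continuous.continuousAt.eventually_mem
      (ψ.open_target.mem_nhds (by rw [hc0]; exact ψ.map_source hp))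
  refine ⟨ψ.symm ∘ c, hγ0, hγ, ?_, fun j => ?_⟩
  · filter_upwards [hev] with t ht
    exact ⟨ψ.map_target ht, ψ.right_inv ht⟩
  · have h1 := mfderiv_comp_of_eq (f := ψ.symm ∘ c) (g := fun x => ψ x j) (x := (0 : ℝ)) (y := p)
      (I := 𝓘(ℝ, ℝ)) (I' := 𝓡 n) (I'' := 𝓘(ℝ, ℝ))
      (mdifferentiableAt_coord hψ hp j) (hγ.mdifferentiableAt (by simp)) hγ0
    have h2 : (fun x => ψ x j) ∘ (ψ.symm ∘ c) =ᶠ[𝓝 0] fun t => ψ p j + t * w j := by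
      filter_upwards [hev] with t ht
      simp [ψ.right_inv ht, c]
    have h3 : HasDerivAt (fun t : ℝ => ψ p j + t * w j) (w j) 0 := by
      simpa using ((hasDerivAt_id (0 : ℝ)).mul_const (w j)).const_add (ψ p j)
    have h4 : mfderiv 𝓘(ℝ, ℝ) 𝓘(ℝ, ℝ) ((fun x => ψ x j) ∘ (ψ.symm ∘ c)) 0 (1 : ℝ) = w j := by
      rw [h2.mfderiv_eq, mfderiv_eq_fderiv]
      rw [h3.hasFDerivAt.fderiv]
      exact one_mul (w j)
    rw [h1, hγ0] at h4
    exact h4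

theorem mfderiv_coord_injective {ψ : OpenPartialHomeomorph X (EuclideanSpace ℝ (Fin n))}
    (hψ : ψ ∈ IsManifold.maximalAtlas (𝓡 n) ∞ X) {p : X} (hp : p ∈ ψ.source)
    (v : TangentSpace (𝓡 n) p)
    (hv : ∀ j, differential (n := n) (fun x => ψ x j) p v = 0) : v = 0 := by
  have hinj : Function.Injective (fun (v : EuclideanSpace ℝ (Fin n)) (j : Fin n) =>
      differential (fun x => ψ x j) p v) := by
    let Λ : EuclideanSpace ℝ (Fin n) →ₗ[ℝ] (Fin n → ℝ) := LinearMap.pi fun j =>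
      (differential (fun x => ψ x j) p).toLinearMap
    have : Function.Surjective Λ := fun w => by
      obtain ⟨γ, -, -, -, h⟩ := exists_velocity_eq hψ hp (WithLp.toLp 2 w)
      exact ⟨mfderiv 𝓘(ℝ, ℝ) (𝓡 n) γ 0 (1 : ℝ), funext h⟩
    exact (LinearMap.injective_iff_surjective_of_finrank_eq_finrank (by simp)).2 this
  refine hinj (funext fun j => (hv j).trans ?_)
  exact (map_zero (differential (n := n) (fun x => ψ x j) p)).symm

/-- In a chart in which `S` is a coordinate plane, its tangent space is a coordinate plane. -/
theorem mem_submanifoldTangentSpace_iff {S : Set X} {d : ℕ}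
    {ψ : OpenPartialHomeomorph X (EuclideanSpace ℝ (Fin n))}
    (hψ : ψ ∈ IsManifold.maximalAtlas (𝓡 n) ∞ X) {p : X} (hp : p ∈ ψ.source) (hpS : p ∈ S)
    (hS : ∀ x ∈ ψ.source, (x ∈ S ↔ ∀ j : Fin n, d ≤ (j : ℕ) → ψ x j = 0))
    (v : TangentSpace (𝓡 n) p) :
    v ∈ submanifoldTangentSpace S p ↔
      ∀ j : Fin n, d ≤ (j : ℕ) → differential (n := n) (fun x => ψ x j) p v = 0 := by
  constructor
  · intro hv j hj
    have hle : submanifoldTangentSpace S p ≤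
        LinearMap.ker (differential (n := n) (fun x => ψ x j) p).toLinearMap := by
      refine Submodule.span_le.2 ?_
      rintro _ ⟨γ, hγ0, hγ, hγS, rfl⟩
      have h1 := mfderiv_comp_of_eq (f := γ) (g := fun x => ψ x j) (x := (0 : ℝ)) (y := p)
        (I := 𝓘(ℝ, ℝ)) (I' := 𝓡 n) (I'' := 𝓘(ℝ, ℝ))
        (mdifferentiableAt_coord hψ hp j) (hγ.mdifferentiableAt (by simp)) hγ0
      have h2 : (fun x => ψ x j) ∘ γ =ᶠ[𝓝 0] fun _ => 0 := by
        have hs : ∀ᶠ t in 𝓝 (0 : ℝ), γ t ∈ ψ.source :=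
          hγ.continuousAt.eventually_mem (ψ.open_source.mem_nhds (by rw [hγ0]; exact hp))
        filter_upwards [hγS, hs] with t ht hts
        exact (hS _ hts).1 ht j hj
      rw [h2.mfderiv_eq, mfderiv_const, hγ0] at h1
      have h3 := congrArg (fun f => f (1 : ℝ)) h1
      exact h3.symm
    exact hle hv
  · intro hv
    -- The line with the coordinates of `v` stays in the plane `S`, so `v` is itself a velocity and
    -- the span adds nothing.
    obtain ⟨γ, hγ0, hγ, hev, hw⟩ := exists_velocity_eq hψ hp
      (WithLp.toLp 2 fun j => differential (fun x => ψ x j) p v)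
    refine Submodule.subset_span ⟨γ, hγ0, hγ, ?_, ?_⟩
    · filter_upwards [hev] with t ht
      refine (hS _ ht.1).2 fun j hj => ?_
      rw [ht.2]
      simp only [PiLp.add_apply, PiLp.smul_apply, (hS p hp).1 hpS j hj, hv j hj]
      simp
    · subst hγ0
      refine sub_eq_zero.1 (mfderiv_coord_injective hψ hp _ fun j => ?_)
      refine (map_sub (differential (n := n) (fun x => ψ x j) (γ 0)) v _).trans ?_
      exact sub_eq_zero.2 (hw j).symm

end TangentSpace

/-- The codimension of the common kernel of functionals is their rank. This turns transversality
into independence of differentials. -/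
theorem surjective_of_finrank_quotient_ker {E J : Type*} [Fintype J] [AddCommGroup E] [Module ℝ E]
    (Λ : E →ₗ[ℝ] (J → ℝ)) (h : Module.finrank ℝ (E ⧸ LinearMap.ker Λ) = Fintype.card J) :
    Function.Surjective Λ := by
  rw [← LinearMap.range_eq_top]
  refine Submodule.eq_top_of_finrank_eq ?_
  rw [Module.finrank_fintype_fun_eq_card, ← h]
  exact Λ.quotKerEquivRange.finrank_eq.symm

theorem finrank_quotient_ker_of_surjective {E J : Type*} [Fintype J] [AddCommGroup E] [Module ℝ E]
    (Λ : E →ₗ[ℝ] (J → ℝ)) (h : Function.Surjective Λ) :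
    Module.finrank ℝ (E ⧸ LinearMap.ker Λ) = Fintype.card J := by
  rw [(Λ.quotKerEquivOfSurjective h).finrank_eq, Module.finrank_fintype_fun_eq_card]

/-! ## Adapted charts -/

/-- `φ` is a chart around `p`, with a ball as target, in which `π` is the product of the first `k`
coordinates and in which each `S i` through `p` is the plane of the vanishing of the coordinates in
a block `B i` of the others. -/
structure IsAdaptedChart {n m : ℕ} {X : Type*} [TopologicalSpace X]
    [ChartedSpace (EuclideanSpace ℝ (Fin n)) X] (π : C(X, Ioo (-1 : ℝ) 1)) (S : Fin m → Set X)
    (d : Fin m → ℕ) (p : X) (k : ℕ) (hk : k ≤ n) (B : Fin m → Finset (Fin n)) (r : ℝ)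
    (φ : OpenPartialHomeomorph X (EuclideanSpace ℝ (Fin n))) : Prop where
  mem_maximalAtlas : φ ∈ IsManifold.maximalAtlas (𝓡 n) ∞ X
  mem_source : p ∈ φ.source
  radius_pos : 0 < r
  target_eq : φ.target = Metric.ball (φ p) r
  one_le : 1 ≤ k
  eq_prod : ∀ x ∈ φ.source, (π x : ℝ) = ∏ j : Fin k, φ x (Fin.castLE hk j)
  map_eq_zero : (π p : ℝ) = 0 → φ p = 0
  eq_one : (π p : ℝ) ≠ 0 → k = 1
  ne_zero : (π p : ℝ) ≠ 0 → ∀ x ∈ φ.source, (π x : ℝ) ≠ 0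
  le_of_mem_block : ∀ i, ∀ j ∈ B i, k ≤ (j : ℕ)
  disjoint_block : ∀ i i', i ≠ i' → Disjoint (B i) (B i')
  card_block : ∀ i, p ∈ S i → (B i).card = n - d i
  mem_iff : ∀ i, p ∈ S i → ∀ x ∈ φ.source, (x ∈ S i ↔ ∀ j ∈ B i, φ x j = 0)
  notMem : ∀ i, p ∉ S i → ∀ x ∈ φ.source, x ∉ S i

section

variable {n m : ℕ} {X : Type*} [TopologicalSpace X] [ChartedSpace (EuclideanSpace ℝ (Fin n)) X]
  {π : C(X, Ioo (-1 : ℝ) 1)}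

/-- The branches of the fibre of `π` through `p` have equations whose product is `π`. -/
theorem exists_branch_equations (hπ : IsSmoothSemistableDegeneration n π) (p : X) :
    ∃ (k : ℕ) (_ : k ≤ n) (h : Fin k → X → ℝ) (U : Set X), IsOpen U ∧ p ∈ U ∧
      (∀ j, ContMDiffOn (𝓡 n) 𝓘(ℝ, ℝ) ∞ (h j) U) ∧ 1 ≤ k ∧
      (∀ x ∈ U, (π x : ℝ) = ∏ j, h j x) ∧ ((π p : ℝ) = 0 → ∀ j, h j p = 0) ∧
      ((π p : ℝ) ≠ 0 → k = 1) ∧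
      IsFibreTangentHyperplanes π p k
        (fun j => LinearMap.ker (differential (n := n) (h j) p).toLinearMap) ∧
      ∀ j, differential (n := n) (h j) p ≠ 0 := by
  by_cases hp : (π p : ℝ) = 0
  · obtain ⟨k, hk, φ, hφ⟩ := hπ.isNormalCrossingFunction.exists_chart p hp
    refine ⟨k, hk, fun j x => φ x (Fin.castLE hk j), φ.source, φ.open_source, hφ.mem_source,
      fun j => contMDiffOn_coord hφ.mem_maximalAtlas _, hφ.one_le, hφ.eq_prod,
      fun _ j => by simp [hφ.map_eq_zero], fun h => absurd hp h, Or.inr ⟨hp, hk, φ, hφ,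
      fun j => rfl⟩, fun j hj => ?_⟩
    obtain ⟨γ, -, -, -, h⟩ := exists_velocity_eq hφ.mem_maximalAtlas hφ.mem_source
      (EuclideanSpace.single (Fin.castLE hk j) (1 : ℝ))
    have h1 := h (Fin.castLE hk j)
    rw [hj] at h1
    simp only [PiLp.single_apply, if_true] at h1
    exact zero_ne_one h1
  · have hsurj := hπ.submersive p hp
    have hne : differential (n := n) (fun x => (π x : ℝ)) p ≠ 0 := fun h0 => by
      obtain ⟨v, hv⟩ := hsurj (1 : ℝ)
      have : differential (n := n) (fun x => (π x : ℝ)) p v = 1 := hv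
      rw [h0] at this
      exact zero_ne_one this
    have hn : 1 ≤ n := by
      by_contra hn
      obtain rfl : n = 0 := by omega
      exact hne (ContinuousLinearMap.ext fun v => by rw [Subsingleton.elim v 0]; simp)
    exact ⟨1, hn, fun _ x => (π x : ℝ), univ, isOpen_univ, mem_univ _,
      fun _ => hπ.isNormalCrossingFunction.contMDiff.contMDiffOn, le_rfl, fun x _ => by simp,
      fun h => absurd h hp, fun _ => rfl, Or.inl ⟨hp, rfl, fun j => rfl⟩, fun _ => hne⟩

variable [IsManifold (𝓡 n) ∞ X]

/-- Near `p` the fibre branches and the `S i` through `p` are given by equations with independent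
differentials within each family member. Transversality makes all these differentials independent
together, so the equations are simultaneously part of a coordinate system. -/
theorem exists_adaptedChart (hπ : IsSmoothSemistableDegeneration n π) {S : Fin m → Set X}
    {d : Fin m → ℕ} (hclosed : ∀ i, IsClosed (S i)) (hsub : ∀ i, IsSubmanifold n (d i) (S i))
    (htrans : IsTransversalCollection n π S) (p : X) :
    ∃ (k : ℕ) (hk : k ≤ n) (B : Fin m → Finset (Fin n)) (r : ℝ)
      (φ : OpenPartialHomeomorph X (EuclideanSpace ℝ (Fin n))),
      IsAdaptedChart π S d p k hk B r φ := by
  classical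
  obtain ⟨k, hk, h, U, hU, hpU, hh, hk1, hprod, hzero, hone, hH, hne⟩ :=
    exists_branch_equations hπ p
  choose ψ hψ hpψ hψS using fun i : {i // p ∈ S i} => (hsub i).2 p i.2
  have hdn (i) : d i ≤ n := (hsub i).1
  have hk' := hk
  let J₂ := Σ i : {i // p ∈ S i}, {j : Fin n // d i ≤ (j : ℕ)}
  let g : Fin k ⊕ J₂ → X → ℝ := Sum.elim h fun a x => ψ a.1 x a.2
  have hcard (i) : Fintype.card {j : Fin n // d i ≤ (j : ℕ)} = n - d i := by
    rw [Fintype.card_subtype]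
    have := Fin.card_filter_val_lt (n := n) (m := d i)
    have h2 := Finset.card_filter_add_card_filter_not (s := (Finset.univ : Finset (Fin n)))
      (fun j => (j : ℕ) < d i)
    have h3 := hdn i
    simp only [not_lt, Finset.card_univ, Fintype.card_fin] at h2
    omega
  let Λ : EuclideanSpace ℝ (Fin n) →ₗ[ℝ] (Fin k ⊕ J₂ → ℝ) :=
    LinearMap.pi fun j => (differential (n := n) (g j) p).toLinearMap
  let W := Sum.elim (fun j => LinearMap.ker (differential (n := n) (h j) p).toLinearMap)
    (fun i : {i : Fin m // p ∈ S i} => submanifoldTangentSpace (n := n) (S i) p)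
  have hW : IsTransversalFamily W := htrans p k _ hH
  have hT (i : {i // p ∈ S i}) : submanifoldTangentSpace (n := n) (S i) p =
      LinearMap.ker (LinearMap.pi fun j : {j : Fin n // d i ≤ (j : ℕ)} =>
        (differential (n := n) (fun x => ψ i x j) p).toLinearMap) := by
    refine Submodule.ext fun v : EuclideanSpace ℝ (Fin n) =>
      (mem_submanifoldTangentSpace_iff (hψ i) (hpψ i) i.2 (hψS i) v).trans ?_
    exact ⟨fun hv => funext fun j => hv j j.2, fun hv j hj => congrFun hv ⟨j, hj⟩⟩
  have hker : LinearMap.ker Λ = ⨅ a, W a := by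
    ext v
    simp only [Submodule.mem_iInf, LinearMap.mem_ker]
    constructor
    · rintro hv (j | i)
      · exact congrFun hv (Sum.inl j)
      · change v ∈ submanifoldTangentSpace (n := n) (S i) p
        rw [hT]
        exact funext fun j => congrFun hv (Sum.inr ⟨i, j⟩)
    · intro hv
      ext (j | ⟨i, j⟩)
      · exact hv (Sum.inl j)
      · have := hv (Sum.inr i)
        change v ∈ submanifoldTangentSpace (n := n) (S i) p at this
        rw [hT] at this
        exact congrFun this j
  have hΛ : Function.Surjective Λ := by
    refine surjective_of_finrank_quotient_ker Λ ?_
    rw [hker]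
    refine Eq.trans hW ?_
    rw [Fintype.sum_sum_type, Fintype.card_sum, Fintype.card_sigma, Fintype.card_fin]
    -- Each hyperplane has codimension `1` and each tangent space codimension `n - d i`, so the
    -- codimensions add up to the number of equations.
    congr 1
    · refine (Finset.sum_congr rfl (g := fun _ => 1) fun j _ => ?_).trans (by simp)
      · have h1 := finrank_quotient_ker_of_surjective (J := Unit)
          (LinearMap.pi fun _ => (differential (n := n) (h j) p).toLinearMap) fun w => by
            obtain ⟨v, hv⟩ := LinearMap.surjective (f := (differential (n := n) (h j) p).toLinearMap)
              (fun h0 => hne j (ContinuousLinearMap.coe_injective h0)) (w ())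
            exact ⟨v, funext fun _ => hv⟩
        have h2 : LinearMap.ker (differential (n := n) (h j) p).toLinearMap = LinearMap.ker
            (LinearMap.pi fun _ : Unit => (differential (n := n) (h j) p).toLinearMap) :=
          Submodule.ext fun v => ⟨fun hv => funext fun _ => hv, fun hv => congrFun hv ()⟩
        change Module.finrank ℝ (EuclideanSpace ℝ (Fin n) ⧸
          LinearMap.ker (differential (n := n) (h j) p).toLinearMap) = 1
        rw [h2]
        exact h1.trans Fintype.card_unit
    · refine Finset.sum_congr rfl fun i _ => ?_
      change Module.finrank ℝ (_ ⧸ submanifoldTangentSpace (n := n) (S i) p) = _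
      rw [hT]
      refine finrank_quotient_ker_of_surjective _ fun w => ?_
      obtain ⟨γ, -, -, -, hγ⟩ := exists_velocity_eq (hψ i) (hpψ i)
        (WithLp.toLp 2 fun j => if hj : d i ≤ (j : ℕ) then w ⟨j, hj⟩ else 0)
      refine ⟨_, funext fun j => (hγ j).trans ?_⟩
      simp [j.2]
  -- Since `Λ` is surjective, there are at most `n` equations. The slots from `k` on therefore have
  -- room for those of the submanifolds.
  have hcardle : Fintype.card J₂ ≤ n - k := by
    have h1 := LinearMap.finrank_le_finrank_of_injective (f := (LinearMap.exists_rightInverse_of_surjective Λ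
      (LinearMap.range_eq_top.2 hΛ)).choose) (LinearMap.ker_eq_bot.1 (LinearMap.ker_eq_bot_of_inverse
        (LinearMap.exists_rightInverse_of_surjective Λ (LinearMap.range_eq_top.2 hΛ)).choose_spec))
    rw [Module.finrank_fintype_fun_eq_card, finrank_euclideanSpace_fin, Fintype.card_sum,
      Fintype.card_fin] at h1
    omega
  let ε := Fintype.equivFin J₂
  let o₂ : J₂ → Fin n := fun a => ⟨k + ε a, by have := (ε a).2; omega⟩
  have ho₂ : Function.Injective o₂ := fun a b hab => by
    have : k + (ε a : ℕ) = k + ε b := congrArg Fin.val hab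
    exact ε.injective (Fin.ext (by omega))
  let o : Fin k ⊕ J₂ ↪ Fin n := ⟨Sum.elim (Fin.castLE hk) o₂, by
    refine Function.Injective.sumElim (Fin.castLE_injective hk) ho₂ fun a b hab => ?_
    have h1 : (a : ℕ) = k + ε b := congrArg Fin.val hab
    have := a.2
    omega⟩
  -- The chart is kept inside the domains of all equations, away from the closed `S i` not
  -- containing `p`, and away from the special fibre if `p` is not on it.
  let V : Set X := U ∩ (⋂ i, (ψ i).source) ∩ (⋂ i : {i // p ∉ S i}, (S i)ᶜ) ∩
    {x | (π p : ℝ) ≠ 0 → (π x : ℝ) ≠ 0}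
  have hV : IsOpen V := by
    have h4 : IsOpen {x | (π p : ℝ) ≠ 0 → (π x : ℝ) ≠ 0} := by
      by_cases h0 : (π p : ℝ) = 0
      · simp [h0]
      · simp only [ne_eq, h0, not_false_eq_true, forall_const]
        exact isOpen_ne_fun (f := fun x => (π x : ℝ)) (by fun_prop) continuous_const
    exact ((hU.inter (isOpen_iInter_of_finite fun i => (ψ i).open_source)).inter
      (isOpen_iInter_of_finite fun i : {i // p ∉ S i} => (hclosed i.1).isOpen_compl)).inter h4
  have hpV : p ∈ V := ⟨⟨⟨hpU, mem_iInter.2 hpψ⟩, mem_iInter.2 fun i => i.2⟩, fun h => h⟩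
  obtain ⟨χ, hχ, hpχ, hχV, hχo, hχ0⟩ := exists_chart_of_independent o hV hpV g (by
    rintro (j | a)
    · exact (hh j).mono fun x hx => hx.1.1.1
    · exact (contMDiffOn_coord (hψ a.1) a.2).mono fun x hx => mem_iInter.1 hx.1.1.2 a.1) hΛ
  -- A ball is convex and, if centred at `0`, stable under projection to coordinate planes; both
  -- properties are needed to control the sides.
  obtain ⟨r, hr, hrχ⟩ := Metric.isOpen_iff.1 χ.open_target _ (χ.map_source hpχ)
  obtain ⟨φ, hφ, hφχ, -, hφt, hφs⟩ := exists_chart_target_eq hχ Metric.isOpen_ball hrχ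
  have hsub' : φ.source ⊆ χ.source := hφs ▸ inter_subset_left
  have hsV {x} (hx : x ∈ φ.source) : x ∈ V := hχV (hsub' hx)
  refine ⟨k, hk, fun i => if hi : p ∈ S i then Finset.univ.map
    ⟨fun j : {j : Fin n // d i ≤ (j : ℕ)} => o₂ ⟨⟨i, hi⟩, j⟩,
      fun a b hab => eq_of_heq (Sigma.mk.inj_iff.1 (ho₂ hab)).2⟩ else ∅, r, φ, hφ, ?_, hr, ?_, hk1, ?_, ?_,
    hone, ?_, ?_, ?_, ?_, ?_, ?_⟩
  · rw [hφs]
    exact ⟨hpχ, Metric.mem_ball_self hr⟩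
  · rw [hφt, hφχ]
  · intro x hx
    rw [hprod x (hsV hx).1.1.1]
    exact Finset.prod_congr rfl fun j _ => by
      rw [hφχ]; exact (hχo x (hsub' hx) (Sum.inl j)).symm
  · intro h0
    rw [hφχ]
    refine hχ0 ?_
    rintro (j | ⟨i, j⟩)
    · exact hzero h0 j
    · exact (hψS i p (hpψ i)).1 i.2 j j.2
  · exact fun h0 x hx => (hsV hx).2 h0
  · intro i j hj
    split_ifs at hj with hi
    · obtain ⟨a, -, rfl⟩ := Finset.mem_map.1 hj
      exact Nat.le_add_right _ _
    · simp at hj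
  · intro i i' hii
    by_cases hi : p ∈ S i
    · by_cases hi' : p ∈ S i'
      · rw [dif_pos hi, dif_pos hi', Finset.disjoint_left]
        intro j hj hj'
        obtain ⟨a, -, rfl⟩ := Finset.mem_map.1 hj
        obtain ⟨b, -, hb⟩ := Finset.mem_map.1 hj'
        have := congrArg (fun a : J₂ => (a.1 : Fin m)) (ho₂ hb)
        exact hii this.symm
      · simp [hi']
    · simp [hi]
  · intro i hi
    rw [dif_pos hi, Finset.card_map, Finset.card_univ, hcard]
  · intro i hi x hx
    rw [hψS ⟨i, hi⟩ x (mem_iInter.1 (hsV hx).1.1.2 _), dif_pos hi, hφχ]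
    simp only [Finset.mem_map, Finset.mem_univ, true_and, forall_exists_index,
      forall_apply_eq_imp_iff]
    refine ⟨fun H a => ?_, fun H j hj => ?_⟩
    · exact (hχo x (hsub' hx) (Sum.inr ⟨⟨i, hi⟩, a⟩)).trans (H a a.2)
    · exact (hχo x (hsub' hx) (Sum.inr ⟨⟨i, hi⟩, ⟨j, hj⟩⟩)).symm.trans (H ⟨j, hj⟩)
  · intro i hi x hx
    exact mem_iInter.1 (hsV hx).1.2 ⟨i, hi⟩

end

/-! ## Slices -/

section CoordinatePlane

variable {e n : ℕ} (o : Fin e ↪ Fin n)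

/-- The projection to the coordinates in the range of `o`. -/
noncomputable def coordProj : EuclideanSpace ℝ (Fin n) →L[ℝ] EuclideanSpace ℝ (Fin e) :=
  LinearMap.toContinuousLinearMap
    ((WithLp.linearEquiv 2 ℝ (Fin e → ℝ)).symm.toLinearMap ∘ₗ
      LinearMap.funLeft ℝ ℝ o ∘ₗ (WithLp.linearEquiv 2 ℝ (Fin n → ℝ)).toLinearMap)

@[simp]
theorem coordProj_apply (z : EuclideanSpace ℝ (Fin n)) (a : Fin e) : coordProj o z a = z (o a) :=
  rfl

/-- The inclusion of the plane of the coordinates in the range of `o`. -/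
noncomputable def coordIncl : EuclideanSpace ℝ (Fin e) →L[ℝ] EuclideanSpace ℝ (Fin n) :=
  LinearMap.toContinuousLinearMap
    ((WithLp.linearEquiv 2 ℝ (Fin n → ℝ)).symm.toLinearMap ∘ₗ
      Function.ExtendByZero.linearMap ℝ o ∘ₗ (WithLp.linearEquiv 2 ℝ (Fin e → ℝ)).toLinearMap)

@[simp]
theorem coordIncl_apply (v : EuclideanSpace ℝ (Fin e)) (a : Fin e) : coordIncl o v (o a) = v a :=
  o.injective.extend_apply _ _ a

theorem coordIncl_apply_of_notMem (v : EuclideanSpace ℝ (Fin e)) {j : Fin n} (hj : j ∉ range o) :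
    coordIncl o v j = 0 :=
  Function.extend_apply' _ _ j hj

theorem coordProj_coordIncl (v : EuclideanSpace ℝ (Fin e)) : coordProj o (coordIncl o v) = v := by
  ext a
  simp

theorem coordIncl_coordProj {z : EuclideanSpace ℝ (Fin n)} (hz : ∀ j ∉ range o, z j = 0) :
    coordIncl o (coordProj o z) = z := by
  ext j
  by_cases hj : j ∈ range o
  · obtain ⟨a, rfl⟩ := hj
    simp
  · rw [coordIncl_apply_of_notMem o _ hj, hz j hj]

/-- This keeps the projection of a point to a coordinate plane inside a target ball centred at `0`.
-/
theorem norm_coordIncl_coordProj_le (z : EuclideanSpace ℝ (Fin n)) :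
    ‖coordIncl o (coordProj o z)‖ ≤ ‖z‖ := by
  rw [EuclideanSpace.norm_eq, EuclideanSpace.norm_eq]
  refine Real.sqrt_le_sqrt (Finset.sum_le_sum fun j _ => ?_)
  by_cases hj : j ∈ range o
  · obtain ⟨a, rfl⟩ := hj
    simp
  · rw [coordIncl_apply_of_notMem o _ hj]
    simp [sq_nonneg]

/-- The coordinates outside `range o` form the second factor. This is the linear normal form in
which the inclusion of a slice is an immersion. -/
theorem exists_equiv_coordIncl :
    ∃ L : (EuclideanSpace ℝ (Fin e) × EuclideanSpace ℝ (Fin (n - e))) ≃L[ℝ]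
      EuclideanSpace ℝ (Fin n), ∀ v, L (v, 0) = coordIncl o v := by
  classical
  have hcard : Fintype.card (Fin (n - e)) = Fintype.card {j // j ∉ range o} := by
    have h2 : Fintype.card {x // x ∈ range o} = e := by
      rw [Fintype.card_congr (Equiv.ofInjective o o.injective).symm, Fintype.card_fin]
    rw [Fintype.card_fin, Fintype.card_subtype_compl, h2, Fintype.card_fin]
  let c := Fintype.equivOfCardEq hcard
  let o' : Fin (n - e) ↪ Fin n := c.toEmbedding.trans (Function.Embedding.subtype _)
  have he : e ≤ n := by simpa using Fintype.card_le_of_embedding o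
  have hinj : Function.Injective ((coordProj o).prod (coordProj o')).toLinearMap := by
    refine (injective_iff_map_eq_zero _).2 fun z hz => ?_
    obtain ⟨h1, h2⟩ := Prod.ext_iff.1 hz
    ext j
    by_cases hj : j ∈ range o
    · obtain ⟨a, rfl⟩ := hj
      exact congrArg (fun w : EuclideanSpace ℝ (Fin e) => w a) h1
    · have h3 := congrArg (fun w : EuclideanSpace ℝ (Fin (n - e)) => w (c.symm ⟨j, hj⟩)) h2
      simpa [o'] using h3
  let L := (LinearEquiv.ofInjectiveOfFinrankEq ((coordProj o).prod (coordProj o')).toLinearMap hinj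
    (by simp; omega)).toContinuousLinearEquiv
  refine ⟨L.symm, fun v => ?_⟩
  rw [ContinuousLinearEquiv.symm_apply_eq]
  refine Prod.ext (coordProj_coordIncl o v).symm ?_
  ext b
  have h : coordProj o' (coordIncl o v) b = 0 :=
    coordIncl_apply_of_notMem o v (c b).2
  exact h.symm

end CoordinatePlane

section Slice

variable {e n : ℕ} {X : Type*} [TopologicalSpace X]

/-- The chart `φ` restricted to a subset `T` which is a coordinate plane in it. -/
noncomputable def sliceChart (o : Fin e ↪ Fin n) (T : Set X)
    (φ : OpenPartialHomeomorph X (EuclideanSpace ℝ (Fin n)))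
    (hT : ∀ x ∈ φ.source, (x ∈ T ↔ ∀ j ∉ range o, φ x j = 0)) (p : T) :
    OpenPartialHomeomorph T (EuclideanSpace ℝ (Fin e)) := by
  classical
  have hmem {v} (hv : coordIncl o v ∈ φ.target) : φ.symm (coordIncl o v) ∈ T := by
    rw [hT _ (φ.map_target hv), φ.right_inv hv]
    exact fun j hj => coordIncl_apply_of_notMem o v hj
  exact
  { toFun x := coordProj o (φ x)
    invFun v := if h : φ.symm (coordIncl o v) ∈ T then ⟨φ.symm (coordIncl o v), h⟩ else p
    source := Subtype.val ⁻¹' φ.source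
    target := coordIncl o ⁻¹' φ.target
    map_source' x hx := by
      rw [mem_preimage, coordIncl_coordProj o ((hT _ hx).1 x.2)]
      exact φ.map_source hx
    map_target' v hv := by
      rw [dif_pos (hmem hv)]
      exact φ.map_target hv
    left_inv' x hx := by
      have h : φ.symm (coordIncl o (coordProj o (φ x))) = x := by
        rw [coordIncl_coordProj o ((hT _ hx).1 x.2), φ.left_inv hx]
      rw [dif_pos (by rw [h]; exact x.2)]
      exact Subtype.ext h
    right_inv' v hv := by
      rw [dif_pos (hmem hv)]
      change coordProj o (φ (φ.symm (coordIncl o v))) = v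
      rw [φ.right_inv hv, coordProj_coordIncl]
    open_source := φ.open_source.preimage continuous_subtype_val
    open_target := φ.open_target.preimage (coordIncl o).continuous
    continuousOn_toFun := (coordProj o).continuous.comp_continuousOn
      (φ.continuousOn.comp continuous_subtype_val.continuousOn fun x hx => hx)
    continuousOn_invFun := by
      rw [IsInducing.subtypeVal.continuousOn_iff]
      refine (φ.continuousOn_symm.comp (coordIncl o).continuous.continuousOn
        fun v hv => hv).congr fun v hv => ?_
      simp only [Function.comp_apply]
      rw [dif_pos (hmem hv)] }

variable {o : Fin e ↪ Fin n} {T : Set X}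
  {φ : OpenPartialHomeomorph X (EuclideanSpace ℝ (Fin n))}
  {hT : ∀ x ∈ φ.source, (x ∈ T ↔ ∀ j ∉ range o, φ x j = 0)} {p : T}

theorem sliceChart_source : (sliceChart o T φ hT p).source = Subtype.val ⁻¹' φ.source := rfl

theorem sliceChart_apply (x : T) : sliceChart o T φ hT p x = coordProj o (φ x) := rfl

theorem coe_sliceChart_symm {v : EuclideanSpace ℝ (Fin e)}
    (hv : v ∈ (sliceChart o T φ hT p).target) :
    ((sliceChart o T φ hT p).symm v : X) = φ.symm (coordIncl o v) := by
  have h : φ.symm (coordIncl o v) ∈ T := by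
    rw [hT _ (φ.map_target hv), φ.right_inv hv]
    exact fun j hj => coordIncl_apply_of_notMem o v hj
  exact congrArg Subtype.val (dif_pos h)

end Slice

/-- Charts of `X` around the points of `T` in which `T` is a coordinate plane of dimension `e`. -/
structure SliceAtlas (n : ℕ) {X : Type*} [TopologicalSpace X]
    [ChartedSpace (EuclideanSpace ℝ (Fin n)) X] (e : ℕ) (T : Set X) where
  /-- The ambient chart around a point. -/
  chart : T → OpenPartialHomeomorph X (EuclideanSpace ℝ (Fin n))
  /-- The coordinates on `T`. -/
  index : T → Fin e ↪ Fin n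
  mem_maximalAtlas : ∀ p, chart p ∈ IsManifold.maximalAtlas (𝓡 n) ∞ X
  mem_source : ∀ p : T, (p : X) ∈ (chart p).source
  mem_iff : ∀ p, ∀ x ∈ (chart p).source, (x ∈ T ↔ ∀ j ∉ range (index p), chart p x j = 0)

namespace SliceAtlas

variable {e n : ℕ} {X : Type*} [TopologicalSpace X] [ChartedSpace (EuclideanSpace ℝ (Fin n)) X]
  {T : Set X} (A : SliceAtlas n e T)

/-- The chart of `T` around `p`. -/
noncomputable abbrev slice (p : T) : OpenPartialHomeomorph T (EuclideanSpace ℝ (Fin e)) :=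
  sliceChart (A.index p) T (A.chart p) (A.mem_iff p) p

/-- The manifold structure of `T`. -/
noncomputable abbrev chartedSpace : ChartedSpace (EuclideanSpace ℝ (Fin e)) T where
  atlas := range A.slice
  chartAt := A.slice
  mem_chart_source p := A.mem_source p
  chart_mem_atlas p := mem_range_self p

/-- The transition maps of `T` are those of `X` between a linear inclusion and a linear projection.
-/
theorem isManifold [IsManifold (𝓡 n) ∞ X] :
    @IsManifold _ _ _ _ _ _ _ (𝓡 e) ∞ T _ A.chartedSpace := by
  let _ := A.chartedSpace
  refine isManifold_of_contDiffOn _ _ _ ?_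
  rintro _ _ ⟨p, rfl⟩ ⟨q, rfl⟩
  simp only [modelWithCornersSelf_coe, modelWithCornersSelf_coe_symm, Function.id_comp,
    Function.comp_id, preimage_id, range_id, inter_univ]
  have hc : ContDiffOn ℝ ∞ (A.chart q ∘ (A.chart p).symm)
      ((A.chart p).target ∩ (A.chart p).symm ⁻¹' (A.chart q).source) :=
    contDiffOn_comp_chart_symm (A.mem_maximalAtlas p)
      (contMDiffOn_of_mem_maximalAtlas (A.mem_maximalAtlas q))
  have hsub : MapsTo (coordIncl (A.index p)) ((A.slice p).symm.trans (A.slice q)).source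
      ((A.chart p).target ∩ (A.chart p).symm ⁻¹' (A.chart q).source) := by
    intro v hv
    rw [OpenPartialHomeomorph.trans_source] at hv
    refine ⟨hv.1, ?_⟩
    have := hv.2
    rw [mem_preimage, sliceChart_source, mem_preimage, coe_sliceChart_symm hv.1] at this
    exact this
  refine ((coordProj (A.index q)).contDiff.comp_contDiffOn
    (hc.comp (coordIncl (A.index p)).contDiff.contDiffOn hsub)).congr fun v hv => ?_
  rw [OpenPartialHomeomorph.trans_source] at hv
  simp only [OpenPartialHomeomorph.coe_trans, Function.comp_apply, sliceChart_apply]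
  rw [coe_sliceChart_symm hv.1]

theorem isSmoothEmbedding [IsManifold (𝓡 n) ∞ X] :
    letI := A.chartedSpace
    Manifold.IsSmoothEmbedding (𝓡 e) (𝓡 n) ∞ (Subtype.val : T → X) := by
  let _ := A.chartedSpace
  have := A.isManifold
  refine ⟨⟨EuclideanSpace ℝ (Fin (n - e)), inferInstance, inferInstance, fun p => ?_⟩,
    IsEmbedding.subtypeVal⟩
  obtain ⟨L, hL⟩ := exists_equiv_coordIncl (A.index p)
  refine Manifold.IsImmersionAtOfComplement.mk_of_charts L (A.slice p) (A.chart p)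
    (A.mem_source p) (A.mem_source p) (IsManifold.chart_mem_maximalAtlas p) (A.mem_maximalAtlas p)
    (fun x hx => hx) fun v hv => ?_
  have hv' : v ∈ (A.slice p).target := by simpa using hv
  simp only [Function.comp_apply, hL]
  change A.chart p ((A.slice p).symm v : X) = _
  rw [coe_sliceChart_symm hv', (A.chart p).right_inv hv']

end SliceAtlas

/-- The increasing enumeration of `C` fixes the initial segment of length `k` contained in it. Thus
`π` is again the product of the first `k` coordinates in a slice chart. -/
theorem exists_embedding_range_eq {n k : ℕ} (hk : k ≤ n) (C : Finset (Fin n))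
    (hC : ∀ j : Fin n, (j : ℕ) < k → j ∈ C) :
    ∃ (o : Fin C.card ↪ Fin n) (hke : k ≤ C.card), range o = C ∧
      ∀ j : Fin k, o (Fin.castLE hke j) = Fin.castLE hk j := by
  have hke : k ≤ C.card := by
    have h := Finset.card_le_card (s := Finset.univ.map (Fin.castLEEmb hk)) (t := C) fun j hj => by
      obtain ⟨a, -, rfl⟩ := Finset.mem_map.1 hj
      exact hC _ a.2
    simpa using h
  let o := C.orderEmbOfFin rfl
  have hle (a : Fin C.card) : (a : ℕ) ≤ o a := by
    obtain ⟨a, ha⟩ := a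
    induction a with
    | zero => exact Nat.zero_le _
    | succ a ih =>
      have h1 := ih (by omega)
      have h2 : o ⟨a, by omega⟩ < o ⟨a + 1, ha⟩ := o.lt_iff_lt.2 (Fin.mk_lt_mk.2 (Nat.lt_succ_self a))
      have h3 : (o ⟨a, by omega⟩ : ℕ) < o ⟨a + 1, ha⟩ := h2
      simp only at h1 ⊢
      omega
  have hval : ∀ a : ℕ, ∀ ha : a < k, (o ⟨a, ha.trans_le hke⟩ : ℕ) = a := by
    intro a
    induction a using Nat.strong_induction_on with
    | _ a ih =>
      intro ha
      have hmem : (⟨a, ha.trans_le hk⟩ : Fin n) ∈ range o := by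
        rw [C.range_orderEmbOfFin rfl]
        exact hC _ ha
      obtain ⟨b, hb⟩ := hmem
      have hb' : (o b : ℕ) = a := congrArg Fin.val hb
      have h1 := hle b
      -- If `b < a`, the induction hypothesis gives `o b = b`, which contradicts `o b = a`.
      rcases lt_or_eq_of_le (h1.trans_eq hb') with h2 | h2
      · have h3 := ih b h2 (h2.trans ha)
        have h4 : (o b : ℕ) = b := h3
        omega
      · have : b = ⟨a, ha.trans_le hke⟩ := Fin.ext h2
        rw [← this, hb']
  exact ⟨o.toEmbedding, hke, C.range_orderEmbOfFin rfl, fun j => Fin.ext (hval j j.2)⟩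

/-! ### Intersections of the submanifolds -/

section

variable {n m : ℕ} {X : Type*} [TopologicalSpace X] [ChartedSpace (EuclideanSpace ℝ (Fin n)) X]
  {π : C(X, Ioo (-1 : ℝ) 1)} {S : Fin m → Set X} {d : Fin m → ℕ}

/-- The dimension of the intersection of the `S i` with `i ∈ I`. -/
def sliceDim (n : ℕ) (d : Fin m → ℕ) (I : Finset (Fin m)) : ℕ := n - ∑ i ∈ I, (n - d i)

/-- The blocks are disjoint, so removing them leaves a number of coordinates that is the same at
every point of the intersection. They also avoid the first `k` coordinates, which keep their places.
-/
theorem IsAdaptedChart.exists_index {p : X} {k : ℕ} {hk : k ≤ n} {B : Fin m → Finset (Fin n)}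
    {r : ℝ} {φ : OpenPartialHomeomorph X (EuclideanSpace ℝ (Fin n))}
    (h : IsAdaptedChart π S d p k hk B r φ) {I : Finset (Fin m)} (hp : p ∈ ⋂ i ∈ I, S i) :
    ∃ (o : Fin (sliceDim n d I) ↪ Fin n) (hke : k ≤ sliceDim n d I),
      (∀ j : Fin k, o (Fin.castLE hke j) = Fin.castLE hk j) ∧
      (∀ i ∈ I, ∀ j ∈ B i, j ∉ range o) ∧
      ∀ x ∈ φ.source, (x ∈ ⋂ i ∈ I, S i) ↔ ∀ j ∉ range o, φ x j = 0 := by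
  classical
  rw [mem_iInter₂] at hp
  have hcard : (I.biUnion B)ᶜ.card = sliceDim n d I := by
    rw [Finset.card_compl, Fintype.card_fin, Finset.card_biUnion fun i _ j _ hij =>
      h.disjoint_block i j hij, sliceDim, Finset.sum_congr rfl fun i hi => h.card_block i (hp i hi)]
  obtain ⟨o, hke, hrange, ho⟩ := exists_embedding_range_eq hk (I.biUnion B)ᶜ fun j hj => by
    rw [Finset.mem_compl, Finset.mem_biUnion]
    rintro ⟨i, -, hji⟩
    exact absurd (h.le_of_mem_block i j hji) (not_le.2 hj)
  rw [← hcard]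
  have hnot (j) : j ∉ range o ↔ ∃ i ∈ I, j ∈ B i := by
    rw [hrange, Finset.mem_coe, Finset.mem_compl, not_not, Finset.mem_biUnion]
  refine ⟨o, hke, ho, fun i hi j hj => (hnot j).2 ⟨i, hi, hj⟩, fun x hx => ?_⟩
  rw [mem_iInter₂]
  refine ⟨fun H j hj => ?_, fun H i hi => ?_⟩
  · obtain ⟨i, hi, hji⟩ := (hnot j).1 hj
    exact (h.mem_iff i (hp i hi) x hx).1 (H i hi) j hji
  · exact (h.mem_iff i (hp i hi) x hx).2 fun j hj => H j ((hnot j).2 ⟨i, hi, hj⟩)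

/-- Slicing removes none of the factors of `π`, so the slice charts are normal crossing charts. Off
the special fibre `k = 1`, and `π` is itself a slice coordinate, hence submersive. Properness
survives because the intersection is closed. -/
theorem isSmoothSemistableDegeneration_restrictTo [IsManifold (𝓡 n) ∞ X]
    (hπ : IsSmoothSemistableDegeneration n π) (hclosed : ∀ i, IsClosed (S i))
    (hsub : ∀ i, IsSubmanifold n (d i) (S i)) (htrans : IsTransversalCollection n π S)
    (I : Finset (Fin m)) :
    ∃ (e : ℕ) (_ : ChartedSpace (EuclideanSpace ℝ (Fin e)) ↥(⋂ i ∈ I, S i))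
      (_ : IsManifold (𝓡 e) ∞ ↥(⋂ i ∈ I, S i)),
      Manifold.IsSmoothEmbedding (𝓡 e) (𝓡 n) ∞ (Subtype.val : ↥(⋂ i ∈ I, S i) → X) ∧
      IsSmoothSemistableDegeneration e (restrictTo π (⋂ i ∈ I, S i)) := by
  choose k hk B r φ hφ using exists_adaptedChart hπ hclosed hsub htrans
  choose o hke ho _ hT using fun p : ↥(⋂ i ∈ I, S i) => (hφ p).exists_index p.2
  let A : SliceAtlas n (sliceDim n d I) (⋂ i ∈ I, S i) :=
    { chart p := φ p
      index := o
      mem_maximalAtlas p := (hφ p).mem_maximalAtlas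
      mem_source p := (hφ p).mem_source
      mem_iff := hT }
  let _ := A.chartedSpace
  have hM := A.isManifold
  have hA (p) : A.slice p ∈ IsManifold.maximalAtlas (𝓡 (sliceDim n d I)) ∞ ↥(⋂ i ∈ I, S i) :=
    IsManifold.chart_mem_maximalAtlas p
  have hprod (p) (x) (hx : x ∈ (A.slice p).source) :
      (restrictTo π (⋂ i ∈ I, S i) x : ℝ) = ∏ j : Fin (k p), A.slice p x (Fin.castLE (hke p) j) := by
    refine ((hφ p).eq_prod x hx).trans (Finset.prod_congr rfl fun j _ => ?_)
    change _ = φ p x (o p _)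
    rw [ho p]
  refine ⟨_, A.chartedSpace, A.isManifold, A.isSmoothEmbedding, ?_, ⟨?_, fun p hp => ?_⟩,
    fun p hp => ?_⟩
  · exact hπ.isProperMap.comp
      (isClosed_biInter fun i _ => hclosed i).isClosedEmbedding_subtypeVal.isProperMap
  · exact hπ.isNormalCrossingFunction.contMDiff.comp A.isSmoothEmbedding.contMDiff
  · exact ⟨k p, hke p, A.slice p, hA p, A.mem_source p, by
      change coordProj (o p) (φ p p) = 0
      rw [(hφ p).map_eq_zero hp, map_zero], (hφ p).one_le, hprod p⟩
  · have hk1 := (hφ p).eq_one hp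
    have h1 := (hφ p).one_le
    obtain ⟨γ, -, -, -, h⟩ := exists_velocity_eq (hA p) (A.mem_source p)
      (EuclideanSpace.single (Fin.castLE (hke p) ⟨0, h1⟩) (1 : ℝ))
    have h2 := h (Fin.castLE (hke p) ⟨0, h1⟩)
    have heq : (fun x => A.slice p x (Fin.castLE (hke p) ⟨0, h1⟩)) =ᶠ[𝓝 p]
        fun x => (restrictTo π (⋂ i ∈ I, S i) x : ℝ) := by
      filter_upwards [(A.slice p).open_source.mem_nhds (A.mem_source p)] with x hx
      rw [hprod p x hx]
      refine (Finset.prod_eq_single (f := fun j => A.slice p x (Fin.castLE (hke p) j))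
        (⟨0, h1⟩ : Fin (k p)) (fun j _ hj => ?_)
        fun h0 => absurd (Finset.mem_univ _) h0).symm
      exact absurd (Fin.ext (by have := j.2; change (j : ℕ) = 0; omega)) hj
    intro (c : ℝ)
    refine ⟨c • (show EuclideanSpace ℝ (Fin (sliceDim n d I)) from
      mfderiv 𝓘(ℝ, ℝ) (𝓡 (sliceDim n d I)) γ 0 (1 : ℝ)), ?_⟩
    rw [← heq.mfderiv_eq]
    refine (map_smul (differential (n := sliceDim n d I)
      (fun x => A.slice p x (Fin.castLE (hke p) ⟨0, h1⟩)) p) c _).trans ?_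
    refine (congrArg (c * ·) h2).trans ?_
    simp

end

/-! ## The topology of real-oriented blow-ups -/

/-- An open set in which the components of the complement of `D` are locally connected at every
point, including the points of `D`. -/
def IsSideNeighborhood {X : Type*} [TopologicalSpace X] (D : Set X) (U : Opens X) : Prop :=
  ∀ x ∈ U, ∀ W ∈ 𝓝 x, ∃ V : Opens X, x ∈ V ∧ V ≤ U ∧ (V : Set X) ⊆ W ∧
    ∀ y ∈ (U : Set X) \ D, IsPreconnected (connectedComponentIn ((U : Set X) \ D) y ∩ V)

namespace RealOrientedBlowup

section Side

variable {X : Type*} [TopologicalSpace X] {D : Set X}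

theorem blowDown_mem_of_mem_side {b : RealOrientedBlowup D} {U : Opens X} {y : X}
    (h : y ∈ b.side U) : b.blowDown ∈ U := by
  by_contra hb
  rw [b.side_eq_empty U hb] at h
  exact h

theorem side_eq_of_mem {b : RealOrientedBlowup D} {U : Opens X} {y : X} (h : y ∈ b.side U) :
    b.side U = connectedComponentIn ((U : Set X) \ D) y := by
  obtain ⟨z, -, hz⟩ := b.exists_side_eq U (blowDown_mem_of_mem_side h)
  rw [hz] at h ⊢
  exact connectedComponentIn_eq h

theorem side_eq_side_of_mem {b b' : RealOrientedBlowup D} {U : Opens X} {y : X}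
    (h : y ∈ b.side U) (h' : y ∈ b'.side U) : b.side U = b'.side U := by
  rw [side_eq_of_mem h, side_eq_of_mem h']

/-- The trace on `V` of the side in `U` is connected, so it cannot meet two sides in `V`. -/
theorem side_eq_inter {b : RealOrientedBlowup D} {U V : Opens X} (hVU : V ≤ U)
    (hV : ∀ y ∈ (U : Set X) \ D, IsPreconnected (connectedComponentIn ((U : Set X) \ D) y ∩ V))
    (hb : b.blowDown ∈ V) : b.side V = b.side U ∩ V := by
  refine subset_antisymm (fun y hy => ⟨b.side_mono _ _ hVU hy, (b.side_subset _ hy).1⟩) ?_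
  obtain ⟨y, hy⟩ := b.side_nonempty hb
  have hyU := b.side_mono _ _ hVU hy
  rw [side_eq_of_mem hy]
  refine IsPreconnected.subset_connectedComponentIn ?_ ⟨hyU, (b.side_subset _ hy).1⟩
    fun z hz => ⟨hz.2, (b.side_subset _ hz.1).2⟩
  rw [side_eq_of_mem hyU]
  exact hV y (b.side_subset _ hyU)

/-- The sides in `W` both contain the common side in `V`. One side, in `U`, thus controls the sides
in all other neighbourhoods. -/
theorem side_eq_of_side_eq {b b' : RealOrientedBlowup D} {U V W : Opens X} (hVU : V ≤ U)
    (hV : ∀ y ∈ (U : Set X) \ D, IsPreconnected (connectedComponentIn ((U : Set X) \ D) y ∩ V))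
    (hVW : V ≤ W) (hb : b.blowDown ∈ V) (hb' : b'.blowDown ∈ V) (h : b'.side U = b.side U) :
    b'.side W = b.side W := by
  have h1 : b'.side V = b.side V := by
    rw [side_eq_inter hVU hV hb, side_eq_inter hVU hV hb', h]
  obtain ⟨y, hy⟩ := b.side_nonempty hb
  exact side_eq_side_of_mem (b'.side_mono _ _ hVW (h1 ▸ hy)) (b.side_mono _ _ hVW hy)

theorem isOpen_side_eq (U : Opens X) (b : RealOrientedBlowup D) (hb : b.blowDown ∈ U) :
    IsOpen {b' : RealOrientedBlowup D | b'.side U = b.side U} := by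
  have h : {b' : RealOrientedBlowup D | b'.side U = b.side U} =
      {b' | b'.blowDown ∈ U ∧ b'.side U = b.side U} := by
    ext b'
    refine ⟨fun h => ⟨?_, h⟩, fun h => h.2⟩
    obtain ⟨y, hy⟩ := b.side_nonempty hb
    exact blowDown_mem_of_mem_side (b := b') (h ▸ hy)
  rw [h]
  exact isOpen_basic U _

/-- The side in `U` determines every other prescribed side once the image is in a small `V`. So near
`b` the blow-up looks like a subset of `X`, and continuity can be checked after blowing down. -/
theorem nhds_eq {U : Opens X} (hU : IsSideNeighborhood D U) {b : RealOrientedBlowup D}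
    (hb : b.blowDown ∈ U) :
    𝓝 b = Filter.comap blowDown (𝓝 b.blowDown) ⊓
      Filter.principal {b' | b'.side U = b.side U} := by
  refine le_antisymm (le_inf continuous_blowDown.continuousAt.le_comap
    (Filter.le_principal_iff.2 ((isOpen_side_eq U b hb).mem_nhds rfl))) ?_
  rw [nhds_generateFrom]
  refine le_iInf₂ fun s hs => ?_
  obtain ⟨hbs, U', K, rfl⟩ := hs
  rw [Filter.le_principal_iff]
  obtain ⟨V, hbV, hVU, hVW, hV⟩ := hU _ hb U' (U'.isOpen.mem_nhds hbs.1)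
  refine Filter.mem_inf_of_inter (Filter.preimage_mem_comap (V.isOpen.mem_nhds hbV))
    (Filter.mem_principal_self _) fun b' hb' => ⟨hVW hb'.1, ?_⟩
  rw [side_eq_of_side_eq hVU hV hVW hbV hb'.1 hb'.2]
  exact hbs.2

theorem eq_of_side_eq {U : Opens X} (hU : IsSideNeighborhood D U) {b b' : RealOrientedBlowup D}
    (hb : b.blowDown ∈ U) (h : b'.blowDown = b.blowDown) (hs : b'.side U = b.side U) : b' = b := by
  refine RealOrientedBlowup.ext h (funext fun W => ?_)
  by_cases hW : b.blowDown ∈ W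
  · obtain ⟨V, hbV, hVU, hVW, hV⟩ := hU _ hb W (W.isOpen.mem_nhds hW)
    exact side_eq_of_side_eq hVU hV hVW hbV (h ▸ hbV) hs
  · rw [b.side_eq_empty W hW, b'.side_eq_empty W (h ▸ hW)]

theorem mem_closure_side (b : RealOrientedBlowup D) {U : Opens X} (hb : b.blowDown ∈ U) :
    b.blowDown ∈ closure (b.side U) := by
  refine mem_closure_iff.2 fun W hW hbW => ?_
  obtain ⟨y, hy⟩ := b.side_nonempty (U := U ⊓ ⟨W, hW⟩) ⟨hb, hbW⟩
  have h := (b.side_subset _ hy).1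
  exact ⟨y, h.2, b.side_mono _ U inf_le_left hy⟩

/-- Every neighbourhood `W` of `x` contains a smaller `V` with `K ∩ V` connected and nonempty. The
component of `W \ D` containing `K ∩ V` is the side in `W`; two choices are compared at a point of
`K` in both small sets. -/
theorem exists_of_mem_closure {U : Opens X} (hU : IsSideNeighborhood D U) {x y : X} (hx : x ∈ U)
    (hy : y ∈ (U : Set X) \ D) (hxy : x ∈ closure (connectedComponentIn ((U : Set X) \ D) y)) :
    ∃ b : RealOrientedBlowup D, b.blowDown = x ∧
      b.side U = connectedComponentIn ((U : Set X) \ D) y := by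
  set K := connectedComponentIn ((U : Set X) \ D) y with hK
  have hV (W : Opens X) (hW : x ∈ W) : ∃ V : Opens X, x ∈ V ∧ V ≤ W ∧ IsPreconnected (K ∩ V) := by
    obtain ⟨V, h1, -, h2, h3⟩ := hU x hx W (W.isOpen.mem_nhds hW)
    exact ⟨V, h1, h2, h3 y hy⟩
  choose V hxV hVW hVK using hV
  have hKD : K ⊆ Dᶜ := fun z hz => (connectedComponentIn_subset _ _ hz).2
  have hcomp {W : Opens X} (hW : x ∈ W) {z w : X} (hz : z ∈ K ∩ V W hW) (hw : w ∈ K ∩ V W hW) :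
      connectedComponentIn ((W : Set X) \ D) z = connectedComponentIn ((W : Set X) \ D) w := by
    have hsub : K ∩ V W hW ⊆ (W : Set X) \ D := fun u hu => ⟨hVW W hW hu.2, hKD hu.1⟩
    exact connectedComponentIn_eq ((hVK W hW).subset_connectedComponentIn hz hsub hw)
  have hne {W : Opens X} (hW : x ∈ W) : (K ∩ W).Nonempty := by
    rw [inter_comm]
    exact mem_closure_iff.1 hxy W W.isOpen hW
  let side (W : Opens X) : Set X :=
    ⋃ (h : x ∈ W), ⋃ z ∈ K ∩ V W h, connectedComponentIn ((W : Set X) \ D) z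
  have hside {W : Opens X} (hW : x ∈ W) {z} (hz : z ∈ K ∩ V W hW) :
      side W = connectedComponentIn ((W : Set X) \ D) z := by
    refine subset_antisymm (iUnion_subset fun _ => iUnion₂_subset fun w hw => ?_) ?_
    · rw [hcomp hW hw hz]
    · exact (subset_biUnion_of_mem (u := fun z => connectedComponentIn ((W : Set X) \ D) z)
        hz).trans (subset_iUnion (fun h : x ∈ W => ⋃ z ∈ K ∩ V W h,
          connectedComponentIn ((W : Set X) \ D) z) hW)
  refine ⟨⟨x, side, fun W hW => ?_, fun W hW => ?_, fun W W' hWW' => ?_⟩, rfl, ?_⟩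
  · simp [side, hW]
  · obtain ⟨z, hz⟩ := hne (hxV W hW)
    exact ⟨z, ⟨hVW W hW hz.2, hKD hz.1⟩, hside hW hz⟩
  · by_cases hW : x ∈ W
    · obtain ⟨z, hz⟩ := hne (W := V W hW ⊓ V W' (hWW' hW)) ⟨hxV _ _, hxV _ _⟩
      rw [hside hW ⟨hz.1, hz.2.1⟩, hside (hWW' hW) ⟨hz.1, hz.2.2⟩]
      exact connectedComponentIn_mono _ (sdiff_subset_sdiff_left hWW')
    · simp [side, hW]
  · obtain ⟨z, hz⟩ := hne (hxV U hx)
    exact (hside hx hz).trans (connectedComponentIn_eq hz.1).symm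

/-- Points with different images are separated in `X`; points with the same image are separated by
their sides, which are locally constant. -/
theorem t2Space [T2Space X] (h : ∀ x, ∃ U : Opens X, x ∈ U ∧ IsSideNeighborhood D U) :
    T2Space (RealOrientedBlowup D) := by
  refine ⟨fun b b' hbb' => ?_⟩
  by_cases hx : b.blowDown = b'.blowDown
  · obtain ⟨U, hbU, hU⟩ := h b.blowDown
    refine ⟨_, _, isOpen_side_eq U b hbU, isOpen_side_eq U b' (hx ▸ hbU), rfl, rfl, ?_⟩
    rw [Set.disjoint_left]
    intro c hc hc'
    refine hbb' (eq_of_side_eq hU (hx ▸ hbU) hx ?_)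
    exact Eq.trans (Eq.symm hc) hc'
  · obtain ⟨u, v, hu, hv, hbu, hbv, huv⟩ := t2_separation hx
    exact ⟨_, _, hu.preimage continuous_blowDown, hv.preimage continuous_blowDown, hbu, hbv,
      huv.preimage _⟩

/-- An ultrafilter whose image converges to `x` must select one of the finitely many sides in `U`.
That side is adherent to `x`, so it defines a point over `x`, to which the ultrafilter converges. -/
theorem isProperMap_blowDown (h : ∀ x, ∃ U : Opens X, x ∈ U ∧ IsSideNeighborhood D U ∧
      (connectedComponentIn ((U : Set X) \ D) '' ((U : Set X) \ D)).Finite) :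
    IsProperMap (blowDown : RealOrientedBlowup D → X) := by
  rw [isProperMap_iff_ultrafilter]
  refine ⟨continuous_blowDown, fun F x hF => ?_⟩
  obtain ⟨U, hxU, hU, hfin⟩ := h x
  have hFU : blowDown ⁻¹' (U : Set X) ∈ F := hF (U.isOpen.mem_nhds hxU)
  have hcov : blowDown ⁻¹' (U : Set X) ⊆
      ⋃ K ∈ connectedComponentIn ((U : Set X) \ D) '' ((U : Set X) \ D),
        {b : RealOrientedBlowup D | b.side U = K} := by
    intro b hb
    obtain ⟨y, hy, hyb⟩ := b.exists_side_eq U hb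
    exact mem_biUnion (mem_image_of_mem _ hy) hyb
  obtain ⟨K, ⟨y, hy, rfl⟩, hK⟩ :=
    (Ultrafilter.finite_biUnion_mem_iff hfin).1 (Filter.mem_of_superset hFU hcov)
  have hcl : x ∈ closure (connectedComponentIn ((U : Set X) \ D) y) := by
    refine mem_closure_iff.2 fun W hW hxW => ?_
    have h1 : blowDown ⁻¹' (W ∩ U) ∈ F := hF ((hW.inter U.isOpen).mem_nhds ⟨hxW, hxU⟩)
    obtain ⟨b, hb1, hb2⟩ := F.nonempty_of_mem (Filter.inter_mem h1 hK)
    have h3 := b.mem_closure_side hb1.2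
    rw [mem_ofPred_eq.mp hb2] at h3
    exact mem_closure_iff.1 h3 W hW hb1.1
  obtain ⟨b, rfl, hb⟩ := exists_of_mem_closure hU hxU hy hcl
  refine ⟨b, rfl, ?_⟩
  rw [nhds_eq hU hxU]
  refine le_inf (Filter.map_le_iff_le_comap.1 hF) (Filter.le_principal_iff.2 ?_)
  rwa [hb]

end Side

section Map

variable {X Y : Type*} [TopologicalSpace X] [TopologicalSpace Y] {D : Set X} {E : Set Y}
  (f : C(Y, X)) (hf : MapsTo f Eᶜ Dᶜ)

theorem blowDown_map (b : RealOrientedBlowup E) : (map f hf b).blowDown = f b.blowDown := rfl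

theorem mem_side_map {b : RealOrientedBlowup E} {U : Opens X} {y : Y}
    (hy : y ∈ b.side (Opens.comap f U)) : f y ∈ (map f hf b).side U :=
  mem_biUnion hy (mem_connectedComponentIn ⟨(b.side_subset _ hy).1, hf (b.side_subset _ hy).2⟩)

theorem side_comap_eq {b : RealOrientedBlowup E} {U : Opens X}
    (hfU : ∀ y ∈ (Opens.comap f U : Set Y) \ E,
      f ⁻¹' connectedComponentIn ((U : Set X) \ D) (f y) =
        connectedComponentIn ((Opens.comap f U : Set Y) \ E) y) :
    b.side (Opens.comap f U) = f ⁻¹' (map f hf b).side U := by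
  by_cases hb : b.blowDown ∈ Opens.comap f U
  · obtain ⟨y, hy⟩ := b.side_nonempty hb
    rw [side_eq_of_mem hy, side_eq_of_mem (mem_side_map f hf hy), hfU y (b.side_subset _ hy)]
  · rw [b.side_eq_empty _ hb, (map f hf b).side_eq_empty U hb, preimage_empty]

/-- If the trace of each side in `U` is a single side, then the side of `b` and the side of its
image determine each other. The neighbourhood filters given by `nhds_eq` then correspond. -/
theorem isEmbedding_map (hemb : IsEmbedding f)
    (h : ∀ y, ∃ U : Opens X, f y ∈ U ∧ IsSideNeighborhood D U ∧
      IsSideNeighborhood E (Opens.comap f U) ∧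
      ∀ y ∈ (Opens.comap f U : Set Y) \ E,
        f ⁻¹' connectedComponentIn ((U : Set X) \ D) (f y) =
          connectedComponentIn ((Opens.comap f U : Set Y) \ E) y) :
    IsEmbedding (map f hf) := by
  refine ⟨isInducing_iff_nhds.2 fun b => ?_, fun b b' hbb' => ?_⟩
  · obtain ⟨U, hbU, hU, hUE, hfU⟩ := h b.blowDown
    rw [nhds_eq hUE (U := Opens.comap f U) hbU, nhds_eq hU (b := map f hf b) hbU, Filter.comap_inf,
      Filter.comap_comap, Filter.comap_principal, hemb.nhds_eq_comap, Filter.comap_comap]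
    have h0 : Filter.comap (f ∘ blowDown) (𝓝 (f b.blowDown)) ⊓
        Filter.principal {b' : RealOrientedBlowup E |
          b'.side (Opens.comap f U) = b.side (Opens.comap f U)} =
        Filter.comap (f ∘ blowDown) (𝓝 (f b.blowDown)) ⊓ Filter.principal
          (map f hf ⁻¹' {b' : RealOrientedBlowup D | b'.side U = (map f hf b).side U}) := by
      congr 2
      ext b'
      change b'.side (Opens.comap f U) = b.side (Opens.comap f U) ↔
        (map f hf b').side U = (map f hf b).side U
      refine ⟨fun hs => ?_, fun hs => ?_⟩
      · obtain ⟨y, hy⟩ := b.side_nonempty (U := Opens.comap f U) hbU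
        exact side_eq_side_of_mem (mem_side_map f hf (hs ▸ hy)) (mem_side_map f hf hy)
      · rw [side_comap_eq f hf hfU, hs, ← side_comap_eq f hf hfU]
    exact h0
  · obtain ⟨U, hbU, hU, hUE, hfU⟩ := h b'.blowDown
    refine eq_of_side_eq hUE (U := Opens.comap f U) hbU
      (hemb.injective (congrArg blowDown hbb')) ?_
    rw [side_comap_eq f hf hfU, hbb', ← side_comap_eq f hf hfU]

/-- A point over `f y` lifts if its side contains the image of a point whose side in `Y` is adherent
to `y`: `exists_of_mem_closure` turns the latter side into a preimage. -/
theorem range_map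
    (h : ∀ y, ∃ U : Opens X, f y ∈ U ∧ IsSideNeighborhood D U ∧
      IsSideNeighborhood E (Opens.comap f U) ∧
      ∀ z ∈ (U : Set X) \ D, f y ∈ closure (connectedComponentIn ((U : Set X) \ D) z) →
        ∃ y' ∈ (Opens.comap f U : Set Y) \ E, f y' ∈ connectedComponentIn ((U : Set X) \ D) z ∧
          y ∈ closure (connectedComponentIn ((Opens.comap f U : Set Y) \ E) y')) :
    range (map f hf) = blowDown ⁻¹' range f := by
  refine subset_antisymm (range_subset_iff.2 fun b => mem_range_self b.blowDown) fun c hc => ?_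
  obtain ⟨y, hy⟩ := hc
  obtain ⟨U, hyU, hU, hUE, hcl⟩ := h y
  have hcU : c.blowDown ∈ U := hy ▸ hyU
  obtain ⟨z, hz, hcz⟩ := c.exists_side_eq U hcU
  obtain ⟨y', hy'U, hy'z, hy'⟩ := hcl z hz (by rw [hy, ← hcz]; exact c.mem_closure_side hcU)
  obtain ⟨b, hb, hbs⟩ := exists_of_mem_closure hUE (U := Opens.comap f U) hyU hy'U hy'
  refine ⟨b, eq_of_side_eq hU hcU ?_ ?_⟩
  · rw [blowDown_map, hb, hy]
  · refine side_eq_side_of_mem (y := f y') (mem_side_map f hf ?_) (hcz ▸ hy'z)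
    rw [hbs]
    exact mem_connectedComponentIn hy'U

end Map

end RealOrientedBlowup

/-! ## Corner charts -/

/-- A chart with convex target in which `D` is given by the vanishing of one of the coordinates
`c j`. -/
structure IsCornerChart {n k : ℕ} {X : Type*} [TopologicalSpace X] (D : Set X) (c : Fin k → Fin n)
    (φ : OpenPartialHomeomorph X (EuclideanSpace ℝ (Fin n))) : Prop where
  convex : Convex ℝ φ.target
  mem_iff : ∀ x ∈ φ.source, (x ∈ D ↔ ∃ j, φ x (c j) = 0)

namespace IsCornerChart

variable {n k : ℕ} {X : Type*} [TopologicalSpace X] {D : Set X} {c : Fin k → Fin n}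
  {φ : OpenPartialHomeomorph X (EuclideanSpace ℝ (Fin n))}

theorem convex_orthant (c : Fin k → Fin n) (w : EuclideanSpace ℝ (Fin n)) :
    Convex ℝ {z : EuclideanSpace ℝ (Fin n) | ∀ j, 0 < z (c j) * w (c j)} := by
  rw [ofPred_forall]
  refine convex_iInter fun j => ?_
  exact (convex_Ioi (0 : ℝ)).linear_preimage
    (LinearMap.mulRight ℝ (w (c j)) ∘ₗ (EuclideanSpace.proj (𝕜 := ℝ) (c j)).toLinearMap)

theorem isPreconnected_preimage {C : Set (EuclideanSpace ℝ (Fin n))} (hC : Convex ℝ C)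
    (hCφ : C ⊆ φ.target) : IsPreconnected (φ.source ∩ φ ⁻¹' C) := by
  have h : φ.source ∩ φ ⁻¹' C = φ.symm '' C := by
    rw [φ.symm.image_eq_target_inter_inv_preimage hCφ]
    rfl
  rw [h]
  exact hC.isPreconnected.image _ (φ.continuousOn_symm.mono hCφ)

theorem ne_zero (h : IsCornerChart D c φ) {x : X} (hx : x ∈ φ.source \ D) (j : Fin k) : φ x (c j) ≠ 0 :=
  fun h0 => hx.2 ((h.mem_iff x hx.1).2 ⟨j, h0⟩)

/-- Off `D` no coordinate `c j` changes sign on a connected set. Conversely, an open orthant of the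
convex target is convex, hence connected. -/
theorem connectedComponentIn_eq (h : IsCornerChart D c φ) {y : X} (hy : y ∈ φ.source \ D) :
    connectedComponentIn (φ.source \ D) y =
      {x ∈ φ.source | ∀ j, 0 < φ x (c j) * φ y (c j)} := by
  refine subset_antisymm (fun x hx => ?_) ?_
  · have hsub := connectedComponentIn_subset (φ.source \ D) y
    refine ⟨(hsub hx).1, fun j => ?_⟩
    by_contra hneg
    have hcont : ContinuousOn (fun x => φ x (c j) * φ y (c j))
        (connectedComponentIn (φ.source \ D) y) :=
      ((EuclideanSpace.proj (𝕜 := ℝ) (c j)).continuous.comp_continuousOn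
        (φ.continuousOn.mono fun x hx => (hsub hx).1)).mul continuousOn_const
    obtain ⟨w, hw, hw0⟩ := isPreconnected_connectedComponentIn.intermediate_value hx
      (mem_connectedComponentIn hy) hcont ⟨not_lt.1 hneg, mul_self_nonneg _⟩
    exact mul_ne_zero (h.ne_zero (hsub hw) j) (h.ne_zero hy j) hw0
  · have h1 := isPreconnected_preimage (φ := φ) (h.convex.inter (convex_orthant c (φ y)))
      inter_subset_left
    have h2 : φ.source ∩ φ ⁻¹' (φ.target ∩ {z | ∀ j, 0 < z (c j) * φ y (c j)}) =
        {x ∈ φ.source | ∀ j, 0 < φ x (c j) * φ y (c j)} := by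
      ext x
      exact ⟨fun hx => ⟨hx.1, hx.2.2⟩, fun hx => ⟨hx.1, φ.map_source hx.1, hx.2⟩⟩
    rw [h2] at h1
    refine h1.subset_connectedComponentIn
      ⟨hy.1, fun j => mul_self_pos.2 (h.ne_zero hy j)⟩ fun x hx => ⟨hx.1, fun hxD => ?_⟩
    obtain ⟨j, hj⟩ := (h.mem_iff x hx.1).1 hxD
    have := hx.2 j
    rw [hj, zero_mul] at this
    exact lt_irrefl _ this

/-- A ball meets an orthant in a convex set, even when its centre lies on `D`. -/
theorem isSideNeighborhood (h : IsCornerChart D c φ) : IsSideNeighborhood D (⟨φ.source, φ.open_source⟩ : Opens X) := by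
  intro x hx W hW
  have h1 : φ.target ∩ φ.symm ⁻¹' W ∈ 𝓝 (φ x) :=
    Filter.inter_mem (φ.open_target.mem_nhds (φ.map_source hx))
      ((φ.symm.continuousAt (φ.map_source hx)).preimage_mem_nhds (by rwa [φ.left_inv hx]))
  obtain ⟨r, hr, hrW⟩ := Metric.mem_nhds_iff.1 h1
  refine ⟨⟨φ.source ∩ φ ⁻¹' Metric.ball (φ x) r, φ.isOpen_inter_preimage Metric.isOpen_ball⟩,
    ⟨hx, Metric.mem_ball_self hr⟩, fun y hy => hy.1, fun y hy => ?_, fun y hy => ?_⟩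
  · have := (hrW hy.2).2
    rwa [mem_preimage, φ.left_inv hy.1] at this
  · have h2 := isPreconnected_preimage (φ := φ)
      ((convex_ball (φ x) r).inter (convex_orthant c (φ y)))
      (inter_subset_left.trans fun z hz => (hrW hz).1)
    have h3 : connectedComponentIn (φ.source \ D) y ∩ (φ.source ∩ φ ⁻¹' Metric.ball (φ x) r) =
        φ.source ∩ φ ⁻¹' (Metric.ball (φ x) r ∩ {z | ∀ j, 0 < z (c j) * φ y (c j)}) := by
      rw [h.connectedComponentIn_eq hy]
      ext z
      exact ⟨fun hz => ⟨hz.1.1, hz.2.2, hz.1.2⟩, fun hz => ⟨⟨hz.1, hz.2.2⟩, hz.1, hz.2.1⟩⟩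
    exact h3 ▸ h2

/-- A side is determined by the set of those coordinates `c j` that are positive on it. -/
theorem finite_components (h : IsCornerChart D c φ) :
    (connectedComponentIn (φ.source \ D) '' (φ.source \ D)).Finite := by
  let G : Set (Fin k) → Set X := fun P =>
    {x ∈ φ.source | ∀ j, (j ∈ P → 0 < φ x (c j)) ∧ (j ∉ P → φ x (c j) < 0)}
  refine (Set.finite_range G).subset ?_
  rintro _ ⟨y, hy, rfl⟩
  refine ⟨{j | 0 < φ y (c j)}, ?_⟩
  rw [h.connectedComponentIn_eq hy]
  ext x
  refine and_congr_right fun hx => forall_congr' fun j => ?_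
  rcases lt_or_gt_of_ne (h.ne_zero hy j) with hj | hj
  · simp only [mem_ofPred_eq, hj.not_gt, false_imp_iff, not_false_eq_true, true_imp_iff, true_and]
    refine ⟨fun hx => mul_pos_of_neg_of_neg hx hj, fun hx => ?_⟩
    by_contra h0
    exact absurd hx (not_lt.2 (mul_nonpos_of_nonneg_of_nonpos (not_lt.1 h0) hj.le))
  · simp [hj]

/-- Weak sign conditions suffice because the segment from `φ x` to `φ y` enters the open orthant at
once. -/
theorem mem_closure_iff (h : IsCornerChart D c φ) {x y : X} (hx : x ∈ φ.source) (hy : y ∈ φ.source \ D) :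
    x ∈ closure (connectedComponentIn (φ.source \ D) y) ↔
      ∀ j, 0 ≤ φ x (c j) * φ y (c j) := by
  rw [h.connectedComponentIn_eq hy]
  constructor
  · intro hxc j
    have hcont : ContinuousAt (fun x => φ x (c j) * φ y (c j)) x :=
      ((EuclideanSpace.proj (𝕜 := ℝ) (c j)).continuous.continuousAt.comp
        (φ.continuousAt hx)).mul continuousAt_const
    have h1 := hcont.continuousWithinAt.mem_closure hxc (t := Ioi 0) fun z hz => hz.2 j
    rwa [closure_Ioi] at h1
  · intro hnonneg
    let γ : ℝ → EuclideanSpace ℝ (Fin n) := fun s => (1 - s) • φ x + s • φ y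
    have hγ (s) (hs : s ∈ Ioc (0 : ℝ) 1) : γ s ∈ φ.target :=
      h.convex (φ.map_source hx) (φ.map_source hy.1) (by linarith [hs.2]) hs.1.le (by ring)
    have hγ0 : γ 0 = φ x := by simp [γ]
    have hγc : Continuous γ := by fun_prop
    have hlim : Filter.Tendsto (fun s => φ.symm (γ s)) (𝓝[>] 0) (𝓝 x) := by
      have h1 : ContinuousAt (fun s => φ.symm (γ s)) 0 := by
        refine ContinuousAt.comp (g := φ.symm) ?_ hγc.continuousAt
        rw [hγ0]
        exact φ.symm.continuousAt (φ.map_source hx)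
      have h2 := h1.tendsto
      rw [hγ0, φ.left_inv hx] at h2
      exact h2.mono_left nhdsWithin_le_nhds
    refine mem_closure_of_tendsto hlim ?_
    filter_upwards [Ioc_mem_nhdsGT zero_lt_one] with s hs
    refine ⟨φ.map_target (hγ s hs), fun j => ?_⟩
    rw [φ.right_inv (hγ s hs)]
    simp only [γ, PiLp.add_apply, PiLp.smul_apply, smul_eq_mul]
    have h1 := mul_nonneg (sub_nonneg.2 hs.2) (hnonneg j)
    have h2 := mul_pos hs.1 (mul_self_pos.2 (h.ne_zero hy j))
    nlinarith

end IsCornerChart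

/-! ### Blow-ups of the intersections -/

section

variable {n m : ℕ} {X : Type*} [TopologicalSpace X] [ChartedSpace (EuclideanSpace ℝ (Fin n)) X]
  {π : C(X, Ioo (-1 : ℝ) 1)} {S : Fin m → Set X} {d : Fin m → ℕ}
  {p : X} {k : ℕ} {hk : k ≤ n} {B : Fin m → Finset (Fin n)}
  {r : ℝ} {φ : OpenPartialHomeomorph X (EuclideanSpace ℝ (Fin n))}

theorem IsAdaptedChart.isCornerChart (h : IsAdaptedChart π S d p k hk B r φ) :
    IsCornerChart (specialFibre π) (Fin.castLE hk) φ where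
  convex := h.target_eq ▸ convex_ball _ _
  mem_iff x hx := by
    change (π x : ℝ) = 0 ↔ _
    rw [h.eq_prod x hx, Finset.prod_eq_zero_iff]
    simp

theorem isCornerChart_sliceChart (h : IsAdaptedChart π S d p k hk B r φ) {e : ℕ} {T : Set X}
    {o : Fin e ↪ Fin n} {hke : k ≤ e} (ho : ∀ j : Fin k, o (Fin.castLE hke j) = Fin.castLE hk j)
    (hT : ∀ x ∈ φ.source, (x ∈ T ↔ ∀ j ∉ range o, φ x j = 0)) (q : T) :
    IsCornerChart (specialFibre (restrictTo π T)) (Fin.castLE hke) (sliceChart o T φ hT q) where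
  convex := h.isCornerChart.convex.linear_preimage (coordIncl o).toLinearMap
  mem_iff x hx := by
    refine (h.isCornerChart.mem_iff x hx).trans ?_
    simp only [sliceChart_apply, coordProj_apply, ho]

/-- Sides are orthants in the first `k` coordinates, and the slice chart has the same first `k`
coordinates. -/
theorem preimage_connectedComponentIn (h : IsAdaptedChart π S d p k hk B r φ) {e : ℕ} {T : Set X}
    {o : Fin e ↪ Fin n} {hke : k ≤ e} (ho : ∀ j : Fin k, o (Fin.castLE hke j) = Fin.castLE hk j)
    (hT : ∀ x ∈ φ.source, (x ∈ T ↔ ∀ j ∉ range o, φ x j = 0)) {y : T}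
    (hy : (y : X) ∈ φ.source \ specialFibre π) :
    Subtype.val ⁻¹' connectedComponentIn (φ.source \ specialFibre π) y =
      connectedComponentIn (Subtype.val ⁻¹' φ.source \ specialFibre (restrictTo π T)) y := by
  rw [h.isCornerChart.connectedComponentIn_eq hy]
  refine Eq.trans ?_ ((isCornerChart_sliceChart h ho hT y).connectedComponentIn_eq hy).symm
  ext x
  refine and_congr_right fun _ => forall_congr' fun j => ?_
  simp only [sliceChart_apply, coordProj_apply, ho]

/-- If `π p = 0`, the chart is centred at `0`: projecting `φ z` to the coordinate plane of `T` stays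
in the target and preserves the signs that define the side. If `π p ≠ 0`, then `p` itself lies on
the side. -/
theorem exists_mem_closure_slice (h : IsAdaptedChart π S d p k hk B r φ) {e : ℕ} {T : Set X}
    {o : Fin e ↪ Fin n} {hke : k ≤ e} (ho : ∀ j : Fin k, o (Fin.castLE hke j) = Fin.castLE hk j)
    (hT : ∀ x ∈ φ.source, (x ∈ T ↔ ∀ j ∉ range o, φ x j = 0)) (hp : p ∈ T) {z : X}
    (hz : z ∈ φ.source \ specialFibre π)
    (hpz : p ∈ closure (connectedComponentIn (φ.source \ specialFibre π) z)) :
    ∃ y : T, (y : X) ∈ φ.source \ specialFibre π ∧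
      (y : X) ∈ connectedComponentIn (φ.source \ specialFibre π) z ∧
      (⟨p, hp⟩ : T) ∈ closure
        (connectedComponentIn (Subtype.val ⁻¹' φ.source \ specialFibre (restrictTo π T)) y) := by
  have hc := h.isCornerChart
  rw [hc.mem_closure_iff h.mem_source hz] at hpz
  have hclos {y : T} (hy : (y : X) ∈ φ.source \ specialFibre π)
      (hyz : ∀ j : Fin k, 0 ≤ φ p (Fin.castLE hk j) * φ y (Fin.castLE hk j)) :
      (⟨p, hp⟩ : T) ∈ closure
        (connectedComponentIn (Subtype.val ⁻¹' φ.source \ specialFibre (restrictTo π T)) y) := by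
    refine ((isCornerChart_sliceChart h ho hT y).mem_closure_iff (x := ⟨p, hp⟩)
      h.mem_source hy).2 fun j => ?_
    simpa only [sliceChart_apply, coordProj_apply, ho] using hyz j
  by_cases h0 : (π p : ℝ) = 0
  · let w := coordIncl o (coordProj o (φ z))
    have hw : w ∈ φ.target := by
      have hz' := φ.map_source hz.1
      rw [h.target_eq, h.map_eq_zero h0, mem_ball_zero_iff] at hz' ⊢
      exact (norm_coordIncl_coordProj_le o _).trans_lt hz'
    have hwj (j : Fin k) : w (Fin.castLE hk j) = φ z (Fin.castLE hk j) := by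
      simp only [w, ← ho j, coordIncl_apply, coordProj_apply]
    have hyT : φ.symm w ∈ T := by
      rw [hT _ (φ.map_target hw), φ.right_inv hw]
      exact fun j hj => coordIncl_apply_of_notMem o _ hj
    have hyz : φ.symm w ∈ connectedComponentIn (φ.source \ specialFibre π) z := by
      rw [hc.connectedComponentIn_eq hz]
      refine ⟨φ.map_target hw, fun j => ?_⟩
      rw [φ.right_inv hw, hwj]
      exact mul_self_pos.2 (hc.ne_zero hz j)
    have hy := connectedComponentIn_subset _ _ hyz
    refine ⟨⟨φ.symm w, hyT⟩, hy, hyz, hclos hy fun j => ?_⟩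
    rw [φ.right_inv hw, hwj]
    exact hpz j
  · have hpD : p ∈ φ.source \ specialFibre π := ⟨h.mem_source, h0⟩
    refine ⟨⟨p, hp⟩, hpD, ?_, hclos hpD fun j => mul_self_nonneg _⟩
    rw [hc.connectedComponentIn_eq hz]
    exact ⟨h.mem_source, fun j => lt_of_le_of_ne (hpz j)
      (mul_ne_zero (hc.ne_zero hpD j) (hc.ne_zero hz j)).symm⟩

theorem blownUpMap_blowupInclusion (T : Set X)
    (b : RealOrientedBlowup (specialFibre (restrictTo π T))) :
    blownUpMap π (blowupInclusion π T b) = blownUpMap (restrictTo π T) b := by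
  have hiff : (∃ y ∈ (blowupInclusion π T b).side ⊤, 0 < (π y : ℝ)) ↔
      ∃ y ∈ b.side ⊤, 0 < (restrictTo π T y : ℝ) := by
    constructor
    · intro hpos
      obtain ⟨y, hy⟩ := b.side_nonempty (U := ⊤) trivial
      refine ⟨y, hy, pos_on_side π _ hpos y ?_⟩
      exact RealOrientedBlowup.mem_side_map ⟨Subtype.val, continuous_subtype_val⟩
        (fun _ hx => hx) (U := ⊤) hy
    · rintro ⟨y, hy, hpos⟩
      exact ⟨y, RealOrientedBlowup.mem_side_map ⟨Subtype.val, continuous_subtype_val⟩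
        (fun _ hx => hx) (U := ⊤) hy, hpos⟩
  unfold blownUpMap
  by_cases hb : ∃ y ∈ b.side ⊤, 0 < (restrictTo π T y : ℝ)
  · rw [dif_pos hb, dif_pos (hiff.2 hb)]
    rfl
  · rw [dif_neg hb, dif_neg fun h => hb (hiff.1 h)]
    rfl

variable [IsManifold (𝓡 n) ∞ X]

theorem isEmbedding_blowupInclusion (hπ : IsSmoothSemistableDegeneration n π)
    (hclosed : ∀ i, IsClosed (S i)) (hsub : ∀ i, IsSubmanifold n (d i) (S i))
    (htrans : IsTransversalCollection n π S) (I : Finset (Fin m)) :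
    IsEmbedding (blowupInclusion π (⋂ i ∈ I, S i)) := by
  refine RealOrientedBlowup.isEmbedding_map _ _ IsEmbedding.subtypeVal fun y => ?_
  obtain ⟨k, hk, B, r, φ, h⟩ := exists_adaptedChart hπ hclosed hsub htrans y
  obtain ⟨o, hke, ho, -, hT⟩ := h.exists_index y.2
  exact ⟨⟨φ.source, φ.open_source⟩, h.mem_source, h.isCornerChart.isSideNeighborhood,
    (isCornerChart_sliceChart h ho hT y).isSideNeighborhood,
    fun z hz => preimage_connectedComponentIn h ho hT hz⟩

theorem range_blowupInclusion (hπ : IsSmoothSemistableDegeneration n π)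
    (hclosed : ∀ i, IsClosed (S i)) (hsub : ∀ i, IsSubmanifold n (d i) (S i))
    (htrans : IsTransversalCollection n π S) (I : Finset (Fin m)) :
    range (blowupInclusion π (⋂ i ∈ I, S i)) =
      RealOrientedBlowup.blowDown ⁻¹' ⋂ i ∈ I, S i := by
  refine (RealOrientedBlowup.range_map _ _ fun y => ?_).trans
    (congrArg (RealOrientedBlowup.blowDown ⁻¹' ·) Subtype.range_coe)
  obtain ⟨k, hk, B, r, φ, h⟩ := exists_adaptedChart hπ hclosed hsub htrans y
  obtain ⟨o, hke, ho, -, hT⟩ := h.exists_index y.2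
  exact ⟨⟨φ.source, φ.open_source⟩, h.mem_source, h.isCornerChart.isSideNeighborhood,
    (isCornerChart_sliceChart h ho hT y).isSideNeighborhood,
    fun z hz hcl => exists_mem_closure_slice h ho hT y.2 hz hcl⟩

/-- With this, a stratum of the blow-up can be recognised from blow-down images alone, so the flow
only has to preserve the `S i` in `X`. -/
theorem image_blowupInclusion (hπ : IsSmoothSemistableDegeneration n π)
    (hclosed : ∀ i, IsClosed (S i)) (hsub : ∀ i, IsSubmanifold n (d i) (S i))
    (htrans : IsTransversalCollection n π S) (I : Finset (Fin m)) (Z : Set BlownUpInterval) :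
    blowupInclusion π (⋂ i ∈ I, S i) '' (blownUpMap (restrictTo π (⋂ i ∈ I, S i)) ⁻¹' Z) =
      {b | blownUpMap π b ∈ Z ∧ b.blowDown ∈ ⋂ i ∈ I, S i} := by
  ext b
  constructor
  · rintro ⟨c, hc, rfl⟩
    refine ⟨by rwa [blownUpMap_blowupInclusion], ?_⟩
    have := mem_range_self (f := blowupInclusion π (⋂ i ∈ I, S i)) c
    rwa [range_blowupInclusion hπ hclosed hsub htrans] at this
  · rintro ⟨hb, hbI⟩
    have h1 : b ∈ range (blowupInclusion π (⋂ i ∈ I, S i)) := by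
      rw [range_blowupInclusion hπ hclosed hsub htrans]
      exact hbI
    obtain ⟨c, rfl⟩ := h1
    rw [blownUpMap_blowupInclusion] at hb
    exact ⟨c, hb, rfl⟩

end

/-! ## Trivialisation by flow lines -/

section FlowLine

variable {Y : Type*} [TopologicalSpace Y]

/-- `γ` is, on `I`, a section of `p` that locally follows the prescribed germs of curves `c`. -/
structure IsFlowLine (p : Y → ℝ) (c : Y → ℝ → Y) (I : Set ℝ) (γ : ℝ → Y) : Prop where
  continuousOn : ContinuousOn γ I
  section_eq : ∀ t ∈ I, p (γ t) = t
  eventually_eq : ∀ t ∈ I, ∀ᶠ s in 𝓝[I] t, γ s = c (γ t) s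

/-- A continuous family of flow lines on `I` through the points of `N`. -/
structure IsFlow (p : Y → ℝ) (c : Y → ℝ → Y) (N : Set Y) (I : Set ℝ) (T : Y → ℝ → Y) : Prop where
  continuousOn : ContinuousOn (Function.uncurry T) (N ×ˢ I)
  isFlowLine : ∀ y ∈ N, IsFlowLine p c I (T y)
  apply_self : ∀ y ∈ N, T y (p y) = y

variable {p : Y → ℝ} {c : Y → ℝ → Y} {I I' : Set ℝ} {γ γ' : ℝ → Y}

theorem IsFlowLine.mono (h : IsFlowLine p c I γ) (hI : I' ⊆ I) : IsFlowLine p c I' γ where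
  continuousOn := h.continuousOn.mono hI
  section_eq t ht := h.section_eq t (hI ht)
  eventually_eq t ht := (h.eventually_eq t (hI ht)).filter_mono (nhdsWithin_mono t hI)

theorem IsFlow.mono {N N' : Set Y} {T : Y → ℝ → Y} (h : IsFlow p c N I T) (hN : N' ⊆ N)
    (hI : I' ⊆ I) : IsFlow p c N' I' T where
  continuousOn := h.continuousOn.mono (prod_mono hN hI)
  isFlowLine y hy := (h.isFlowLine y (hN hy)).mono hI
  apply_self y hy := h.apply_self y (hN hy)

theorem IsPreconnected.forall_of_isClosed_of_eventually {I : Set ℝ} (hI : IsPreconnected I)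
    {P : ℝ → Prop} (hclosed : IsClosed {t : I | P t})
    (hopen : ∀ t ∈ I, P t → ∀ᶠ s in 𝓝[I] t, P s) {t₀ : ℝ} (ht₀ : t₀ ∈ I) (h₀ : P t₀) :
    ∀ t ∈ I, P t := by
  have : PreconnectedSpace I := isPreconnected_iff_preconnectedSpace.1 hI
  have hclopen : IsClopen {t : I | P t} := by
    refine ⟨hclosed, isOpen_iff_eventually.2 fun t ht => ?_⟩
    exact (eventually_nhds_subtype_iff I t P).2 (hopen t t.2 ht)
  have huniv := hclopen.eq_univ ⟨⟨t₀, ht₀⟩, h₀⟩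
  intro t ht
  have : (⟨t, ht⟩ : I) ∈ {t : I | P t} := huniv ▸ mem_univ _
  exact this

/-- The coincidence set is closed since `Y` is Hausdorff, and open since both lines follow the same
germ at a common point. -/
theorem IsFlowLine.eqOn [T2Space Y] (hI : IsPreconnected I) (h : IsFlowLine p c I γ)
    (h' : IsFlowLine p c I γ') {t₀ : ℝ} (ht₀ : t₀ ∈ I) (h₀ : γ t₀ = γ' t₀) : EqOn γ γ' I := by
  refine hI.forall_of_isClosed_of_eventually (P := fun t => γ t = γ' t) ?_ (fun t ht heq => ?_)
    ht₀ h₀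
  · exact isClosed_eq h.continuousOn.domRestrict h'.continuousOn.domRestrict
  · filter_upwards [h.eventually_eq t ht, h'.eventually_eq t ht] with s hs hs'
    rw [hs, hs', heq]

/-- The times spent in `Z` form a clopen set. The germs run both forwards and backwards, whence an
equivalence. -/
theorem IsFlowLine.mem_iff {Z : Set Y} (hZ : IsClosed Z) (hI : IsPreconnected I)
    (h : IsFlowLine p c I γ) (hc : ∀ y ∈ Z, ∀ᶠ s in 𝓝[I] (p y), c y s ∈ Z) {t t' : ℝ}
    (ht : t ∈ I) (ht' : t' ∈ I) : γ t ∈ Z ↔ γ t' ∈ Z := by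
  have hclosed : IsClosed {t : I | γ t ∈ Z} := hZ.preimage h.continuousOn.domRestrict
  have hopen : ∀ t ∈ I, γ t ∈ Z → ∀ᶠ s in 𝓝[I] t, γ s ∈ Z := by
    intro t ht htZ
    have h1 := hc _ htZ
    rw [h.section_eq t ht] at h1
    filter_upwards [h.eventually_eq t ht, h1] with s hs hs'
    rwa [hs]
  exact ⟨fun h0 => hI.forall_of_isClosed_of_eventually (P := fun t => γ t ∈ Z) hclosed hopen
    ht h0 t' ht', fun h0 => hI.forall_of_isClosed_of_eventually (P := fun t => γ t ∈ Z) hclosed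
    hopen ht' h0 t ht⟩

/-- Finitely many boxes cover the compact fibre and, by `hnhds`, all fibres nearby. Each point uses
any box around it; by uniqueness the choice does not matter, so continuity is inherited from a
single box. -/
theorem exists_isFlow_of_isCompact_fibre [T2Space Y] {t₀ : ℝ}
    (hcpt : IsCompact (p ⁻¹' {t₀}))
    (hnhds : ∀ O : Set Y, IsOpen O → p ⁻¹' {t₀} ⊆ O → ∀ᶠ t in 𝓝 t₀, p ⁻¹' {t} ⊆ O)
    (hbox : ∀ b, ∃ N ∈ 𝓝 b, ∃ J ∈ 𝓝 (p b), ∃ T, IsFlow p c (N ∩ p ⁻¹' J) (J ∩ Ico 0 1) T) :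
    ∃ ε > 0, ∃ T, IsFlow p c (p ⁻¹' (Ioo (t₀ - ε) (t₀ + ε) ∩ Ico 0 1))
      (Ioo (t₀ - ε) (t₀ + ε) ∩ Ico 0 1) T := by
  choose N hN J hJ T hT using hbox
  obtain ⟨F, hF, hFcov⟩ := hcpt.elim_nhds_subcover (fun b => interior (N b))
    fun b _ => interior_mem_nhds.2 (hN b)
  have hJF : ∀ᶠ t in 𝓝 t₀, ∀ b ∈ F, t ∈ J b := by
    refine (Filter.eventually_all_finset F).2 fun b hb => ?_
    have : p b = t₀ := hF b hb
    exact this ▸ hJ b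
  obtain ⟨ε, hε, hball⟩ := Metric.eventually_nhds_iff_ball.1
    (hJF.and (hnhds _ (isOpen_biUnion fun b _ => isOpen_interior) hFcov))
  rw [Real.ball_eq_Ioo] at hball
  set I := Ioo (t₀ - ε) (t₀ + ε) ∩ Ico 0 1 with hIdef
  have hI : IsPreconnected I := (ordConnected_Ioo.inter ordConnected_Ico).isPreconnected
  have hcov (y) (hy : p y ∈ I) : ∃ b ∈ F, y ∈ interior (N b) := by
    simpa using (hball _ hy.1).2 (rfl : p y = p y)
  have hIJ {b} (hb : b ∈ F) : I ⊆ J b ∩ Ico 0 1 := fun t ht => ⟨(hball t ht.1).1 b hb, ht.2⟩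
  have hloc {b} (hb : b ∈ F) : IsFlow p c (N b ∩ p ⁻¹' I) I (T b) :=
    (hT b).mono (inter_subset_inter_right _ (preimage_mono fun t ht => (hIJ hb ht).1)) (hIJ hb)
  classical
  let β : Y → Y := fun y => if hy : p y ∈ I then (hcov y hy).choose else y
  have hβ {y} (hy : p y ∈ I) : β y ∈ F ∧ y ∈ interior (N (β y)) := by
    simp only [β, dif_pos hy]
    exact (hcov y hy).choose_spec
  have hβN {y} (hy : p y ∈ I) : y ∈ N (β y) ∩ p ⁻¹' I := ⟨interior_subset (hβ hy).2, hy⟩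
  refine ⟨ε, hε, fun y => T (β y) y, ⟨?_, fun y hy => ?_, fun y hy => ?_⟩⟩
  · rintro ⟨y, t⟩ ⟨hy, ht⟩
    have hy : p y ∈ I := hy
    have h1 := (hloc (hβ hy).1).continuousOn (y, t) ⟨hβN hy, ht⟩
    have h2 : 𝓝[(N (β y) ∩ p ⁻¹' I) ×ˢ I] (y, t) = 𝓝[(p ⁻¹' I) ×ˢ I] (y, t) := by
      rw [nhdsWithin_prod_eq, nhdsWithin_prod_eq, inter_comm, nhdsWithin_inter_of_mem']
      exact mem_nhdsWithin_of_mem_nhds (mem_interior_iff_mem_nhds.1 (hβ hy).2)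
    rw [ContinuousWithinAt, h2] at h1
    refine ContinuousWithinAt.congr_of_eventuallyEq h1 ?_ rfl
    have h3 : ∀ᶠ z in 𝓝[(p ⁻¹' I) ×ˢ I] (y, t), z ∈ (N (β y) ∩ p ⁻¹' I) ×ˢ I :=
      h2 ▸ self_mem_nhdsWithin
    filter_upwards [h3] with z hz
    exact ((hloc (hβ hz.1.2).1).isFlowLine _ (hβN hz.1.2)).eqOn hI
      ((hloc (hβ hy).1).isFlowLine _ hz.1) hz.1.2
      (((hloc (hβ hz.1.2).1).apply_self _ (hβN hz.1.2)).trans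
        ((hloc (hβ hy).1).apply_self _ hz.1).symm) hz.2
  · exact (hloc (hβ hy).1).isFlowLine y (hβN hy)
  · exact (hloc (hβ hy).1).apply_self y (hβN hy)

theorem continuousOn_ite_le {Z W : Type*} [TopologicalSpace Z] [TopologicalSpace W] {f g : Z → W}
    {q : Z → ℝ} {v : ℝ} {s : Set Z} (hq : Continuous q) (hf : ContinuousOn f (s ∩ {z | q z ≤ v}))
    (hg : ContinuousOn g (s ∩ {z | v ≤ q z})) (h : ∀ z ∈ s, q z = v → f z = g z) :
    ContinuousOn (fun z => if q z ≤ v then f z else g z) s := by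
  refine ContinuousOn.if (fun z hz => h z hz.1 ?_) ?_ ?_
  · exact frontier_le_subset_eq hq continuous_const hz.2
  · rwa [(isClosed_le hq continuous_const).closure_eq]
  · refine hg.mono (inter_subset_inter_right _ ?_)
    simp only [not_le]
    exact closure_lt_subset_le continuous_const hq

theorem exists_isFlow_Icc_union [T2Space Y] (hp : Continuous p) {u v w : ℝ} (huv : u ≤ v)
    (hvw : v ≤ w) {T₁ T₂ : Y → ℝ → Y} (h₁ : IsFlow p c (p ⁻¹' Icc u v) (Icc u v) T₁)
    (h₂ : IsFlow p c (p ⁻¹' Icc v w) (Icc v w) T₂) :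
    ∃ T, IsFlow p c (p ⁻¹' Icc u w) (Icc u w) T := by
  classical
  have hv₁ : v ∈ Icc u v := ⟨huv, le_rfl⟩
  have hv₂ : v ∈ Icc v w := ⟨le_rfl, hvw⟩
  have hp₁ {y} (hy : p y ∈ Icc u v) : p (T₁ y v) = v := (h₁.isFlowLine y hy).section_eq v hv₁
  have hp₂ {y} (hy : p y ∈ Icc v w) : p (T₂ y v) = v := (h₂.isFlowLine y hy).section_eq v hv₂
  -- `R₁` and `R₂` move a point along its flow line to level `v`, if necessary, so that it lies in
  -- the lower or the upper slab.
  let R₁ : Y → Y := fun y => if p y ≤ v then y else T₂ y v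
  let R₂ : Y → Y := fun y => if p y ≤ v then T₁ y v else y
  have hR₁p {y} (hy : p y ∈ Icc u w) : p (R₁ y) ∈ Icc u v := by
    by_cases hyv : p y ≤ v
    · simp only [R₁, if_pos hyv]; exact ⟨hy.1, hyv⟩
    · simp only [R₁, if_neg hyv]; rw [hp₂ ⟨(not_le.1 hyv).le, hy.2⟩]; exact hv₁
  have hR₂p {y} (hy : p y ∈ Icc u w) : p (R₂ y) ∈ Icc v w := by
    by_cases hyv : p y ≤ v
    · simp only [R₂, if_pos hyv]; rw [hp₁ ⟨hy.1, hyv⟩]; exact hv₂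
    · simp only [R₂, if_neg hyv]; exact ⟨(not_le.1 hyv).le, hy.2⟩
  have hjoin {y} (hy : p y ∈ Icc u w) : T₁ (R₁ y) v = T₂ (R₂ y) v := by
    by_cases hyv : p y ≤ v
    · simp only [R₁, R₂, if_pos hyv]
      have h := hp₁ ⟨hy.1, hyv⟩
      have h' := h₂.apply_self (T₁ y v) (by rw [mem_preimage, h]; exact hv₂)
      rw [h] at h'
      exact h'.symm
    · simp only [R₁, R₂, if_neg hyv]
      have h := hp₂ ⟨(not_le.1 hyv).le, hy.2⟩
      have h' := h₁.apply_self (T₂ y v) (by rw [mem_preimage, h]; exact hv₁)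
      rwa [h] at h'
  have hR₁c : ContinuousOn R₁ (p ⁻¹' Icc u w) := by
    refine continuousOn_ite_le hp continuousOn_id ?_ fun y hy hyv => ?_
    · exact h₂.continuousOn.comp (f := fun y => (y, v)) (by fun_prop)
        fun y hy => ⟨⟨hy.2, hy.1.2⟩, hv₂⟩
    · have h := h₂.apply_self y (by rw [mem_preimage, hyv]; exact hv₂)
      rw [hyv] at h
      exact h.symm
  have hR₂c : ContinuousOn R₂ (p ⁻¹' Icc u w) := by
    refine continuousOn_ite_le hp ?_ continuousOn_id fun y hy hyv => ?_
    · exact h₁.continuousOn.comp (f := fun y => (y, v)) (by fun_prop)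
        fun y hy => ⟨⟨hy.1.1, hy.2⟩, hv₁⟩
    · have h := h₁.apply_self y (by rw [mem_preimage, hyv]; exact hv₁)
      rwa [hyv] at h
  let T : Y → ℝ → Y := fun y t => if t ≤ v then T₁ (R₁ y) t else T₂ (R₂ y) t
  have hTc : ContinuousOn (Function.uncurry T) ((p ⁻¹' Icc u w) ×ˢ Icc u w) := by
    refine continuousOn_ite_le (q := Prod.snd) continuous_snd ?_ ?_ ?_
    · exact h₁.continuousOn.comp (f := fun z : Y × ℝ => (R₁ z.1, z.2))
        ((hR₁c.comp continuousOn_fst fun z hz => hz.1.1).prodMk continuousOn_snd)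
        fun z hz => ⟨hR₁p hz.1.1, hz.1.2.1, hz.2⟩
    · exact h₂.continuousOn.comp (f := fun z : Y × ℝ => (R₂ z.1, z.2))
        ((hR₂c.comp continuousOn_fst fun z hz => hz.1.1).prodMk continuousOn_snd)
        fun z hz => ⟨hR₂p hz.1.1, hz.2, hz.1.2.2⟩
    · rintro ⟨y, t⟩ hz (rfl : t = v)
      exact hjoin hz.1
  have hT₁ {y} {t} (ht : t ≤ v) : T y t = T₁ (R₁ y) t := if_pos ht
  have hT₂ {y} (hy : p y ∈ Icc u w) {t} (ht : v ≤ t) : T y t = T₂ (R₂ y) t := by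
    rcases ht.eq_or_lt with rfl | ht
    · rw [hT₁ le_rfl, hjoin hy]
    · exact if_neg (not_le.2 ht)
  refine ⟨T, hTc, fun y hy => ⟨?_, fun t ht => ?_, fun t ht => ?_⟩, fun y hy => ?_⟩
  · exact hTc.comp (f := fun t => (y, t)) (by fun_prop) fun t ht => ⟨hy, ht⟩
  · rcases le_total t v with htv | htv
    · rw [hT₁ htv, (h₁.isFlowLine _ (hR₁p hy)).section_eq t ⟨ht.1, htv⟩]
    · rw [hT₂ hy htv, (h₂.isFlowLine _ (hR₂p hy)).section_eq t ⟨htv, ht.2⟩]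
  · rw [← Icc_union_Icc_eq_Icc huv hvw, nhdsWithin_union, Filter.eventually_sup]
    constructor
    · by_cases htv : t ≤ v
      · filter_upwards [(h₁.isFlowLine _ (hR₁p hy)).eventually_eq t ⟨ht.1, htv⟩,
          self_mem_nhdsWithin] with s hs hsI
        rw [hT₁ htv, hT₁ hsI.2, hs]
      · have : 𝓝[Icc u v] t = ⊥ := by
          rw [← notMem_closure_iff_nhdsWithin_eq_bot, isClosed_Icc.closure_eq]
          exact fun h => htv h.2
        rw [this]
        exact Filter.eventually_bot
    · by_cases htv : v ≤ t
      · filter_upwards [(h₂.isFlowLine _ (hR₂p hy)).eventually_eq t ⟨htv, ht.2⟩,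
          self_mem_nhdsWithin] with s hs hsI
        rw [hT₂ hy htv, hT₂ hy hsI.1, hs]
      · have : 𝓝[Icc v w] t = ⊥ := by
          rw [← notMem_closure_iff_nhdsWithin_eq_bot, isClosed_Icc.closure_eq]
          exact fun h => htv h.1
        rw [this]
        exact Filter.eventually_bot
  · rcases le_or_gt (p y) v with hyv | hyv
    · rw [hT₁ hyv]
      simp only [R₁, if_pos hyv]
      exact h₁.apply_self y ⟨hy.1, hyv⟩
    · rw [hT₂ hy hyv.le]
      simp only [R₂, if_neg (not_le.2 hyv)]
      exact h₂.apply_self y ⟨hyv.le, hy.2⟩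

theorem exists_isFlow_Icc [T2Space Y] (hp : Continuous p)
    (hcpt : ∀ a < 1, IsCompact (p ⁻¹' Iic a))
    (hbox : ∀ b, ∃ N ∈ 𝓝 b, ∃ J ∈ 𝓝 (p b), ∃ T, IsFlow p c (N ∩ p ⁻¹' J) (J ∩ Ico 0 1) T)
    {a : ℝ} (ha : a ∈ Ico (0 : ℝ) 1) : ∃ T, IsFlow p c (p ⁻¹' Icc 0 a) (Icc 0 a) T := by
  have hloc (t₀ : Icc 0 a) : ∃ ε > 0, ∃ T, IsFlow p c (p ⁻¹' (Ioo (t₀ - ε) (t₀ + ε) ∩ Ico 0 1))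
      (Ioo (t₀ - ε) (t₀ + ε) ∩ Ico 0 1) T := by
    refine exists_isFlow_of_isCompact_fibre ?_ (fun O hO hsub => ?_) hbox
    · refine (hcpt a ha.2).of_isClosed_subset (isClosed_singleton.preimage hp) fun y hy => ?_
      rw [mem_preimage, mem_singleton_iff] at hy
      rw [mem_preimage, hy]
      exact t₀.2.2
    -- The part of a slightly larger compact sublevel set outside `O` has closed image, and this
    -- image misses `t₀`.
    · obtain ⟨a', ha'⟩ := exists_between ha.2
      have hK : IsClosed (p '' (p ⁻¹' Iic a' \ O)) :=
        (((hcpt a' ha'.2).diff hO).image hp).isClosed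
      have ht₀ : (t₀ : ℝ) ∉ p '' (p ⁻¹' Iic a' \ O) := by
        rintro ⟨y, hy, hyt⟩
        exact hy.2 (hsub hyt)
      filter_upwards [hK.isOpen_compl.mem_nhds ht₀, Iio_mem_nhds (t₀.2.2.trans_lt ha'.1)]
        with t ht hta y hy
      by_contra hyO
      have hyt : p y = t := hy
      have hta' : t < a' := hta
      exact ht ⟨y, ⟨by rw [mem_preimage, hyt]; exact hta'.le, hyO⟩, hyt⟩
  choose ε hε T hT using hloc
  obtain ⟨t, ht0, htm, ⟨M, hM⟩, hcov⟩ := exists_monotone_Icc_subset_open_cover_Icc ha.1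
    (c := fun t₀ : Icc 0 a => Subtype.val ⁻¹' Ioo (t₀ - ε t₀) (t₀ + ε t₀))
    (fun t₀ => isOpen_Ioo.preimage continuous_subtype_val)
    fun t₀ _ => mem_iUnion.2 ⟨t₀, by simp [hε t₀]⟩
  have hstep (k : ℕ) : ∃ T, IsFlow p c (p ⁻¹' Icc (t k : ℝ) (t (k + 1))) (Icc (t k) (t (k + 1))) T := by
    obtain ⟨t₀, ht₀⟩ := hcov k
    have hsub : Icc (t k : ℝ) (t (k + 1)) ⊆ Ioo (t₀ - ε t₀) (t₀ + ε t₀) ∩ Ico 0 1 := fun s hs =>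
      have hs0 : s ∈ Icc 0 a := ⟨(t k).2.1.trans hs.1, hs.2.trans (t (k + 1)).2.2⟩
      ⟨ht₀ (a := ⟨s, hs0⟩) hs, hs0.1, hs0.2.trans_lt ha.2⟩
    exact ⟨T t₀, (hT t₀).mono (preimage_mono hsub) hsub⟩
  have hind (k : ℕ) : ∃ T, IsFlow p c (p ⁻¹' Icc (t 0 : ℝ) (t (k + 1))) (Icc (t 0) (t (k + 1))) T := by
    induction k with
    | zero => exact hstep 0
    | succ k ih =>
      obtain ⟨T₁, hT₁⟩ := ih
      obtain ⟨T₂, hT₂⟩ := hstep (k + 1)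
      exact exists_isFlow_Icc_union hp (htm (Nat.zero_le _)) (htm (Nat.le_succ _)) hT₁ hT₂
  have h := hind M
  rwa [ht0, hM (M + 1) (Nat.le_succ M)] at h

/-- By uniqueness the flows on the intervals `[0, a]` extend one another. The choice of `a` strictly
above both `p y` and `t` makes it valid in a neighbourhood. -/
theorem exists_isFlow_Ico [T2Space Y] (hp : Continuous p) (hp0 : ∀ y, p y ∈ Ico (0 : ℝ) 1)
    (hcpt : ∀ a < 1, IsCompact (p ⁻¹' Iic a))
    (hbox : ∀ b, ∃ N ∈ 𝓝 b, ∃ J ∈ 𝓝 (p b), ∃ T, IsFlow p c (N ∩ p ⁻¹' J) (J ∩ Ico 0 1) T) :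
    ∃ T, IsFlow p c univ (Ico 0 1) T := by
  choose T hT using fun a : Ico (0 : ℝ) 1 => exists_isFlow_Icc hp hcpt hbox a.2
  have hmid (y : Y) {t : ℝ} (ht : t ∈ Ico (0 : ℝ) 1) : ∃ a : Ico (0 : ℝ) 1, p y < a ∧ t < a := by
    obtain ⟨a, ha, ha1⟩ := exists_between (max_lt (hp0 y).2 ht.2)
    exact ⟨⟨a, (ht.1.trans (le_max_right _ _)).trans ha.le, ha1⟩,
      (le_max_left _ _).trans_lt ha, (le_max_right _ _).trans_lt ha⟩
  have huniq {a a' : Ico (0 : ℝ) 1} {y : Y} {t : ℝ} (ht : 0 ≤ t) (ha : p y ≤ a ∧ t ≤ a)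
      (ha' : p y ≤ a' ∧ t ≤ a') : T a y t = T a' y t := by
    wlog haa : a ≤ a' generalizing a a'
    · exact (this ha' ha (le_of_not_ge haa)).symm
    have hsub : Icc (0 : ℝ) a ⊆ Icc 0 a' := Icc_subset_Icc_right haa
    have hy : y ∈ p ⁻¹' Icc (0 : ℝ) a := ⟨(hp0 y).1, ha.1⟩
    exact ((hT a).isFlowLine y hy).eqOn isPreconnected_Icc
      (((hT a').isFlowLine y (hsub hy)).mono hsub) hy
      (((hT a).apply_self y hy).trans ((hT a').apply_self y (hsub hy)).symm) ⟨ht, ha.2⟩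
  classical
  let α : Y → ℝ → Ico (0 : ℝ) 1 := fun y t =>
    if ht : t ∈ Ico (0 : ℝ) 1 then (hmid y ht).choose else ⟨0, le_rfl, zero_lt_one⟩
  have hα {y : Y} {t : ℝ} (ht : t ∈ Ico (0 : ℝ) 1) : p y < α y t ∧ t < α y t := by
    simp only [α, dif_pos ht]
    exact (hmid y ht).choose_spec
  let T' : Y → ℝ → Y := fun y t => T (α y t) y t
  have hT' {y : Y} {t : ℝ} (ht : t ∈ Ico (0 : ℝ) 1) {a : Ico (0 : ℝ) 1} (ha : p y ≤ a ∧ t ≤ a) :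
      T' y t = T a y t := huniq ht.1 ⟨(hα ht).1.le, (hα ht).2.le⟩ ha
  have hnhds {t : ℝ} {a : Ico (0 : ℝ) 1} (hta : t < a) : 𝓝[Ico 0 1] t = 𝓝[Icc 0 (a : ℝ)] t := by
    have h1 : Iio (a : ℝ) ∈ 𝓝 t := Iio_mem_nhds hta
    rw [nhdsWithin_eq_nhdsWithin (s := Iio (a : ℝ)) (t := Ico 0 1) (u := Icc 0 (a : ℝ)) hta
      isOpen_Iio]
    ext s
    exact ⟨fun h => ⟨⟨h.1.1, le_of_lt h.2⟩, h.2⟩, fun h => ⟨⟨h.1.1, h.1.2.trans_lt a.2.2⟩, h.2⟩⟩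
  have hcont : ContinuousOn (Function.uncurry T') (univ ×ˢ Ico 0 1) := by
    rintro ⟨y, t⟩ ⟨-, ht⟩
    have hya := hα (y := y) ht
    set a := α y t
    have h1 := (hT a).continuousOn (y, t) ⟨⟨(hp0 y).1, hya.1.le⟩, ht.1, hya.2.le⟩
    have hyn : 𝓝[p ⁻¹' Icc (0 : ℝ) a] y = 𝓝 y :=
      nhdsWithin_eq_nhds.2 (Filter.mem_of_superset (hp.continuousAt (Iio_mem_nhds hya.1))
        fun z hz => ⟨(hp0 z).1, le_of_lt hz⟩)
    have h2 : 𝓝[(p ⁻¹' Icc (0 : ℝ) a) ×ˢ Icc (0 : ℝ) a] (y, t) = 𝓝[univ ×ˢ Ico 0 1] (y, t) := by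
      rw [nhdsWithin_prod_eq, nhdsWithin_prod_eq, hyn, nhdsWithin_univ, hnhds hya.2]
    rw [ContinuousWithinAt, h2] at h1
    refine ContinuousWithinAt.congr_of_eventuallyEq h1 ?_ rfl
    have h3 : ∀ᶠ z in 𝓝[univ ×ˢ Ico 0 1] (y, t),
        z ∈ (p ⁻¹' Icc (0 : ℝ) a) ×ˢ Icc (0 : ℝ) a := h2 ▸ self_mem_nhdsWithin
    filter_upwards [h3] with z hz
    exact hT' ⟨hz.2.1, hz.2.2.trans_lt a.2.2⟩ ⟨hz.1.2, hz.2.2⟩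
  refine ⟨T', hcont, fun y _ => ⟨?_, fun t ht => ?_, fun t ht => ?_⟩, fun y _ => ?_⟩
  · exact hcont.comp (f := fun t => (y, t)) (by fun_prop) fun t ht => ⟨trivial, ht⟩
  · have hya := hα (y := y) ht
    exact ((hT _).isFlowLine y ⟨(hp0 y).1, hya.1.le⟩).section_eq t ⟨ht.1, hya.2.le⟩
  · have hya := hα (y := y) ht
    rw [hnhds hya.2]
    filter_upwards [((hT _).isFlowLine y ⟨(hp0 y).1, hya.1.le⟩).eventually_eq t ⟨ht.1, hya.2.le⟩,
      self_mem_nhdsWithin] with s hs hsI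
    rw [hT' (a := α y t) ⟨hsI.1, hsI.2.trans_lt (α y t).2.2⟩ ⟨hya.1.le, hsI.2⟩, hs]
  · have hya := hα (y := y) (hp0 y)
    exact (hT _).apply_self y ⟨(hp0 y).1, hya.1.le⟩

/-- A map to `[0, 1)` with compact preimages of compact sets whose flow lines exist locally is a
product, and a closed set that is locally invariant is a product in it. -/
theorem exists_homeomorph_of_flowBox [T2Space Y] (hp : Continuous p)
    (hp0 : ∀ y, p y ∈ Ico (0 : ℝ) 1) (hcpt : ∀ a < 1, IsCompact (p ⁻¹' Iic a))
    (hbox : ∀ b, ∃ N ∈ 𝓝 b, ∃ J ∈ 𝓝 (p b), ∃ T, IsFlow p c (N ∩ p ⁻¹' J) (J ∩ Ico 0 1) T) :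
    ∃ H : ({y // p y = 0} × Ico (0 : ℝ) 1) ≃ₜ Y, (∀ z, p (H z) = z.2) ∧
      ∀ Z : Set Y, IsClosed Z → (∀ y ∈ Z, ∀ᶠ s in 𝓝[Ico 0 1] (p y), c y s ∈ Z) →
        ∀ z, H z ∈ Z ↔ (z.1 : Y) ∈ Z := by
  obtain ⟨T, hT⟩ := exists_isFlow_Ico hp hp0 hcpt hbox
  have h0 : (0 : ℝ) ∈ Ico (0 : ℝ) 1 := ⟨le_rfl, zero_lt_one⟩
  have hline (y) := hT.isFlowLine y trivial
  have hback {y : Y} {t u : ℝ} (ht : t ∈ Ico (0 : ℝ) 1) (hu : u ∈ Ico (0 : ℝ) 1) :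
      T (T y t) u = T y u := by
    have h1 := hT.apply_self (T y t) trivial
    rw [(hline y).section_eq t ht] at h1
    exact (hline _).eqOn isPreconnected_Ico (hline y) ht h1 hu
  have hself (y) : T y (p y) = y := hT.apply_self y trivial
  let H : ({y // p y = 0} × Ico (0 : ℝ) 1) ≃ₜ Y :=
    { toFun z := T z.1 z.2
      invFun y := (⟨T y 0, (hline y).section_eq 0 h0⟩, ⟨p y, hp0 y⟩)
      left_inv z := by
        refine Prod.ext (Subtype.ext ?_) (Subtype.ext ((hline _).section_eq _ z.2.2))
        have h1 := hself z.1
        rw [z.1.2] at h1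
        exact (hback z.2.2 h0).trans h1
      right_inv y := (hback h0 (hp0 y)).trans (hself y)
      continuous_toFun := hT.continuousOn.comp_continuous
        (f := fun z : {y // p y = 0} × Ico (0 : ℝ) 1 => ((z.1 : Y), (z.2 : ℝ))) (by fun_prop)
        fun z => ⟨trivial, z.2.2⟩
      continuous_invFun := by
        refine Continuous.prodMk (Continuous.subtype_mk ?_ _) (Continuous.subtype_mk hp _)
        exact hT.continuousOn.comp_continuous (f := fun y : Y => (y, (0 : ℝ))) (by fun_prop)
          fun y => ⟨trivial, h0⟩ }
  refine ⟨H, fun z => (hline _).section_eq _ z.2.2, fun Z hZ hZc z => ?_⟩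
  have h1 := (hline z.1).mem_iff hZ isPreconnected_Ico hZc z.2.2 h0
  have h2 := hself z.1
  rw [z.1.2] at h2
  rw [h2] at h1
  exact h1

end FlowLine

/-! ## Orbits near an orthant -/

section OrthantGauge

variable {κ : Type*} [Fintype κ]

/-- A function on `ℝ^κ` which is strictly increasing in the interior direction, and which on the
nonnegative orthant, where it is nonnegative, is the product of the coordinates. -/
noncomputable def orthantGauge (v : κ → ℝ) : ℝ :=
  ∏ j, max (v j) 0 - ∑ j, max (-v j) 0

theorem continuous_orthantGauge : Continuous (orthantGauge : (κ → ℝ) → ℝ) := by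
  unfold orthantGauge
  fun_prop

theorem orthantGauge_of_nonneg {v : κ → ℝ} (hv : ∀ j, 0 ≤ v j) : orthantGauge v = ∏ j, v j := by
  simp [orthantGauge, hv]

/-- Outside the orthant the product term vanishes and the sum is positive. So an orbit point with
gauge value `t ≥ 0` lies automatically in the closed orthant. -/
theorem nonneg_of_orthantGauge_nonneg {v : κ → ℝ} (hv : 0 ≤ orthantGauge v) (j : κ) :
    0 ≤ v j := by
  by_contra! hj
  have h1 : ∏ i, max (v i) 0 = 0 :=
    Finset.prod_eq_zero (Finset.mem_univ j) (max_eq_right hj.le)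
  have h2 : max (-v j) 0 ≤ ∑ i, max (-v i) 0 :=
    Finset.single_le_sum (f := fun i => max (-v i) 0) (fun i _ => le_max_right _ _)
      (Finset.mem_univ j)
  have h3 := le_max_left (-v j) 0
  rw [orthantGauge, h1] at hv
  linarith

/-- From a point of the orthant the product grows, also from the boundary, where its derivative may
vanish. From outside, the subtracted sum strictly drops. -/
theorem orthantGauge_lt [Nonempty κ] {v w : κ → ℝ} (h : ∀ j, v j < w j) :
    orthantGauge v < orthantGauge w := by
  have hsum (j) : max (-w j) 0 ≤ max (-v j) 0 := max_le_max (neg_le_neg (h j).le) le_rfl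
  by_cases hv : ∀ j, 0 ≤ v j
  · rw [orthantGauge_of_nonneg hv, orthantGauge_of_nonneg fun j => (hv j).trans (h j).le]
    by_cases h0 : ∃ j, v j = 0
    · obtain ⟨j, hj⟩ := h0
      rw [Finset.prod_eq_zero (Finset.mem_univ j) hj]
      exact Finset.prod_pos fun i _ => (hv i).trans_lt (h i)
    · push Not at h0
      exact Finset.prod_lt_prod_of_nonempty (fun i _ => (hv i).lt_of_ne (h0 i).symm)
        (fun i _ => h i) Finset.univ_nonempty
  · push Not at hv
    obtain ⟨j, hj⟩ := hv
    have h1 : ∏ i, max (v i) 0 ≤ ∏ i, max (w i) 0 :=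
      Finset.prod_le_prod (fun i _ => le_max_right _ _)
        fun i _ => max_le_max (h i).le le_rfl
    have h2 : ∑ i, max (-w i) 0 < ∑ i, max (-v i) 0 := by
      refine Finset.sum_lt_sum (fun i _ => hsum i) ⟨j, Finset.mem_univ j, ?_⟩
      rw [max_eq_left (a := -v j) (by linarith)]
      exact max_lt (neg_lt_neg (h j)) (by linarith)
    unfold orthantGauge
    linarith

end OrthantGauge

/-- A family of strictly increasing functions has a continuous family of inverses. -/
theorem exists_continuousOn_of_strictMonoOn {E : Type*} [TopologicalSpace E] {h : E × ℝ → ℝ}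
    {z₀ : E} {N : Set E} (hN : N ∈ 𝓝 z₀) {η : ℝ} (hη : 0 < η)
    (hc : ContinuousOn h (N ×ˢ Icc (-η) η))
    (hmono : ∀ z ∈ N, StrictMonoOn (fun s => h (z, s)) (Icc (-η) η)) :
    ∃ N' ∈ 𝓝 z₀, N' ⊆ N ∧ ∃ δ > 0, ∃ σ : E → ℝ → ℝ,
      ContinuousOn (Function.uncurry σ) (N' ×ˢ Ioo (h (z₀, 0) - δ) (h (z₀, 0) + δ)) ∧
      ∀ z ∈ N', ∀ t ∈ Ioo (h (z₀, 0) - δ) (h (z₀, 0) + δ), σ z t ∈ Ioo (-η) η ∧ h (z, σ z t) = t := by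
  have hm : -η ∈ Icc (-η) η := ⟨le_rfl, by linarith⟩
  have h0 : (0 : ℝ) ∈ Icc (-η) η := ⟨by linarith, hη.le⟩
  have hp : η ∈ Icc (-η) η := ⟨by linarith, le_rfl⟩
  have hslice {s : ℝ} (hs : s ∈ Icc (-η) η) : ContinuousOn (fun z => h (z, s)) N :=
    hc.comp (by fun_prop) fun z hz => ⟨hz, hs⟩
  have hzN := mem_of_mem_nhds hN
  have h1 := hmono z₀ hzN hm h0 (by linarith)
  have h2 := hmono z₀ hzN h0 hp hη
  simp only at h1 h2
  set t₀ := h (z₀, 0) with ht₀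
  -- Half the gap leaves room for `z` to vary: nearby, `h (z, ·)` still passes both `t₀ - δ` and `t₀
  -- + δ`.
  set δ := min (t₀ - h (z₀, -η)) (h (z₀, η) - t₀) / 2 with hδ
  have hδ1 : 2 * δ ≤ t₀ - h (z₀, -η) := by
    rw [hδ]; linarith [min_le_left (t₀ - h (z₀, -η)) (h (z₀, η) - t₀)]
  have hδ2 : 2 * δ ≤ h (z₀, η) - t₀ := by
    rw [hδ]; linarith [min_le_right (t₀ - h (z₀, -η)) (h (z₀, η) - t₀)]
  have hδ0 : 0 < δ := by
    have := lt_min (sub_pos.2 h1) (sub_pos.2 h2)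
    rw [hδ]; linarith
  have e1 : ∀ᶠ z in 𝓝 z₀, h (z, -η) < t₀ - δ :=
    ((hslice hm).continuousAt hN).eventually_lt_const (by linarith)
  have e2 : ∀ᶠ z in 𝓝 z₀, t₀ + δ < h (z, η) :=
    ((hslice hp).continuousAt hN).eventually_const_lt (by linarith)
  have key (z : E) (t : ℝ) : ∃ s, (z ∈ N ∧ h (z, -η) < t ∧ t < h (z, η)) →
      s ∈ Ioo (-η) η ∧ h (z, s) = t := by
    by_cases hz : z ∈ N ∧ h (z, -η) < t ∧ t < h (z, η)
    · obtain ⟨s, hs, hst⟩ := intermediate_value_Ioo (f := fun s => h (z, s))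
        (by linarith : -η ≤ η) (hc.comp (by fun_prop) fun s hs => ⟨hz.1, hs⟩) ⟨hz.2.1, hz.2.2⟩
      exact ⟨s, fun _ => ⟨hs, hst⟩⟩
    · exact ⟨0, fun h => absurd h hz⟩
  choose σ hσ using key
  refine ⟨_, Filter.inter_mem hN (e1.and e2), inter_subset_left, δ, hδ0, σ, ?_, ?_⟩
  · rintro ⟨z, t⟩ ⟨⟨hz, hz1, hz2⟩, ht1, ht2⟩
    simp only at hz hz1 hz2 ht1 ht2
    obtain ⟨⟨hs1, hs2⟩, hst⟩ := hσ z t ⟨hz, hz1.trans ht1, ht2.trans hz2⟩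
    rw [ContinuousWithinAt, Filter.tendsto_def, Function.uncurry_apply_pair]
    intro W hW
    obtain ⟨μ, hμ, hμW⟩ := Metric.mem_nhds_iff.1
      (Filter.inter_mem hW (Ioo_mem_nhds hs1 hs2))
    set ν := μ / 2
    have hν : 0 < ν := by positivity
    have hνμ : ν < μ := half_lt_self hμ
    have hball {s : ℝ} (h : |s - σ z t| ≤ ν) : s ∈ W ∩ Ioo (-η) η :=
      hμW (by rw [Metric.mem_ball, Real.dist_eq]; linarith)
    have ha := (hball (s := σ z t - ν) (by simp [abs_of_pos hν])).2
    have hb := (hball (s := σ z t + ν) (by simp [abs_of_pos hν])).2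
    have hal := hmono z hz (Ioo_subset_Icc_self ha) ⟨hs1.le, hs2.le⟩ (by linarith)
    have hbl := hmono z hz ⟨hs1.le, hs2.le⟩ (Ioo_subset_Icc_self hb) (by linarith)
    simp only [hst] at hal hbl
    set J := Ioo (t₀ - δ) (t₀ + δ)
    set N' := N ∩ {z | h (z, -η) < t₀ - δ ∧ t₀ + δ < h (z, η)}
    have hzN' : (z, t) ∈ N' ×ˢ J := ⟨⟨hz, hz1, hz2⟩, ht1, ht2⟩
    -- The strict inequalities at times `σ z t ± ν` persist for nearby `(z', t')`, which traps `σ z'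
    -- t'` between these times.
    have c1 : ContinuousWithinAt (fun w : E × ℝ => h (w.1, σ z t - ν) - w.2) (N' ×ˢ J) (z, t) :=
      (((hslice (Ioo_subset_Icc_self ha)).comp continuousOn_fst fun w hw => hw.1.1).sub
        continuousOn_snd) _ hzN'
    have c2 : ContinuousWithinAt (fun w : E × ℝ => h (w.1, σ z t + ν) - w.2) (N' ×ˢ J) (z, t) :=
      (((hslice (Ioo_subset_Icc_self hb)).comp continuousOn_fst fun w hw => hw.1.1).sub
        continuousOn_snd) _ hzN'
    filter_upwards [self_mem_nhdsWithin,
      (c1.tendsto.eventually_lt_const (u := 0) (by simpa using hal)),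
      (c2.tendsto.eventually_const_lt (u := 0) (by simpa using hbl))] with w hw hw1 hw2
    obtain ⟨z', t'⟩ := w
    obtain ⟨⟨hz', hz1', hz2'⟩, ht1', ht2'⟩ := hw
    simp only at hz' hz1' hz2' ht1' ht2' hw1 hw2
    obtain ⟨⟨hs1', hs2'⟩, hst'⟩ := hσ z' t' ⟨hz', hz1'.trans ht1', ht2'.trans hz2'⟩
    refine (hball (abs_le.2 ⟨?_, ?_⟩)).1
    · have := (hmono z' hz').lt_iff_lt (Ioo_subset_Icc_self ha) ⟨hs1'.le, hs2'.le⟩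
      simp only [hst'] at this
      change _ ≤ σ z' t' - _
      linarith [this.1 (by linarith)]
    · have := (hmono z' hz').lt_iff_lt ⟨hs1'.le, hs2'.le⟩ (Ioo_subset_Icc_self hb)
      simp only [hst'] at this
      change σ z' t' - _ ≤ _
      linarith [this.1 (by linarith)]
  · rintro z ⟨hz, hz1, hz2⟩ t ⟨ht1, ht2⟩
    exact hσ z t ⟨hz, hz1.trans ht1, ht2.trans hz2⟩

/-! ### Orbits of a vector field pointing into an orthant -/

section Orbit

variable {E : Type*} [NormedAddCommGroup E] [NormedSpace ℝ E] {F : E → E} {z₀ : E}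

theorem eventuallyEq_of_hasDerivAt (hF : ContDiffAt ℝ 1 F z₀) {f g : ℝ → E} {t₀ : ℝ}
    (hf₀ : f t₀ = z₀) (hg₀ : g t₀ = z₀) (hf : ∀ᶠ t in 𝓝 t₀, HasDerivAt f (F (f t)) t)
    (hg : ∀ᶠ t in 𝓝 t₀, HasDerivAt g (F (g t)) t) : f =ᶠ[𝓝 t₀] g := by
  obtain ⟨K, s, hs, hl⟩ := hF.exists_lipschitzOnWith
  refine ODE_solution_unique_of_eventually (v := fun _ => F) (s := fun _ => s) (K := K)
    (Filter.Eventually.of_forall fun _ => hl) (hf.and ?_) (hg.and ?_) (hf₀.trans hg₀.symm)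
  · exact hf.self_of_nhds.continuousAt.eventually_mem (by rwa [hf₀])
  · exact hg.self_of_nhds.continuousAt.eventually_mem (by rwa [hg₀])

theorem strictMonoOn_orthantGauge {κ : Type*} [Fintype κ] [Nonempty κ] {u : κ → E →L[ℝ] ℝ}
    {ψ : ℝ → E} {D : Set ℝ} (hD : Convex ℝ D)
    (hψ : ∀ s ∈ D, HasDerivWithinAt ψ (F (ψ s)) D s ∧ ∀ j, 0 < u j (F (ψ s))) :
    StrictMonoOn (fun s => orthantGauge fun j => u j (ψ s)) D := by
  have hmono (j) : StrictMonoOn (fun s => u j (ψ s)) D := by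
    refine strictMonoOn_of_hasDerivWithinAt_pos (f' := fun s => u j (F (ψ s))) hD
      (fun s hs => ?_) (fun s hs => ?_) fun s hs => (hψ s (interior_subset hs)).2 j
    · exact ((u j).continuous.continuousAt.comp_continuousWithinAt
        (hψ s hs).1.continuousWithinAt)
    · exact ((u j).hasFDerivAt.comp_hasDerivWithinAt s (hψ s (interior_subset hs)).1).mono
        interior_subset
  exact fun s hs s' hs' h => orthantGauge_lt fun j => hmono j hs hs' h

/-- Orbits stay in a linear subspace to which the vector field is tangent. -/
theorem eventually_apply_eq_self [CompleteSpace E] (hF : ContDiffAt ℝ 1 F z₀) {P : E →L[ℝ] E}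
    (hP : ∀ z, P (P z) = P z) (hz₀ : P z₀ = z₀) (hPF : ∀ᶠ z in 𝓝 z₀, P z = z → P (F z) = F z)
    {ψ : ℝ → E} {t₀ : ℝ} (hψ₀ : ψ t₀ = z₀) (hψ : ∀ᶠ t in 𝓝 t₀, HasDerivAt ψ (F (ψ t)) t) :
    ∀ᶠ t in 𝓝 t₀, P (ψ t) = ψ t := by
  -- Orbits of the projected field stay in the range of `P`, because the derivative of `P χ - χ`
  -- vanishes. There the two fields agree, and uniqueness identifies the orbits.
  have hFP : ContDiffAt ℝ 1 (fun z => P (F (P z))) z₀ :=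
    P.contDiff.contDiffAt.comp z₀
      (ContDiffAt.comp z₀ (by rwa [hz₀]) P.contDiff.contDiffAt)
  obtain ⟨r, hr, ε, hε, h⟩ :=
    hFP.exists_forall_mem_closedBall_exists_eq_forall_mem_Ioo_hasDerivAt t₀
  obtain ⟨χ, hχ₀, hχ⟩ := h z₀ (Metric.mem_closedBall_self hr.le)
  have ht₀ : t₀ ∈ Ioo (t₀ - ε) (t₀ + ε) := ⟨by linarith, by linarith⟩
  have hd (t) (ht : t ∈ Ioo (t₀ - ε) (t₀ + ε)) : HasDerivAt (fun t => P (χ t) - χ t) 0 t := by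
    have := (P.hasFDerivAt.comp_hasDerivAt t (hχ t ht)).sub (hχ t ht)
    rw [hP, sub_self] at this
    exact this
  have hPχ (t) (ht : t ∈ Ioo (t₀ - ε) (t₀ + ε)) : P (χ t) = χ t := by
    have := isOpen_Ioo.is_const_of_deriv_eq_zero (f := fun t => P (χ t) - χ t)
      isPreconnected_Ioo (fun t ht => (hd t ht).differentiableAt.differentiableWithinAt)
      (fun t ht => (hd t ht).deriv) ht ht₀
    simp only [hχ₀, hz₀, sub_self] at this
    exact sub_eq_zero.1 this
  have hmem : ∀ᶠ t in 𝓝 t₀, t ∈ Ioo (t₀ - ε) (t₀ + ε) := isOpen_Ioo.mem_nhds ht₀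
  have hcont : Filter.Tendsto χ (𝓝 t₀) (𝓝 z₀) := by
    have := (hχ t₀ ht₀).continuousAt.tendsto
    rwa [hχ₀] at this
  have hχF : ∀ᶠ t in 𝓝 t₀, HasDerivAt χ (F (χ t)) t := by
    filter_upwards [hmem, hcont.eventually hPF] with t ht htP
    have := hχ t ht
    rwa [hPχ t ht, htP (hPχ t ht)] at this
  filter_upwards [eventuallyEq_of_hasDerivAt hF hψ₀ hχ₀ hψ hχF, hmem] with t ht ht'
  rw [ht, hPχ t ht']

/-- The local flow of a vector field that points into an orthant, together with the times at which
its orbits attain the values of the gauge function of the orthant. -/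
theorem exists_orbitBox [CompleteSpace E] {κ : Type*} [Fintype κ] [Nonempty κ]
    (hF : ContDiffAt ℝ 1 F z₀) (u : κ → E →L[ℝ] ℝ) (hu : ∀ j, 0 < u j (F z₀)) {G : Set E}
    (hG : G ∈ 𝓝 z₀) {τ : ℝ} (hτ : orthantGauge (fun j => u j z₀) = τ) :
    ∃ N ∈ 𝓝 z₀, ∃ δ > 0, ∃ η > 0, ∃ (Ψ : E → ℝ → E) (σ : E → ℝ → ℝ),
      ContinuousOn (Function.uncurry Ψ) (N ×ˢ Ioo (-η) η) ∧
      ContinuousOn (Function.uncurry σ) (N ×ˢ Ioo (τ - δ) (τ + δ)) ∧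
      (∀ z ∈ N, Ψ z 0 = z) ∧
      (∀ z ∈ N, ∀ s ∈ Ioo (-η) η, HasDerivAt (Ψ z) (F (Ψ z s)) s ∧ Ψ z s ∈ G) ∧
      (∀ z ∈ N, StrictMonoOn (fun s => orthantGauge fun j => u j (Ψ z s)) (Ioo (-η) η)) ∧
      ∀ z ∈ N, ∀ t ∈ Ioo (τ - δ) (τ + δ),
        σ z t ∈ Ioo (-η) η ∧ orthantGauge (fun j => u j (Ψ z (σ z t))) = t := by
  obtain ⟨ε, hε, a, r, L, K, hr, hpl⟩ := IsPicardLindelof.of_contDiffAt_one hF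
  obtain ⟨α, hα, hαc⟩ :=
    (hpl 0).exists_forall_mem_closedBall_eq_hasDerivWithinAt_continuousOn
  simp only [zero_sub, zero_add] at hα hαc
  have hr' : (0 : ℝ) < r := hr
  have hG' : G ∩ {z | ∀ j, 0 < u j (F z)} ∈ 𝓝 z₀ := by
    refine Filter.inter_mem hG (Filter.eventually_all.2 fun j => ?_)
    exact ((u j).continuous.continuousAt.comp hF.continuousAt).eventually_const_lt (hu j)
  have hbox : Metric.closedBall z₀ r ×ˢ Icc (-ε) ε ∈ 𝓝 ((z₀, 0) : E × ℝ) :=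
    prod_mem_nhds (Metric.closedBall_mem_nhds z₀ hr') (Icc_mem_nhds (by linarith) hε)
  have hα₀ : α (z₀, 0) = z₀ := (hα z₀ (Metric.mem_closedBall_self hr'.le)).1
  have hpre : α ⁻¹' (G ∩ {z | ∀ j, 0 < u j (F z)}) ∈ 𝓝 ((z₀, 0) : E × ℝ) :=
    (hαc.continuousAt hbox).preimage_mem_nhds (by rwa [hα₀])
  obtain ⟨N₁, hN₁, I₁, hI₁, hNI⟩ := mem_nhds_prod_iff.1 (Filter.inter_mem hbox hpre)
  obtain ⟨ρ, hρ, hρI⟩ := Metric.mem_nhds_iff.1 hI₁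
  set η := ρ / 2 with hη
  have hη0 : 0 < η := by positivity
  have hIcc : Icc (-η) η ⊆ I₁ := fun s hs => hρI (by
    rw [Metric.mem_ball, Real.dist_eq, sub_zero]
    exact (abs_le.2 hs).trans_lt (half_lt_self hρ))
  have hmem {z s} (hz : z ∈ N₁) (hs : s ∈ Icc (-η) η) := hNI (mk_mem_prod hz (hIcc hs))
  have h0 : (0 : ℝ) ∈ Icc (-η) η := ⟨by linarith, hη0.le⟩
  have hηε : Icc (-η) η ⊆ Icc (-ε) ε := fun s hs => (hmem (mem_of_mem_nhds hN₁) hs).1.2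
  have hc : ContinuousOn α (N₁ ×ˢ Icc (-η) η) := hαc.mono fun w hw => (hmem hw.1 hw.2).1
  have hmono : ∀ z ∈ N₁, StrictMonoOn (fun s => orthantGauge fun j => u j (α (z, s)))
      (Icc (-η) η) := fun z hz =>
    strictMonoOn_orthantGauge (F := F) (ψ := fun s => α (z, s)) (convex_Icc _ _) fun s hs =>
      ⟨((hα z (hmem hz hs).1.1).2 s (hηε hs)).mono hηε, (hmem hz hs).2.2⟩
  obtain ⟨N, hN, hNN, δ, hδ, σ, hσc, hσ⟩ := exists_continuousOn_of_strictMonoOn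
    (h := fun w => orthantGauge fun j => u j (α w)) hN₁ hη0
    (continuous_orthantGauge.comp_continuousOn
      (continuousOn_pi.2 fun j => (u j).continuous.comp_continuousOn hc)) hmono
  simp only [hα₀, hτ] at hσc hσ
  refine ⟨N, hN, δ, hδ, η, hη0, fun z s => α (z, s), σ, ?_, hσc, fun z hz => ?_,
    fun z hz s hs => ?_, fun z hz => (hmono z (hNN hz)).mono Ioo_subset_Icc_self, hσ⟩
  · exact hc.mono (prod_mono hNN Ioo_subset_Icc_self)
  · exact (hα z (hmem (hNN hz) h0).1.1).1
  · have hs' := Ioo_subset_Icc_self hs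
    refine ⟨(((hα z (hmem (hNN hz) hs').1.1).2 s (hηε hs')).mono hηε).hasDerivAt
      (Icc_mem_nhds hs.1 hs.2), (hmem (hNN hz) hs').2.1⟩

end Orbit

/-! ## Vector fields patched from constant fields in charts -/

section PatchedField

variable {n : ℕ} {X ι F : Type*} [TopologicalSpace X] [ChartedSpace (EuclideanSpace ℝ (Fin n)) X]
  [NormedAddCommGroup F] [NormedSpace ℝ F]

/-- The derivative of `g` along the vector field `∑ ρ i • e i`, where `e i` is regarded as a constant
vector field in the chart `φ i`. -/
noncomputable def patchedDeriv (φ : ι → OpenPartialHomeomorph X (EuclideanSpace ℝ (Fin n)))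
    (ρ : SmoothPartitionOfUnity ι (𝓡 n) X univ) (e : ι → EuclideanSpace ℝ (Fin n)) (g : X → F)
    (x : X) : F :=
  ∑ᶠ i, ρ i x • fderiv ℝ (g ∘ (φ i).symm) (φ i x) (e i)

variable {φ : ι → OpenPartialHomeomorph X (EuclideanSpace ℝ (Fin n))}
  {ρ : SmoothPartitionOfUnity ι (𝓡 n) X univ} {e : ι → EuclideanSpace ℝ (Fin n)}
  {χ χ' : OpenPartialHomeomorph X (EuclideanSpace ℝ (Fin n))}

theorem eventually_patchedDeriv_eq_sum (x₀ : X) : ∀ᶠ x in 𝓝 x₀,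
    ∀ (e : ι → EuclideanSpace ℝ (Fin n)) (g : X → F), patchedDeriv φ ρ e g x =
      ∑ i ∈ ρ.fintsupport x₀, ρ i x • fderiv ℝ (g ∘ (φ i).symm) (φ i x) (e i) := by
  filter_upwards [ρ.eventually_finsupport_subset x₀] with x hx e g
  refine finsum_eq_sum_of_support_subset _ fun i hi => hx ?_
  rw [ρ.mem_finsupport]
  exact fun h0 => hi (by simp [h0])

theorem contDiffAt_transition (hχ : χ ∈ IsManifold.maximalAtlas (𝓡 n) ∞ X)
    (hχ' : χ' ∈ IsManifold.maximalAtlas (𝓡 n) ∞ X) {x : X} (hx : x ∈ χ.source)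
    (hx' : x ∈ χ'.source) : ContDiffAt ℝ ∞ (χ' ∘ χ.symm) (χ x) := by
  refine (contDiffOn_comp_chart_symm hχ (contMDiffOn_of_mem_maximalAtlas hχ')).contDiffAt ?_
  refine (χ.symm.isOpen_inter_preimage χ'.open_source).mem_nhds ⟨χ.map_source hx, ?_⟩
  rwa [mem_preimage, χ.left_inv hx]

/-- All weights are nonnegative and one is positive, so a positivity condition in each chart
survives patching. -/
theorem patchedDeriv_pos {x : X} {g : X → ℝ} (hρ : ρ.IsSubordinate fun i => (φ i).source)
    (h : ∀ i, x ∈ (φ i).source → 0 < fderiv ℝ (g ∘ (φ i).symm) (φ i x) (e i)) :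
    0 < patchedDeriv φ ρ e g x := by
  rw [(eventually_patchedDeriv_eq_sum x).self_of_nhds]
  have hmem {i} (hi : x ∈ tsupport (ρ i)) := h i (hρ i hi)
  refine Finset.sum_pos' (fun i hi => mul_nonneg (ρ.nonneg i x)
    (hmem ((ρ.mem_fintsupport_iff x i).1 hi)).le) ?_
  obtain ⟨i, hi⟩ := ρ.exists_pos_of_mem (mem_univ x)
  have hi' : x ∈ tsupport (ρ i) := subset_tsupport _ hi.ne'
  exact ⟨i, (ρ.mem_fintsupport_iff x i).2 hi', mul_pos hi (hmem hi')⟩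

theorem patchedDeriv_eq_zero {x : X} {g : X → ℝ} (hρ : ρ.IsSubordinate fun i => (φ i).source)
    (h : ∀ i, x ∈ (φ i).source → fderiv ℝ (g ∘ (φ i).symm) (φ i x) (e i) = 0) :
    patchedDeriv φ ρ e g x = 0 := by
  rw [(eventually_patchedDeriv_eq_sum x).self_of_nhds]
  refine Finset.sum_eq_zero fun i hi => ?_
  rw [h i (hρ i ((ρ.mem_fintsupport_iff x i).1 hi)), smul_zero]

theorem fderiv_comp_symm (hχ : χ ∈ IsManifold.maximalAtlas (𝓡 n) ∞ X)
    (hχ' : χ' ∈ IsManifold.maximalAtlas (𝓡 n) ∞ X) {x : X} (hx : x ∈ χ.source)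
    (hx' : x ∈ χ'.source) {g : X → F} (hg : DifferentiableAt ℝ (g ∘ χ'.symm) (χ' x)) :
    fderiv ℝ (g ∘ χ.symm) (χ x) =
      (fderiv ℝ (g ∘ χ'.symm) (χ' x)).comp (fderiv ℝ (χ' ∘ χ.symm) (χ x)) := by
  have h1 : (χ' ∘ χ.symm) (χ x) = χ' x := by simp [χ.left_inv hx]
  have h2 : g ∘ χ.symm =ᶠ[𝓝 (χ x)] (g ∘ χ'.symm) ∘ (χ' ∘ χ.symm) := by
    filter_upwards [(χ.continuousAt_symm (χ.map_source hx)).eventually_mem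
      (s := χ'.source) (by rw [χ.left_inv hx]; exact χ'.open_source.mem_nhds hx')] with z hz
    simp [χ'.left_inv hz]
  rw [h2.fderiv_eq, fderiv_comp _ (by rwa [h1])
    ((contDiffAt_transition hχ hχ' hx hx').differentiableAt (by simp)), h1]

/-- By the chain rule the operator is differentiation along the vector whose components in `χ` are
its values on `χ`. -/
theorem patchedDeriv_eq_fderiv (hφ : ∀ i, φ i ∈ IsManifold.maximalAtlas (𝓡 n) ∞ X)
    (hρ : ρ.IsSubordinate fun i => (φ i).source) (hχ : χ ∈ IsManifold.maximalAtlas (𝓡 n) ∞ X)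
    {x : X} (hx : x ∈ χ.source) {g : X → F} (hg : DifferentiableAt ℝ (g ∘ χ.symm) (χ x)) :
    patchedDeriv φ ρ e g x = fderiv ℝ (g ∘ χ.symm) (χ x) (patchedDeriv φ ρ e χ x) := by
  rw [(eventually_patchedDeriv_eq_sum x).self_of_nhds, (eventually_patchedDeriv_eq_sum x).self_of_nhds,
    map_sum]
  refine Finset.sum_congr rfl fun i hi => ?_
  rw [map_smul, fderiv_comp_symm (hφ i) hχ (hρ i ((ρ.mem_fintsupport_iff x i).1 hi)) hx hg]
  rfl

theorem patchedDeriv_clm (hφ : ∀ i, φ i ∈ IsManifold.maximalAtlas (𝓡 n) ∞ X)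
    (hρ : ρ.IsSubordinate fun i => (φ i).source) (hχ : χ ∈ IsManifold.maximalAtlas (𝓡 n) ∞ X)
    {x : X} (hx : x ∈ χ.source) (L : EuclideanSpace ℝ (Fin n) →L[ℝ] F) :
    patchedDeriv φ ρ e (fun y => L (χ y)) x = L (patchedDeriv φ ρ e χ x) := by
  have h : (fun y => L (χ y)) ∘ χ.symm =ᶠ[𝓝 (χ x)] L := by
    filter_upwards [χ.open_target.mem_nhds (χ.map_source hx)] with z hz
    simp [χ.right_inv hz]
  rw [patchedDeriv_eq_fderiv hφ hρ hχ hx (L.differentiableAt.congr_of_eventuallyEq h),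
    h.fderiv_eq, L.fderiv]

/-- Locally the sum is finite with smooth terms; `C¹` is all that Picard–Lindelöf requires. -/
theorem contDiffAt_patchedDeriv (hφ : ∀ i, φ i ∈ IsManifold.maximalAtlas (𝓡 n) ∞ X)
    (hρ : ρ.IsSubordinate fun i => (φ i).source) (hχ : χ ∈ IsManifold.maximalAtlas (𝓡 n) ∞ X)
    {x : X} (hx : x ∈ χ.source) :
    ContDiffAt ℝ 1 (fun z => patchedDeriv φ ρ e χ (χ.symm z)) (χ x) := by
  have hcont := (χ.continuousAt_symm (χ.map_source hx)).tendsto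
  rw [χ.left_inv hx] at hcont
  refine ContDiffAt.congr_of_eventuallyEq ?_
    ((hcont.eventually (eventually_patchedDeriv_eq_sum (φ := φ) (ρ := ρ) x)).mono
      fun z hz => hz e χ)
  refine ContDiffAt.sum fun i hi => ?_
  have hxi : x ∈ (φ i).source := hρ i ((ρ.mem_fintsupport_iff x i).1 hi)
  have h1 : ContDiffAt ℝ ∞ (ρ i ∘ χ.symm) (χ x) :=
    (contDiffOn_comp_chart_symm hχ (ρ i).contMDiff.contMDiffOn (U := univ)).contDiffAt
      (by simpa using χ.open_target.mem_nhds (χ.map_source hx))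
  have h2 : ContDiffAt ℝ 1 (fderiv ℝ (χ ∘ (φ i).symm)) (φ i x) :=
    (contDiffAt_transition (hφ i) hχ hxi hx).fderiv_right (by norm_cast)
  have h3 := (contDiffAt_transition hχ (hφ i) hx hxi).of_le (m := 1) (by norm_cast)
  have h4 : ContDiffAt ℝ 1 (fun z => fderiv ℝ (χ ∘ (φ i).symm) (φ i (χ.symm z))) (χ x) :=
    ContDiffAt.comp (χ x) (by simpa [χ.left_inv hx] using h2) h3
  exact (h1.of_le (by norm_cast)).smul (h4.clm_apply contDiffAt_const)

/-- `ψ` has at time `s` the velocity prescribed by the patched vector field. -/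
def IsOrbitAt (φ : ι → OpenPartialHomeomorph X (EuclideanSpace ℝ (Fin n)))
    (ρ : SmoothPartitionOfUnity ι (𝓡 n) X univ) (e : ι → EuclideanSpace ℝ (Fin n)) (ψ : ℝ → X)
    (s : ℝ) : Prop :=
  ContinuousAt ψ s ∧ ∃ χ ∈ IsManifold.maximalAtlas (𝓡 n) ∞ X, ψ s ∈ χ.source ∧
    HasDerivAt (χ ∘ ψ) (patchedDeriv φ ρ e χ (ψ s)) s

theorem IsOrbitAt.hasDerivAt (hφ : ∀ i, φ i ∈ IsManifold.maximalAtlas (𝓡 n) ∞ X)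
    (hρ : ρ.IsSubordinate fun i => (φ i).source) {ψ : ℝ → X} {s : ℝ}
    (h : IsOrbitAt φ ρ e ψ s) (hχ' : χ' ∈ IsManifold.maximalAtlas (𝓡 n) ∞ X)
    (hs : ψ s ∈ χ'.source) : HasDerivAt (χ' ∘ ψ) (patchedDeriv φ ρ e χ' (ψ s)) s := by
  obtain ⟨hcont, χ, hχ, hsχ, hd⟩ := h
  have hdiff := (contDiffAt_transition hχ hχ' hsχ hs).differentiableAt (by simp)
  rw [patchedDeriv_eq_fderiv hφ hρ hχ hsχ hdiff]
  refine (HasFDerivAt.comp_hasDerivAt (f := χ ∘ ψ) s hdiff.hasFDerivAt hd).congr_of_eventuallyEq ?_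
  filter_upwards [hcont.eventually_mem (χ.open_source.mem_nhds hsχ)] with t ht
  simp [χ.left_inv ht]

end PatchedField

/-! ## Inward directions -/

theorem RealOrientedBlowup.eventually_mem_side {X : Type*} [TopologicalSpace X] {D : Set X}
    {U W : Opens X} (hU : IsSideNeighborhood D U) {b : RealOrientedBlowup D} (hbU : b.blowDown ∈ U)
    (hbW : b.blowDown ∈ W) : ∀ᶠ x in 𝓝 b.blowDown, x ∈ b.side U → x ∈ b.side W := by
  obtain ⟨V, hbV, hVU, hVW, hV⟩ := hU _ hbU W (W.isOpen.mem_nhds hbW)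
  filter_upwards [V.isOpen.mem_nhds hbV] with x hx hxU
  exact b.side_mono V W hVW (side_eq_inter hVU hV hbV ▸ ⟨hxU, hx⟩)

/-- A nonzero linear functional is positive on a direction if the function it approximates does
not decrease in all nearby directions. -/
theorem fderiv_pos_of_forall_eventually_le {E : Type*} [NormedAddCommGroup E] [NormedSpace ℝ E]
    {g : E → ℝ} {g' : E →L[ℝ] ℝ} {w e : E} (hg : HasFDerivAt g g' w) (hg' : g' ≠ 0)
    (h : ∀ᶠ v in 𝓝 e, ∀ᶠ t : ℝ in 𝓝[>] 0, g w ≤ g (w + t • v)) : 0 < g' e := by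
  have hnonneg : ∀ᶠ v in 𝓝 e, 0 ≤ g' v := by
    filter_upwards [h] with v hv
    have hline : HasDerivAt (fun t : ℝ => w + t • v) v 0 := by
      simpa using ((hasDerivAt_id (0 : ℝ)).smul_const v).const_add w
    have hd : HasDerivAt (fun t : ℝ => g (w + t • v)) (g' v) 0 :=
      HasFDerivAt.comp_hasDerivAt (f := fun t : ℝ => w + t • v) 0 (by simpa using hg) hline
    have hs := (hasDerivAt_iff_tendsto_slope.1 hd).mono_left
      (nhdsWithin_mono (0 : ℝ) (fun t ht => ne_of_gt ht : Ioi (0 : ℝ) ⊆ {0}ᶜ))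
    refine ge_of_tendsto hs ?_
    filter_upwards [hv, self_mem_nhdsWithin] with t ht (ht0 : 0 < t)
    rw [slope_def_field]
    exact div_nonneg (by simpa using ht) (by linarith)
  obtain ⟨u, hu⟩ : ∃ u, 0 < g' u := by
    obtain ⟨u, hu⟩ := DFunLike.ne_iff.1 hg'
    rcases lt_or_gt_of_ne hu with h | h
    · exact ⟨-u, by simpa using h⟩
    · exact ⟨u, h⟩
  -- Since `g'` remains nonnegative after moving from `e` slightly against `u`, where `0 < g' u`, it
  -- is strictly positive at `e`.
  have hlim : Filter.Tendsto (fun t : ℝ => e - t • u) (𝓝[>] 0) (𝓝 e) := by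
    have : Continuous fun t : ℝ => e - t • u := by fun_prop
    simpa using (this.tendsto 0).mono_left nhdsWithin_le_nhds
  obtain ⟨t, ht, ht0⟩ := ((hlim.eventually hnonneg).and self_mem_nhdsWithin).exists
  have ht0' : 0 < t := ht0
  rw [map_sub, map_smul, smul_eq_mul] at ht
  nlinarith [mul_pos ht0' hu]

/-- The direction `(±1, …, ±1, 0, …, 0)` pointing into the orthant of the first `k` coordinates of
the chart `φ` in which `C` lies. -/
noncomputable def orthantDirection {n : ℕ} {X : Type*} [TopologicalSpace X] (k : ℕ)
    (φ : OpenPartialHomeomorph X (EuclideanSpace ℝ (Fin n))) (C : Set X) :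
    EuclideanSpace ℝ (Fin n) :=
  open scoped Classical in
  WithLp.toLp 2 fun j => if (j : ℕ) < k then (if ∃ y ∈ C, 0 < φ y j then 1 else -1) else 0

section

variable {n m : ℕ} {X : Type*} [TopologicalSpace X]

theorem orthantDirection_of_le {k : ℕ} {φ : OpenPartialHomeomorph X (EuclideanSpace ℝ (Fin n))}
    {C : Set X} {j : Fin n} (hj : k ≤ (j : ℕ)) : orthantDirection k φ C j = 0 := by
  simp [orthantDirection, hj.not_gt]

theorem orthantDirection_mul_self {k : ℕ} {hk : k ≤ n}
    {φ : OpenPartialHomeomorph X (EuclideanSpace ℝ (Fin n))} {C : Set X} (j : Fin k) :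
    orthantDirection k φ C (Fin.castLE hk j) * orthantDirection k φ C (Fin.castLE hk j) = 1 := by
  simp only [orthantDirection, Fin.val_castLE, j.2, if_true]
  split_ifs <;> norm_num

variable [ChartedSpace (EuclideanSpace ℝ (Fin n)) X]
  {π : C(X, Ioo (-1 : ℝ) 1)} {S : Fin m → Set X} {d : Fin m → ℕ}
  {p : X} {k : ℕ} {hk : k ≤ n} {B : Fin m → Finset (Fin n)}
  {r : ℝ} {φ : OpenPartialHomeomorph X (EuclideanSpace ℝ (Fin n))}
  {b : RealOrientedBlowup (specialFibre π)}

/-- The source of a chart, as an open subset. -/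
def OpenPartialHomeomorph.opens {Y : Type*} [TopologicalSpace Y]
    (φ : OpenPartialHomeomorph X Y) : Opens X := ⟨φ.source, φ.open_source⟩

namespace IsAdaptedChart

theorem mem_side_iff (h : IsAdaptedChart π S d p k hk B r φ) (hb : b.blowDown ∈ φ.source)
    {x : X} : x ∈ b.side φ.opens ↔ x ∈ φ.source ∧
      ∀ j : Fin k, 0 < orthantDirection k φ (b.side φ.opens) (Fin.castLE hk j) *
        φ x (Fin.castLE hk j) := by
  obtain ⟨y, hy⟩ := b.side_nonempty (U := φ.opens) hb
  have hyU := b.side_subset _ hy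
  have hside : b.side φ.opens =
      {x ∈ φ.source | ∀ j : Fin k, 0 < φ x (Fin.castLE hk j) * φ y (Fin.castLE hk j)} :=
    (RealOrientedBlowup.side_eq_of_mem hy).trans (h.isCornerChart.connectedComponentIn_eq hyU)
  have hsign (j : Fin k) : 0 < orthantDirection k φ (b.side φ.opens) (Fin.castLE hk j) *
      φ y (Fin.castLE hk j) := by
    simp only [orthantDirection, Fin.val_castLE, j.2, if_true]
    split_ifs with hpos
    · obtain ⟨z, hz, hz0⟩ := hpos
      rw [hside] at hz
      rw [one_mul]
      exact (pos_iff_pos_of_mul_pos (hz.2 j)).1 hz0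
    · push Not at hpos
      have := lt_of_le_of_ne (hpos y hy) (h.isCornerChart.ne_zero hyU j)
      linarith
  have hiff (j : Fin k) : 0 < φ x (Fin.castLE hk j) * φ y (Fin.castLE hk j) ↔
      0 < orthantDirection k φ (b.side φ.opens) (Fin.castLE hk j) * φ x (Fin.castLE hk j) := by
    have h1 := hsign j
    generalize orthantDirection k φ (b.side φ.opens) (Fin.castLE hk j) = ε at h1 ⊢
    generalize φ x (Fin.castLE hk j) = a
    generalize φ y (Fin.castLE hk j) = c at h1 ⊢
    rcases pos_and_pos_or_neg_and_neg_of_mul_pos h1 with ⟨h2, h3⟩ | ⟨h2, h3⟩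
    · rw [mul_pos_iff_of_pos_right h3, mul_pos_iff_of_pos_left h2]
    · rw [← neg_mul_neg a c, ← neg_mul_neg ε a, mul_pos_iff_of_pos_right (neg_pos.2 h3),
        mul_pos_iff_of_pos_left (neg_pos.2 h2)]
  rw [← forall_congr' hiff]
  nth_rw 1 [hside]
  rfl

theorem orthantDirection_mul_nonneg_iff (h : IsAdaptedChart π S d p k hk B r φ)
    (hb : b.blowDown ∈ φ.source) {x : X} (hx : x ∈ φ.source) :
    (∀ j : Fin k, 0 ≤ orthantDirection k φ (b.side φ.opens) (Fin.castLE hk j) *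
      φ x (Fin.castLE hk j)) ↔ x ∈ closure (b.side φ.opens) := by
  obtain ⟨y, hy⟩ := b.side_nonempty (U := φ.opens) hb
  rw [RealOrientedBlowup.side_eq_of_mem hy]
  refine Iff.trans (forall_congr' fun j => ?_)
    (h.isCornerChart.mem_closure_iff hx (b.side_subset _ hy)).symm
  have h1 := ((h.mem_side_iff hb).1 hy).2 j
  rw [RealOrientedBlowup.side_eq_of_mem hy] at h1
  generalize orthantDirection k φ _ (Fin.castLE hk j) = ε at h1 ⊢
  generalize φ x (Fin.castLE hk j) = a
  generalize φ y (Fin.castLE hk j) = c at h1 ⊢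
  rcases pos_and_pos_or_neg_and_neg_of_mul_pos h1 with ⟨h2, h3⟩ | ⟨h2, h3⟩
  · rw [mul_nonneg_iff_of_pos_right h3, mul_nonneg_iff_of_pos_left h2]
  · rw [← neg_mul_neg a c, ← neg_mul_neg ε a, mul_nonneg_iff_of_pos_right (neg_pos.2 h3),
      mul_nonneg_iff_of_pos_left (neg_pos.2 h2)]

theorem exists_side_eq (h : IsAdaptedChart π S d p k hk B r φ) (hb : b.blowDown ∈ φ.source)
    {x : X} (hx : x ∈ φ.source)
    (hnonneg : ∀ j : Fin k, 0 ≤ orthantDirection k φ (b.side φ.opens) (Fin.castLE hk j) *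
      φ x (Fin.castLE hk j)) :
    ∃ b' : RealOrientedBlowup (specialFibre π), b'.blowDown = x ∧
      b'.side φ.opens = b.side φ.opens := by
  obtain ⟨y, hy⟩ := b.side_nonempty (U := φ.opens) hb
  rw [h.orthantDirection_mul_nonneg_iff hb hx] at hnonneg
  rw [RealOrientedBlowup.side_eq_of_mem hy] at hnonneg ⊢
  exact RealOrientedBlowup.exists_of_mem_closure h.isCornerChart.isSideNeighborhood hx
    (b.side_subset _ hy) hnonneg

theorem orthantDirection_mul_blowDown_nonneg (h : IsAdaptedChart π S d p k hk B r φ)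
    (hb : b.blowDown ∈ φ.source) (j : Fin k) :
    0 ≤ orthantDirection k φ (b.side φ.opens) (Fin.castLE hk j) *
      φ b.blowDown (Fin.castLE hk j) :=
  (h.orthantDirection_mul_nonneg_iff hb hb).2 (RealOrientedBlowup.mem_closure_side b hb) j

/-- On a chart in which `b` lies on a side where `π` is positive, `π` is the product of the
coordinates taken with the signs that make them positive on that side. -/
theorem eq_prod_orthantDirection (h : IsAdaptedChart π S d p k hk B r φ)
    (hb : b.blowDown ∈ φ.source) (hpos : ∃ y ∈ b.side ⊤, 0 < (π y : ℝ)) {x : X}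
    (hx : x ∈ φ.source) :
    (π x : ℝ) = ∏ j : Fin k, orthantDirection k φ (b.side φ.opens) (Fin.castLE hk j) *
      φ x (Fin.castLE hk j) := by
  obtain ⟨y, hy⟩ := b.side_nonempty (U := φ.opens) hb
  have hπy := pos_on_side π b hpos y (b.side_mono _ ⊤ le_top hy)
  have hyU := (h.mem_side_iff hb).1 hy
  rw [h.eq_prod y hyU.1] at hπy
  have h1 := Finset.prod_pos fun j (_ : j ∈ Finset.univ) => hyU.2 j
  rw [Finset.prod_mul_distrib] at h1
  have h2 : 0 < ∏ j : Fin k, orthantDirection k φ (b.side φ.opens) (Fin.castLE hk j) :=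
    (pos_iff_pos_of_mul_pos h1).2 hπy
  -- The product of the signs has square `1`, and positivity of `π` at `y` excludes `-1`.
  have h3 : (∏ j : Fin k, orthantDirection k φ (b.side φ.opens) (Fin.castLE hk j)) *
      ∏ j : Fin k, orthantDirection k φ (b.side φ.opens) (Fin.castLE hk j) = 1 := by
    rw [← Finset.prod_mul_distrib]
    exact Finset.prod_eq_one fun j _ => orthantDirection_mul_self j
  have h4 : ∏ j : Fin k, orthantDirection k φ (b.side φ.opens) (Fin.castLE hk j) = 1 := by
    nlinarith
  rw [Finset.prod_mul_distrib, h4, one_mul, h.eq_prod x hx]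

end IsAdaptedChart

end

/-- The `j`-th coordinate of `φ`, with the sign that makes it positive on `C`. -/
noncomputable def orthantCoord {n : ℕ} {X : Type*} [TopologicalSpace X] {k : ℕ} (hk : k ≤ n)
    (φ : OpenPartialHomeomorph X (EuclideanSpace ℝ (Fin n))) (C : Set X) (j : Fin k) :
    EuclideanSpace ℝ (Fin n) →L[ℝ] ℝ :=
  orthantDirection k φ C (Fin.castLE hk j) • EuclideanSpace.proj (Fin.castLE hk j)

section

variable {n m : ℕ} {X : Type*} [TopologicalSpace X]

theorem orthantCoord_apply {k : ℕ} {hk : k ≤ n}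
    {φ : OpenPartialHomeomorph X (EuclideanSpace ℝ (Fin n))} {C : Set X} (j : Fin k)
    (z : EuclideanSpace ℝ (Fin n)) :
    orthantCoord hk φ C j z = orthantDirection k φ C (Fin.castLE hk j) * z (Fin.castLE hk j) := rfl

theorem tendsto_symm_add_smul {x : X}
    {φ : OpenPartialHomeomorph X (EuclideanSpace ℝ (Fin n))}
    (hx : x ∈ φ.source) (v : EuclideanSpace ℝ (Fin n)) :
    Filter.Tendsto (fun t : ℝ => φ.symm (φ x + t • v)) (𝓝 0) (𝓝 x) := by
  have h1 : Continuous fun t : ℝ => φ x + t • v := by fun_prop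
  have h2 := h1.tendsto 0
  have h3 := (φ.continuousAt_symm (φ.map_source hx)).tendsto
  rw [φ.left_inv hx] at h3
  rw [zero_smul, add_zero] at h2
  exact h3.comp h2

theorem eventually_add_smul_mem_target {x : X}
    {φ : OpenPartialHomeomorph X (EuclideanSpace ℝ (Fin n))} (hx : x ∈ φ.source)
    (v : EuclideanSpace ℝ (Fin n)) : ∀ᶠ t : ℝ in 𝓝 0, φ x + t • v ∈ φ.target := by
  have h1 : Continuous fun t : ℝ => φ x + t • v := by fun_prop
  exact h1.continuousAt.eventually_mem (by simpa using φ.open_target.mem_nhds (φ.map_source hx))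

variable [ChartedSpace (EuclideanSpace ℝ (Fin n)) X]
  {π : C(X, Ioo (-1 : ℝ) 1)} {S : Fin m → Set X} {d : Fin m → ℕ}
  {p p' : X} {k k' : ℕ} {hk : k ≤ n} {hk' : k' ≤ n} {B B' : Fin m → Finset (Fin n)}
  {r r' : ℝ} {φ φ' : OpenPartialHomeomorph X (EuclideanSpace ℝ (Fin n))}
  {b : RealOrientedBlowup (specialFibre π)}

theorem fderiv_transition_comp (hφ : φ ∈ IsManifold.maximalAtlas (𝓡 n) ∞ X)
    (hφ' : φ' ∈ IsManifold.maximalAtlas (𝓡 n) ∞ X) {x : X} (hx : x ∈ φ.source)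
    (hx' : x ∈ φ'.source) (v : EuclideanSpace ℝ (Fin n)) :
    fderiv ℝ (φ ∘ φ'.symm) (φ' x) (fderiv ℝ (φ' ∘ φ.symm) (φ x) v) = v := by
  have h := fderiv_comp_symm hφ hφ' hx hx' (g := φ)
    ((contDiffAt_transition hφ' hφ hx' hx).differentiableAt (by simp))
  have hid : φ ∘ φ.symm =ᶠ[𝓝 (φ x)] id := by
    filter_upwards [φ.open_target.mem_nhds (φ.map_source hx)] with z hz
    exact φ.right_inv hz
  rw [hid.fderiv_eq, fderiv_id] at h
  exact (DFunLike.congr_fun h v).symm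

namespace IsAdaptedChart

/-- The direction pointing into the orthant of one chart points into the orthant of any other. -/
theorem fderiv_orthantCoord_pos (h : IsAdaptedChart π S d b.blowDown k hk B r φ)
    (h' : IsAdaptedChart π S d p' k' hk' B' r' φ') (hb' : b.blowDown ∈ φ'.source)
    (hpos : ∃ y ∈ b.side ⊤, 0 < (π y : ℝ)) (j : Fin k) :
    0 < fderiv ℝ ((fun x => orthantCoord hk φ (b.side φ.opens) j (φ x)) ∘ φ'.symm)
      (φ' b.blowDown) (orthantDirection k' φ' (b.side φ'.opens)) := by
  set L := orthantCoord hk φ (b.side φ.opens) j with hL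
  have hb := h.mem_source
  have hdiff := (contDiffAt_transition h'.mem_maximalAtlas h.mem_maximalAtlas hb' hb).differentiableAt
    (by simp)
  have hd : HasFDerivAt ((fun x => L (φ x)) ∘ φ'.symm)
      (L.comp (fderiv ℝ (φ ∘ φ'.symm) (φ' b.blowDown))) (φ' b.blowDown) :=
    L.hasFDerivAt.comp (φ' b.blowDown) hdiff.hasFDerivAt
  rw [hd.fderiv]
  refine fderiv_pos_of_forall_eventually_le hd (fun h0 => ?_) ?_
  · have h1 := DFunLike.congr_fun h0 (fderiv ℝ (φ' ∘ φ.symm) (φ b.blowDown)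
      (orthantDirection k φ (b.side φ.opens)))
    rw [ContinuousLinearMap.comp_apply, fderiv_transition_comp h.mem_maximalAtlas
      h'.mem_maximalAtlas hb hb', hL, orthantCoord_apply, orthantDirection_mul_self] at h1
    exact one_ne_zero h1
  · have hev : ∀ᶠ v in 𝓝 (orthantDirection k' φ' (b.side φ'.opens)), ∀ l : Fin k',
        0 < orthantCoord hk' φ' (b.side φ'.opens) l v := by
      refine Filter.eventually_all.2 fun l => ?_
      refine (orthantCoord hk' φ' (b.side φ'.opens) l).continuous.continuousAt.eventually_const_lt ?_
      rw [orthantCoord_apply, orthantDirection_mul_self]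
      exact one_pos
    filter_upwards [hev] with v hv
    have hlim := (tendsto_symm_add_smul hb' v).mono_left
      (nhdsWithin_le_nhds (s := Ioi (0 : ℝ)))
    have hlt {t : ℝ} (ht : 0 < t) (l : Fin k') :
        orthantCoord hk' φ' (b.side φ'.opens) l (φ' b.blowDown) <
          orthantCoord hk' φ' (b.side φ'.opens) l (φ' b.blowDown + t • v) := by
      rw [map_add, map_smul, smul_eq_mul]
      exact lt_add_of_pos_right _ (mul_pos ht (hv l))
    have hle (l : Fin k') : 0 ≤ orthantCoord hk' φ' (b.side φ'.opens) l (φ' b.blowDown) :=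
      h'.orthantDirection_mul_blowDown_nonneg hb' l
    simp only [Function.comp_apply, φ'.left_inv hb']
    -- On the special fibre, the motion enters the open orthant of `φ'`, hence the side of `b` in
    -- `φ`, where the coordinate is positive, while it vanishes at the centre. Off the special fibre
    -- the only signed coordinate is `π`, a product of nonnegative increasing factors in `φ'`.
    by_cases hp : (π b.blowDown : ℝ) = 0
    · filter_upwards [hlim.eventually (RealOrientedBlowup.eventually_mem_side
        h'.isCornerChart.isSideNeighborhood (U := φ'.opens) (W := φ.opens) hb' hb),
        (eventually_add_smul_mem_target hb' v).filter_mono nhdsWithin_le_nhds,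
        self_mem_nhdsWithin] with t ht htt ht0
      have hside := ht ((h'.mem_side_iff hb').2 ⟨φ'.map_target htt, fun l => by
        rw [φ'.right_inv htt]
        exact (hle l).trans_lt (hlt ht0 l)⟩)
      rw [h.map_eq_zero hp, map_zero]
      exact (((h.mem_side_iff hb).1 hside).2 j).le
    · obtain rfl := h.eq_one hp
      have hprod {x} (hx : x ∈ φ.source) : L (φ x) = π x := by
        rw [h.eq_prod_orthantDirection hb hpos hx, Fintype.prod_subsingleton _ j]
        rfl
      filter_upwards [hlim.eventually (φ.open_source.mem_nhds hb),
        (eventually_add_smul_mem_target hb' v).filter_mono nhdsWithin_le_nhds,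
        self_mem_nhdsWithin] with t ht htt ht0
      rw [hprod hb, hprod ht, h'.eq_prod_orthantDirection hb' hpos hb',
        h'.eq_prod_orthantDirection hb' hpos (φ'.map_target htt), φ'.right_inv htt]
      exact Finset.prod_le_prod (fun l _ => hle l) fun l _ => (hlt ht0 l).le

theorem center_mem (h : IsAdaptedChart π S d p k hk B r φ) {i : Fin m} {x : X}
    (hx : x ∈ φ.source) (hxS : x ∈ S i) : p ∈ S i := by
  by_contra hp
  exact h.notMem i hp x hx hxS

/-- The inward direction of a chart is tangent to the submanifolds. -/
theorem fderiv_coord_eq_zero (h : IsAdaptedChart π S d p k hk B r φ)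
    (h' : IsAdaptedChart π S d p' k' hk' B' r' φ') {x : X} (hx : x ∈ φ.source)
    (hx' : x ∈ φ'.source) {i : Fin m} (hxS : x ∈ S i) {j : Fin n} (hj : j ∈ B i) (C : Set X) :
    fderiv ℝ ((fun y => φ y j) ∘ φ'.symm) (φ' x) (orthantDirection k' φ' C) = 0 := by
  set e := orthantDirection k' φ' C with he
  have hdiff := (contDiffAt_transition h'.mem_maximalAtlas h.mem_maximalAtlas hx' hx).differentiableAt
    (by simp)
  have hd : HasFDerivAt ((fun y => φ y j) ∘ φ'.symm)
      ((EuclideanSpace.proj (𝕜 := ℝ) j).comp (fderiv ℝ (φ ∘ φ'.symm) (φ' x))) (φ' x) :=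
    (EuclideanSpace.proj (𝕜 := ℝ) j).hasFDerivAt.comp (φ' x) hdiff.hasFDerivAt
  rw [hd.fderiv]
  -- The line in direction `e` does not move the block coordinates of `φ'`, so it stays in `S i`,
  -- and the coordinate `j` of `φ` vanishes along it.
  have hline : HasDerivAt (fun t : ℝ => φ' x + t • e) e 0 := by
    simpa using ((hasDerivAt_id (0 : ℝ)).smul_const e).const_add (φ' x)
  have h1 := HasFDerivAt.comp_hasDerivAt (f := fun t : ℝ => φ' x + t • e) 0 (by simpa using hd) hline
  refine h1.unique ((hasDerivAt_const (0 : ℝ) (0 : ℝ)).congr_of_eventuallyEq ?_)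
  filter_upwards [(tendsto_symm_add_smul hx' e).eventually (φ.open_source.mem_nhds hx),
    eventually_add_smul_mem_target hx' e] with t ht htt
  refine (h.mem_iff i (h.center_mem hx hxS) _ ht).1 ?_ j hj
  refine (h'.mem_iff i (h'.center_mem hx' hxS) _ (φ'.map_target htt)).2 fun l hl => ?_
  rw [φ'.right_inv htt, PiLp.add_apply, PiLp.smul_apply, he,
    orthantDirection_of_le (h'.le_of_mem_block i l hl), smul_zero, add_zero]
  exact (h'.mem_iff i (h'.center_mem hx' hxS) x hx').1 hxS l hl

end IsAdaptedChart

end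

/-! ## The flow on the positive part of the blow-up -/

/-- Adapted charts at all points, and a subordinate partition of unity. -/
structure AdaptedAtlas (n : ℕ) {m : ℕ} {X : Type*} [TopologicalSpace X]
    [ChartedSpace (EuclideanSpace ℝ (Fin n)) X] (π : C(X, Ioo (-1 : ℝ) 1)) (S : Fin m → Set X)
    (d : Fin m → ℕ) where
  /-- The number of branches of the fibre of `π` through a point. -/
  k : X → ℕ
  hk : ∀ x, k x ≤ n
  /-- The coordinates that vanish on the submanifolds. -/
  B : X → Fin m → Finset (Fin n)
  /-- The radius of the target of the chart. -/
  r : X → ℝ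
  /-- The chart at a point. -/
  φ : X → OpenPartialHomeomorph X (EuclideanSpace ℝ (Fin n))
  isAdaptedChart : ∀ x, IsAdaptedChart π S d x (k x) (hk x) (B x) (r x) (φ x)
  /-- The partition of unity. -/
  ρ : SmoothPartitionOfUnity X (𝓡 n) X univ
  isSubordinate : ρ.IsSubordinate fun x => (φ x).source

/-- This provides the paracompactness needed for partitions of unity. -/
theorem sigmaCompactSpace_of_isProperMap {X : Type*} [TopologicalSpace X]
    {π : C(X, Ioo (-1 : ℝ) 1)} (hπ : IsProperMap π) : SigmaCompactSpace X := by
  have : LocallyCompactSpace (Ioo (-1 : ℝ) 1) := isOpen_Ioo.locallyCompactSpace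
  refine ⟨⟨fun i => π ⁻¹' compactCovering (Ioo (-1 : ℝ) 1) i, fun i =>
    hπ.isCompact_preimage (isCompact_compactCovering _ i), ?_⟩⟩
  rw [← preimage_iUnion, iUnion_compactCovering, preimage_univ]

theorem mem_positivePart_iff {X : Type*} [TopologicalSpace X]
    {π : C(X, Ioo (-1 : ℝ) 1)} {b : RealOrientedBlowup (specialFibre π)} :
    b ∈ positivePart π ↔ ∃ y ∈ b.side ⊤, 0 < (π y : ℝ) := by
  unfold positivePart blownUpMap
  rw [mem_preimage]
  split_ifs with h <;> simp [h]

/-- The projection of `ℝⁿ` to the plane of the vanishing of the coordinates in `s`. -/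
noncomputable def zeroOn {n : ℕ} (s : Finset (Fin n)) :
    EuclideanSpace ℝ (Fin n) →L[ℝ] EuclideanSpace ℝ (Fin n) :=
  LinearMap.toContinuousLinearMap
    { toFun := fun z => WithLp.toLp 2 fun j => if j ∈ s then 0 else z j
      map_add' := fun z w => by ext j; by_cases h : j ∈ s <;> simp [h]
      map_smul' := fun a z => by ext j; by_cases h : j ∈ s <;> simp [h] }

theorem zeroOn_apply {n : ℕ} (s : Finset (Fin n)) (z : EuclideanSpace ℝ (Fin n)) (j : Fin n) :
    zeroOn s z j = if j ∈ s then 0 else z j := rfl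

theorem zeroOn_eq_self_iff {n : ℕ} {s : Finset (Fin n)} {z : EuclideanSpace ℝ (Fin n)} :
    zeroOn s z = z ↔ ∀ j ∈ s, z j = 0 := by
  refine ⟨fun h j hj => ?_, fun h => ?_⟩
  · rw [← h, zeroOn_apply, if_pos hj]
  · ext j
    rw [zeroOn_apply]
    split_ifs with hj
    exacts [(h j hj).symm, rfl]

section

variable {n m : ℕ} {X : Type*} [TopologicalSpace X] [ChartedSpace (EuclideanSpace ℝ (Fin n)) X]
  {π : C(X, Ioo (-1 : ℝ) 1)} {S : Fin m → Set X} {d : Fin m → ℕ}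

theorem nonempty_adaptedAtlas [T2Space X] [IsManifold (𝓡 n) ∞ X]
    (hπ : IsSmoothSemistableDegeneration n π) (hclosed : ∀ i, IsClosed (S i))
    (hsub : ∀ i, IsSubmanifold n (d i) (S i)) (htrans : IsTransversalCollection n π S) :
    Nonempty (AdaptedAtlas n π S d) := by
  have := sigmaCompactSpace_of_isProperMap hπ.isProperMap
  choose k hk B r φ hφ using exists_adaptedChart hπ hclosed hsub htrans
  obtain ⟨ρ, hρ⟩ := SmoothPartitionOfUnity.exists_isSubordinate (𝓡 n) isClosed_univ
    (fun x => (φ x).source) (fun x => (φ x).open_source)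
    fun x _ => mem_iUnion_of_mem x (hφ x).mem_source
  exact ⟨⟨k, hk, B, r, φ, hφ, ρ, hρ⟩⟩

namespace AdaptedAtlas

variable (A : AdaptedAtlas n π S d) {b : RealOrientedBlowup (specialFibre π)}

theorem mem_maximalAtlas (x : X) : A.φ x ∈ IsManifold.maximalAtlas (𝓡 n) ∞ X :=
  (A.isAdaptedChart x).mem_maximalAtlas

theorem isSideNeighborhood (x : X) : IsSideNeighborhood (specialFibre π) (A.φ x).opens :=
  (A.isAdaptedChart x).isCornerChart.isSideNeighborhood

theorem mem_source (x : X) : x ∈ (A.φ x).source := (A.isAdaptedChart x).mem_source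

/-- The inward directions, on the sides given by `b`, in the charts of the atlas. -/
noncomputable def direction (b : RealOrientedBlowup (specialFibre π)) (x : X) :
    EuclideanSpace ℝ (Fin n) :=
  orthantDirection (A.k x) (A.φ x) (b.side (A.φ x).opens)

/-- The inward vector field on the sides given by `b`, in the chart at the image of `b`. -/
noncomputable def field (b : RealOrientedBlowup (specialFibre π)) (z : EuclideanSpace ℝ (Fin n)) :
    EuclideanSpace ℝ (Fin n) :=
  patchedDeriv A.φ A.ρ (A.direction b) (A.φ b.blowDown) ((A.φ b.blowDown).symm z)

/-- The coordinates that are positive on the side given by `b`. -/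
noncomputable def coord (b : RealOrientedBlowup (specialFibre π)) :
    Fin (A.k b.blowDown) → EuclideanSpace ℝ (Fin n) →L[ℝ] ℝ :=
  orthantCoord (A.hk b.blowDown) (A.φ b.blowDown) (b.side (A.φ b.blowDown).opens)

instance : Nonempty (Fin (A.k b.blowDown)) := ⟨⟨0, (A.isAdaptedChart b.blowDown).one_le⟩⟩

theorem contDiffAt_field (b : RealOrientedBlowup (specialFibre π)) :
    ContDiffAt ℝ 1 (A.field b) (A.φ b.blowDown b.blowDown) :=
  contDiffAt_patchedDeriv A.mem_maximalAtlas A.isSubordinate (A.mem_maximalAtlas _)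
    (A.mem_source _)

theorem coord_field_pos (hb : b ∈ positivePart π) (j : Fin (A.k b.blowDown)) :
    0 < A.coord b j (A.field b (A.φ b.blowDown b.blowDown)) := by
  rw [field, (A.φ b.blowDown).left_inv (A.mem_source _),
    ← patchedDeriv_clm A.mem_maximalAtlas A.isSubordinate (A.mem_maximalAtlas _) (A.mem_source _)]
  exact patchedDeriv_pos A.isSubordinate fun x hx =>
    (A.isAdaptedChart b.blowDown).fderiv_orthantCoord_pos (A.isAdaptedChart x) hx
      (mem_positivePart_iff.1 hb) j

theorem coord_nonneg {b' : RealOrientedBlowup (specialFibre π)}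
    (h : b'.side (A.φ b.blowDown).opens = b.side (A.φ b.blowDown).opens)
    (hb' : b'.blowDown ∈ (A.φ b.blowDown).source) (j : Fin (A.k b.blowDown)) :
    0 ≤ A.coord b j (A.φ b.blowDown b'.blowDown) := by
  have := (A.isAdaptedChart b.blowDown).orthantDirection_mul_blowDown_nonneg hb' j
  rwa [h] at this

/-- Along an orbit in the closed orthant, the gauge and `π` are thus the same parameter. -/
theorem orthantGauge_coord (hb : b ∈ positivePart π) {x : X} (hx : x ∈ (A.φ b.blowDown).source)
    (hnonneg : ∀ j, 0 ≤ A.coord b j (A.φ b.blowDown x)) :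
    orthantGauge (fun j => A.coord b j (A.φ b.blowDown x)) = π x := by
  rw [orthantGauge_of_nonneg hnonneg, (A.isAdaptedChart b.blowDown).eq_prod_orthantDirection
    (A.mem_source _) (mem_positivePart_iff.1 hb) hx]
  rfl

theorem mem_source_of_side_eq {x : X} {b' : RealOrientedBlowup (specialFibre π)}
    (hb : b.blowDown ∈ (A.φ x).source)
    (h : b'.side (A.φ x).opens = b.side (A.φ x).opens) : b'.blowDown ∈ (A.φ x).source := by
  obtain ⟨y, hy⟩ := b.side_nonempty (U := (A.φ x).opens) hb
  exact RealOrientedBlowup.blowDown_mem_of_mem_side (h ▸ hy)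

theorem mem_positivePart_of_side_eq (hb : b ∈ positivePart π) {x : X}
    {b' : RealOrientedBlowup (specialFibre π)} (hbx : b.blowDown ∈ (A.φ x).source)
    (h : b'.side (A.φ x).opens = b.side (A.φ x).opens) : b' ∈ positivePart π := by
  obtain ⟨y, hy⟩ := b.side_nonempty (U := (A.φ x).opens) hbx
  exact mem_positivePart_iff.2 ⟨y, b'.side_mono _ ⊤ le_top (h ▸ hy),
    pos_on_side π b (mem_positivePart_iff.1 hb) y (b.side_mono _ ⊤ le_top hy)⟩

/-- Near `b`, the inward vector field on a side does not depend on the point that gives the side. -/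
theorem exists_patchedDeriv_congr (b : RealOrientedBlowup (specialFibre π)) :
    ∃ G ∈ 𝓝 b.blowDown, ∀ b' : RealOrientedBlowup (specialFibre π), b'.blowDown ∈ G →
      b'.side (A.φ b.blowDown).opens = b.side (A.φ b.blowDown).opens → ∀ x ∈ G,
      ∀ g : X → EuclideanSpace ℝ (Fin n), patchedDeriv A.φ A.ρ (A.direction b') g x =
        patchedDeriv A.φ A.ρ (A.direction b) g x := by
  -- Only finitely many charts contribute near the image of `b`, and the side in each is locally
  -- constant on the blow-up.
  have h1 : ∀ᶠ b' in 𝓝 b, ∀ i ∈ A.ρ.fintsupport b.blowDown, A.direction b' i = A.direction b i := by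
    refine (Filter.eventually_all_finset _).2 fun i hi => ?_
    have hbi : b.blowDown ∈ (A.φ i).opens :=
      A.isSubordinate i ((A.ρ.mem_fintsupport_iff b.blowDown i).1 hi)
    filter_upwards [(RealOrientedBlowup.isOpen_side_eq _ b hbi).mem_nhds rfl] with b' hb'
    rw [direction, direction, show b'.side _ = b.side _ from hb']
  rw [RealOrientedBlowup.nhds_eq (A.isSideNeighborhood b.blowDown) (A.mem_source _),
    Filter.eventually_inf_principal, Filter.eventually_comap] at h1
  refine ⟨_, Filter.inter_mem h1 (eventually_patchedDeriv_eq_sum (φ := A.φ) (ρ := A.ρ)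
    (F := EuclideanSpace ℝ (Fin n)) b.blowDown), fun b' hb' hs x hx g => ?_⟩
  rw [hx.2, hx.2]
  exact Finset.sum_congr rfl fun i hi => by rw [hb'.1 b' rfl hs i hi]

theorem eventually_hasDerivAt_field {ψ : ℝ → X} (hψ₀ : ψ 0 = b.blowDown)
    (hψ : ∀ᶠ s in 𝓝 0, IsOrbitAt A.φ A.ρ (A.direction b) ψ s) :
    ∀ᶠ s in 𝓝 0, ψ s ∈ (A.φ b.blowDown).source ∧
      HasDerivAt (A.φ b.blowDown ∘ ψ) (A.field b ((A.φ b.blowDown ∘ ψ) s)) s := by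
  have hmem : ∀ᶠ s in 𝓝 0, ψ s ∈ (A.φ b.blowDown).source :=
    hψ.self_of_nhds.1.eventually_mem
      (hψ₀ ▸ (A.φ b.blowDown).open_source.mem_nhds (A.mem_source _))
  filter_upwards [hψ, hmem] with s hs hsm
  refine ⟨hsm, ?_⟩
  rw [field, Function.comp_apply, (A.φ b.blowDown).left_inv hsm]
  exact hs.hasDerivAt A.mem_maximalAtlas A.isSubordinate (A.mem_maximalAtlas _) hsm

/-- The orbits of the inward vector field stay in the submanifolds. -/
theorem eventually_mem_submanifold {ψ : ℝ → X} (hψ₀ : ψ 0 = b.blowDown)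
    (hψ : ∀ᶠ s in 𝓝 0, IsOrbitAt A.φ A.ρ (A.direction b) ψ s) {i : Fin m}
    (hi : b.blowDown ∈ S i) : ∀ᶠ s in 𝓝 0, ψ s ∈ S i := by
  have hA := A.isAdaptedChart b.blowDown
  have hd := A.eventually_hasDerivAt_field hψ₀ hψ
  -- In the chart the field is tangent to the plane of `S i`: each patched direction preserves `S
  -- i`, so its derivative of a block coordinate is zero.
  have htan : ∀ᶠ z in 𝓝 (A.φ b.blowDown b.blowDown), zeroOn (A.B b.blowDown i) z = z →
      zeroOn (A.B b.blowDown i) (A.field b z) = A.field b z := by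
    filter_upwards [(A.φ b.blowDown).open_target.mem_nhds
      ((A.φ b.blowDown).map_source hA.mem_source)] with z hz hzP
    rw [zeroOn_eq_self_iff] at hzP ⊢
    intro j hj
    have hx := (A.φ b.blowDown).map_target hz
    have hxS : (A.φ b.blowDown).symm z ∈ S i := (hA.mem_iff i hi _ hx).2 fun l hl => by
      rw [(A.φ b.blowDown).right_inv hz, hzP l hl]
    have h1 := patchedDeriv_clm (e := A.direction b) A.mem_maximalAtlas A.isSubordinate
      hA.mem_maximalAtlas hx (EuclideanSpace.proj (𝕜 := ℝ) j)
    refine Eq.trans (Eq.symm h1) (patchedDeriv_eq_zero A.isSubordinate fun x' hx' => ?_)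
    exact hA.fderiv_coord_eq_zero (A.isAdaptedChart x') hx hx' hxS hj _
  have h := eventually_apply_eq_self (A.contDiffAt_field b) (P := zeroOn (A.B b.blowDown i))
    (fun z => zeroOn_eq_self_iff.2 fun j hj => by rw [zeroOn_apply, if_pos hj])
    (zeroOn_eq_self_iff.2 fun j hj => (hA.mem_iff i hi _ hA.mem_source).1 hi j hj) htan
    (ψ := A.φ b.blowDown ∘ ψ) (t₀ := 0) (by rw [Function.comp_apply, hψ₀]) (hd.mono fun s hs => hs.2)
  filter_upwards [h, hd] with s hs hs'
  exact (hA.mem_iff i hi _ hs'.1).2 (zeroOn_eq_self_iff.1 hs)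

end AdaptedAtlas

end

namespace AdaptedAtlas

section

variable {n m : ℕ} {X : Type*} [TopologicalSpace X] [ChartedSpace (EuclideanSpace ℝ (Fin n)) X]
  {π : C(X, Ioo (-1 : ℝ) 1)} {S : Fin m → Set X} {d : Fin m → ℕ} (A : AdaptedAtlas n π S d)

/-- Near the time `π y`, the curve `γ` is the orbit of `y`, lifted to the blow-up and parametrised
by the values of `π`. -/
def IsFlowGerm (y : positivePart π) (γ : ℝ → positivePart π) : Prop :=
  ∃ ψ : ℝ → X, ψ 0 = y.1.blowDown ∧
    (∀ᶠ s in 𝓝 0, IsOrbitAt A.φ A.ρ (A.direction y.1) ψ s) ∧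
    ∃ σ : ℝ → ℝ, Filter.Tendsto σ (𝓝[Ico 0 1] (π y.1.blowDown : ℝ)) (𝓝 0) ∧
      ∀ᶠ t in 𝓝[Ico 0 1] (π y.1.blowDown : ℝ), (γ t).1.blowDown = ψ (σ t) ∧
        (π (γ t).1.blowDown : ℝ) = t ∧
        (γ t).1.side (A.φ y.1.blowDown).opens = y.1.side (A.φ y.1.blowDown).opens

variable {A}

theorem IsFlowGerm.eventually_mem {y : positivePart π} {γ : ℝ → positivePart π}
    (h : A.IsFlowGerm y γ) {i : Fin m} (hi : y.1.blowDown ∈ S i) :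
    ∀ᶠ t in 𝓝[Ico 0 1] (π y.1.blowDown : ℝ), (γ t).1.blowDown ∈ S i := by
  obtain ⟨ψ, hψ₀, hψ, σ, hσ, hγ⟩ := h
  filter_upwards [hγ, hσ.eventually (A.eventually_mem_submanifold hψ₀ hψ hi)] with t ht ht'
  rwa [ht.1]

/-- The orbit is unique by the theory of ODEs. The time `σ t` is unique because the gauge is
strictly increasing along the orbit and must equal `t`. The lifted point is then determined by its
image and its side. -/
theorem IsFlowGerm.eventuallyEq {y : positivePart π} {γ γ' : ℝ → positivePart π}
    (h : A.IsFlowGerm y γ) (h' : A.IsFlowGerm y γ') :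
    ∀ᶠ t in 𝓝[Ico 0 1] (π y.1.blowDown : ℝ), γ t = γ' t := by
  obtain ⟨ψ, hψ₀, hψ, σ, hσ, hγ⟩ := h
  obtain ⟨ψ', hψ₀', hψ', σ', hσ', hγ'⟩ := h'
  set χ := A.φ y.1.blowDown with hχ
  have hd := A.eventually_hasDerivAt_field hψ₀ hψ
  have hd' := A.eventually_hasDerivAt_field hψ₀' hψ'
  have hf₀ : (χ ∘ ψ) 0 = χ y.1.blowDown := by rw [Function.comp_apply, hψ₀]
  have heq : χ ∘ ψ =ᶠ[𝓝 0] χ ∘ ψ' := eventuallyEq_of_hasDerivAt (A.contDiffAt_field y.1)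
    hf₀ (by rw [Function.comp_apply, hψ₀']) (hd.mono fun s hs => hs.2) (hd'.mono fun s hs => hs.2)
  have hcont : ContinuousAt (χ ∘ ψ) 0 := hd.self_of_nhds.2.continuousAt
  have hpos : ∀ᶠ s in 𝓝 (0 : ℝ), ∀ j, 0 < A.coord y.1 j (A.field y.1 ((χ ∘ ψ) s)) := by
    refine Filter.eventually_all.2 fun j => ?_
    have h1 : ContinuousAt (A.field y.1) ((χ ∘ ψ) 0) := by
      rw [hf₀]
      exact (A.contDiffAt_field y.1).continuousAt
    refine ((A.coord y.1 j).continuous.continuousAt.comp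
      (h1.comp hcont)).eventually_const_lt ?_
    rw [Function.comp_apply, Function.comp_apply, hf₀]
    exact A.coord_field_pos y.2 j
  obtain ⟨η, hη, hball⟩ := Metric.eventually_nhds_iff_ball.1 (hd.and (hd'.and (heq.and hpos)))
  have hmono : StrictMonoOn (fun s => orthantGauge fun j => A.coord y.1 j ((χ ∘ ψ) s))
      (Metric.ball 0 η) :=
    strictMonoOn_orthantGauge (F := A.field y.1) (convex_ball 0 η) fun s hs =>
      ⟨(hball s hs).1.2.hasDerivWithinAt, (hball s hs).2.2.2⟩
  have hside : IsSideNeighborhood (specialFibre π) χ.opens := A.isSideNeighborhood _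
  have hgauge {c : positivePart π}
      (hc : c.1.side χ.opens = y.1.side χ.opens) :
      c.1.blowDown ∈ χ.source ∧
        orthantGauge (fun j => A.coord y.1 j (χ c.1.blowDown)) = π c.1.blowDown :=
    have hm := A.mem_source_of_side_eq (A.mem_source _) hc
    ⟨hm, A.orthantGauge_coord y.2 hm (A.coord_nonneg hc hm)⟩
  filter_upwards [hγ, hγ', hσ.eventually (Metric.ball_mem_nhds 0 hη),
    hσ'.eventually (Metric.ball_mem_nhds 0 hη)] with t ⟨h1, h2, h3⟩ ⟨h1', h2', h3'⟩ hs hs'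
  have g1 := hgauge h3
  have g2 := hgauge h3'
  have e2 : χ (γ' t).1.blowDown = (χ ∘ ψ) (σ' t) := by
    rw [(hball _ hs').2.2.1, h1']
    rfl
  have hst : σ t = σ' t := by
    refine hmono.injOn hs hs' ?_
    have e1 : χ (γ t).1.blowDown = (χ ∘ ψ) (σ t) := by rw [h1]; rfl
    rw [← e1, ← e2, g1.2, g2.2, h2, h2']
  have hx : (γ t).1.blowDown = (γ' t).1.blowDown := by
    refine χ.injOn g1.1 g2.1 ?_
    rw [e2, h1, hst]
    rfl
  exact Subtype.ext (RealOrientedBlowup.eq_of_side_eq hside g2.1 hx (h3.trans h3'.symm))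

variable (A)

/-- Near `b`, the positive part is parametrised by an orthant. -/
theorem exists_lift (b : positivePart π) : ∃ lift : EuclideanSpace ℝ (Fin n) → positivePart π,
    ∀ z ∈ (A.φ b.1.blowDown).target, (∀ j, 0 ≤ A.coord b.1 j z) →
      (lift z).1.blowDown = (A.φ b.1.blowDown).symm z ∧
      (lift z).1.side (A.φ b.1.blowDown).opens = b.1.side (A.φ b.1.blowDown).opens := by
  have h (z : EuclideanSpace ℝ (Fin n)) : ∃ c : positivePart π,
      z ∈ (A.φ b.1.blowDown).target → (∀ j, 0 ≤ A.coord b.1 j z) →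
      c.1.blowDown = (A.φ b.1.blowDown).symm z ∧
      c.1.side (A.φ b.1.blowDown).opens = b.1.side (A.φ b.1.blowDown).opens := by
    by_cases hz : z ∈ (A.φ b.1.blowDown).target ∧ ∀ j, 0 ≤ A.coord b.1 j z
    · obtain ⟨c, hc, hcs⟩ := (A.isAdaptedChart b.1.blowDown).exists_side_eq (A.mem_source _)
        ((A.φ b.1.blowDown).map_target hz.1) fun j => by
          rw [(A.φ b.1.blowDown).right_inv hz.1]
          exact hz.2 j
      exact ⟨⟨c, A.mem_positivePart_of_side_eq b.2 (A.mem_source _) hcs⟩, fun _ _ => ⟨hc, hcs⟩⟩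
    · exact ⟨b, fun h1 h2 => absurd ⟨h1, h2⟩ hz⟩
  choose lift hlift using h
  exact ⟨lift, hlift⟩

/-- On the side of `b` the patched field is one `C¹` field, given by `b`. The point `y` is moved
along its orbit until the gauge reaches `t`; for `t ≥ 0` it is then in the closed orthant, hence
lifts to the side of `b`. -/
theorem exists_flowGermBox (b : positivePart π) :
    ∃ N ∈ 𝓝 b, ∃ J ∈ 𝓝 (π b.1.blowDown : ℝ), ∃ T : positivePart π → ℝ → positivePart π,
      let N' := N ∩ (fun y : positivePart π => (π y.1.blowDown : ℝ)) ⁻¹' J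
      ContinuousOn (Function.uncurry T) (N' ×ˢ (J ∩ Ico 0 1)) ∧
      ∀ y ∈ N', T y (π y.1.blowDown) = y ∧ ∀ t ∈ J ∩ Ico 0 1,
        (π (T y t).1.blowDown : ℝ) = t ∧ A.IsFlowGerm (T y t) (T y) := by
  obtain ⟨G, hG, hGc⟩ := A.exists_patchedDeriv_congr b.1
  obtain ⟨lift, hlift⟩ := A.exists_lift b
  have hgc {x} (hx : x ∈ (A.φ b.1.blowDown).source)
      (hnn : ∀ j, 0 ≤ A.coord b.1 j (A.φ b.1.blowDown x)) := A.orthantGauge_coord b.2 hx hnn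
  have hcn {b'} (h) (hb') := A.coord_nonneg (b := b.1) (b' := b') h hb'
  have hms {b'} := A.mem_source_of_side_eq (b := b.1) (b' := b') (A.mem_source _)
  have hside := A.isSideNeighborhood b.1.blowDown
  have hsrc := A.mem_source b.1.blowDown
  have hfield (z) : A.field b.1 z = patchedDeriv A.φ A.ρ (A.direction b.1) (A.φ b.1.blowDown)
    ((A.φ b.1.blowDown).symm z) := rfl
  have hatlas := A.mem_maximalAtlas b.1.blowDown
  obtain ⟨N, hN, δ, hδ, η, hη, Ψ, σ, hΨc, hσc, hΨ0, hΨ, hmono, hσ⟩ := exists_orbitBox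
    (A.contDiffAt_field b.1) (A.coord b.1) (A.coord_field_pos b.2)
    (G := (A.φ b.1.blowDown).target ∩ (A.φ b.1.blowDown).symm ⁻¹' G)
    (Filter.inter_mem ((A.φ b.1.blowDown).open_target.mem_nhds ((A.φ b.1.blowDown).map_source hsrc))
      (((A.φ b.1.blowDown).continuousAt_symm ((A.φ b.1.blowDown).map_source hsrc)).preimage_mem_nhds
        (by rwa [(A.φ b.1.blowDown).left_inv hsrc])))
    (hgc hsrc (hcn rfl hsrc))
  set χ := A.φ b.1.blowDown with hχ
  set τ : ℝ := (π b.1.blowDown : ℝ)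
  set J := Ioo (τ - δ) (τ + δ) with hJ
  set M : Set (positivePart π) :=
    {y | y.1.side χ.opens = b.1.side χ.opens} ∩ {y | χ y.1.blowDown ∈ N} with hM
  have hMn : M ∈ 𝓝 b := by
    refine Filter.inter_mem (((RealOrientedBlowup.isOpen_side_eq χ.opens b.1 hsrc).preimage
      continuous_subtype_val).mem_nhds rfl) ?_
    exact (ContinuousAt.comp (f := fun y : positivePart π => y.1.blowDown) (χ.continuousAt hsrc)
      (RealOrientedBlowup.continuous_blowDown.comp
        continuous_subtype_val).continuousAt).preimage_mem_nhds hN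
  have hMs {y : positivePart π} (hy : y ∈ M) : y.1.blowDown ∈ χ.source := hms hy.1
  let w (y : positivePart π) (t : ℝ) := Ψ (χ y.1.blowDown) (σ (χ y.1.blowDown) t)
  have hw {y : positivePart π} (hy : y ∈ M) {t : ℝ} (ht : t ∈ J ∩ Ico 0 1) :
      w y t ∈ χ.target ∩ χ.symm ⁻¹' G ∧ (∀ j, 0 ≤ A.coord b.1 j (w y t)) ∧
        (π (χ.symm (w y t)) : ℝ) = t := by
    obtain ⟨h1, h2⟩ := hσ _ hy.2 t ht.1
    have h3 := (hΨ _ hy.2 _ h1).2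
    have h4 : ∀ j, 0 ≤ A.coord b.1 j (w y t) :=
      nonneg_of_orthantGauge_nonneg (h2.symm ▸ ht.2.1)
    refine ⟨h3, h4, ?_⟩
    have h5 := hgc (χ.map_target h3.1) fun j => by
      rw [χ.right_inv h3.1]
      exact h4 j
    rw [χ.right_inv h3.1, h2] at h5
    exact h5.symm
  have hT {y : positivePart π} (hy : y ∈ M) {t : ℝ} (ht : t ∈ J ∩ Ico 0 1) :
      (lift (w y t)).1.blowDown = χ.symm (w y t) ∧
        (lift (w y t)).1.side χ.opens = b.1.side χ.opens :=
    hlift _ (hw hy ht).1.1 (hw hy ht).2.1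
  have hwc : ContinuousOn (Function.uncurry w) (M ×ˢ (J ∩ Ico 0 1)) := by
    have hχc : ContinuousOn (fun q : positivePart π × ℝ => χ q.1.1.blowDown)
        (M ×ˢ (J ∩ Ico 0 1)) :=
      χ.continuousOn.comp (RealOrientedBlowup.continuous_blowDown.comp
        (continuous_subtype_val.comp continuous_fst)).continuousOn fun q hq => hMs hq.1
    have hσ' : ContinuousOn (fun q : positivePart π × ℝ => σ (χ q.1.1.blowDown) q.2)
        (M ×ˢ (J ∩ Ico 0 1)) :=
      hσc.comp (hχc.prodMk continuousOn_snd) fun q hq => ⟨hq.1.2, hq.2.1⟩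
    exact hΨc.comp (hχc.prodMk hσ') fun q hq => ⟨hq.1.2, (hσ _ hq.1.2 _ hq.2.1).1⟩
  have hTc : ContinuousOn (Function.uncurry fun y t => lift (w y t)) (M ×ˢ (J ∩ Ico 0 1)) := by
    rw [IsInducing.subtypeVal.continuousOn_iff]
    rintro ⟨y, t⟩ hq
    have hq' := hT hq.1 hq.2
    rw [ContinuousWithinAt, RealOrientedBlowup.nhds_eq hside
      (b := (Subtype.val ∘ Function.uncurry fun y t => lift (w y t)) (y, t)) (hms hq'.2),
      Filter.tendsto_inf, Filter.tendsto_comap_iff, Filter.tendsto_principal]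
    constructor
    · have h1 : ContinuousOn (fun q => χ.symm (Function.uncurry w q)) (M ×ˢ (J ∩ Ico 0 1)) :=
        χ.continuousOn_symm.comp hwc fun q hq => (hw hq.1 hq.2).1.1
      exact (h1.congr fun q hq => (hT hq.1 hq.2).1) (y, t) hq
    · filter_upwards [self_mem_nhdsWithin] with q hq2
      exact (hT hq2.1 hq2.2).2.trans hq'.2.symm
  refine ⟨M, hMn, J, Ioo_mem_nhds (by linarith) (by linarith), fun y t => lift (w y t),
    hTc.mono (prod_mono inter_subset_left subset_rfl), fun y hy => ⟨?_, fun t ht => ?_⟩⟩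
  · obtain ⟨hyM, hyJ⟩ := hy
    have hyI : (π y.1.blowDown : ℝ) ∈ J ∩ Ico 0 1 :=
      ⟨hyJ, nonneg_blowDown π y.1 (mem_positivePart_iff.1 y.2), (π y.1.blowDown).2.2⟩
    obtain ⟨h1, h2⟩ := hσ _ hyM.2 _ hyJ
    -- At time `0` the gauge already equals `π y`, so by strict monotonicity no time elapses.
    have h0 : σ (χ y.1.blowDown) (π y.1.blowDown) = 0 := by
      refine (hmono _ hyM.2).injOn h1 ⟨by linarith, hη⟩ ?_
      simp only
      rw [h2, hΨ0 _ hyM.2, hgc (hMs hyM) (hcn hyM.1 (hMs hyM))]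
    have hwy : w y (π y.1.blowDown) = χ y.1.blowDown := by
      simp only [w, h0]
      exact hΨ0 _ hyM.2
    have h3 := hT hyM hyI
    refine Subtype.ext (RealOrientedBlowup.eq_of_side_eq hside (hMs hyM) ?_ (h3.2.trans hyM.1.symm))
    rw [h3.1, hwy, χ.left_inv (hMs hyM)]
  · obtain ⟨hyM, hyJ⟩ := hy
    have hTt := hT hyM ht
    have hπt : (π (lift (w y t)).1.blowDown : ℝ) = t := by
      rw [hTt.1]
      exact (hw hyM ht).2.2
    -- The orbit of `T y t` is that of `y` with time shifted by `σ t`, which must be subtracted from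
    -- the parametrisation.
    refine ⟨hπt, fun s => χ.symm (Ψ (χ y.1.blowDown) (σ (χ y.1.blowDown) t + s)), ?_, ?_,
      fun t' => σ (χ y.1.blowDown) t' - σ (χ y.1.blowDown) t, ?_, ?_⟩
    · simp only [add_zero]
      exact hTt.1.symm
    · have hlim : ContinuousAt (fun s : ℝ => σ (χ y.1.blowDown) t + s) 0 := by fun_prop
      have hIoo := (hσ _ hyM.2 t ht.1).1
      filter_upwards [hlim.eventually_mem (by rw [add_zero]; exact Ioo_mem_nhds hIoo.1 hIoo.2)]
        with s hs
      obtain ⟨h1, h2⟩ := hΨ _ hyM.2 _ hs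
      have h3 : HasDerivAt (fun s => Ψ (χ y.1.blowDown) (σ (χ y.1.blowDown) t + s))
          (A.field b.1 (Ψ (χ y.1.blowDown) (σ (χ y.1.blowDown) t + s))) s :=
        HasDerivAt.comp_const_add _ s h1
      refine ⟨ContinuousAt.comp (g := χ.symm) (χ.continuousAt_symm h2.1) h3.continuousAt, χ, hatlas,
        χ.map_target h2.1, ?_⟩
      -- The germ refers to the field given by `T y t`, the box to the field given by `b`; near `b`,
      -- on the same side, they agree.
      rw [hGc (lift (w y t)).1 (by rw [hTt.1]; exact (hw hyM ht).1.2) hTt.2 _ h2.2, ← hfield]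
      refine h3.congr_of_eventuallyEq ?_
      filter_upwards [h3.continuousAt.eventually_mem (χ.open_target.mem_nhds h2.1)] with s' hs'
      exact χ.right_inv hs'
    · rw [hπt]
      have h1 : ContinuousAt (σ (χ y.1.blowDown)) t :=
        (hσc.comp (f := fun t => (χ y.1.blowDown, t)) (s := J) (by fun_prop)
          fun t ht => ⟨hyM.2, ht⟩).continuousAt (isOpen_Ioo.mem_nhds ht.1)
      have h2 := (h1.sub (continuousAt_const (y := σ (χ y.1.blowDown) t))).tendsto
      simp only [Pi.sub_apply, sub_self] at h2
      exact h2.mono_left nhdsWithin_le_nhds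
    · rw [hπt]
      have h1 : ContinuousWithinAt (fun t => (lift (w y t)).1) (J ∩ Ico 0 1) t :=
        continuous_subtype_val.continuousAt.comp_continuousWithinAt
          (hTc.comp (f := fun t => (y, t)) (s := J ∩ Ico 0 1) (by fun_prop)
            (fun t ht => ⟨hyM, ht⟩) t ht)
      have hJt : 𝓝[J ∩ Ico 0 1] t = 𝓝[Ico 0 1] t := by
        exact nhdsWithin_inter_of_mem (mem_nhdsWithin_of_mem_nhds (isOpen_Ioo.mem_nhds ht.1))
      have h2 := h1.eventually_mem ((RealOrientedBlowup.isOpen_side_eq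
        (A.φ (lift (w y t)).1.blowDown).opens (lift (w y t)).1 (A.mem_source _)).mem_nhds rfl)
      rw [hJt] at h2
      have h3 : ∀ᶠ t' in 𝓝[Ico 0 1] t, t' ∈ J ∩ Ico 0 1 := by
        rw [← hJt]
        exact self_mem_nhdsWithin
      filter_upwards [h2, h3] with t' ht2 ht'
      have hT' := hT hyM ht'
      refine ⟨?_, ?_, ht2⟩
      · rw [hT'.1, add_sub_cancel]
      · rw [hT'.1]
        exact (hw hyM ht').2.2

end

end AdaptedAtlas

/-! ### The trivialisation of the positive part -/

theorem mem_positiveSpecialFibre_iff {X : Type*} [TopologicalSpace X] {π : C(X, Ioo (-1 : ℝ) 1)}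
    {b : RealOrientedBlowup (specialFibre π)} :
    b ∈ positiveSpecialFibre π ↔ b ∈ positivePart π ∧ (π b.blowDown : ℝ) = 0 := by
  rw [mem_positivePart_iff]
  unfold positiveSpecialFibre blownUpMap
  rw [mem_preimage]
  split_ifs with h
  · simp [h, zeroPlus, Subtype.ext_iff]
  · simp [h, zeroPlus]

theorem blownUpMap_of_mem_positivePart {X : Type*} [TopologicalSpace X]
    {π : C(X, Ioo (-1 : ℝ) 1)} {b : RealOrientedBlowup (specialFibre π)} (hb : b ∈ positivePart π)
    (t : Ico (0 : ℝ) 1) (ht : (π b.blowDown : ℝ) = t) : blownUpMap π b = Sum.inr t := by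
  rw [blownUpMap, dif_pos (mem_positivePart_iff.1 hb)]
  exact congrArg Sum.inr (Subtype.ext ht)

/-- The positive special fibre as a fibre of the positive part. -/
def positiveSpecialFibreHomeomorph {X : Type*} [TopologicalSpace X] (π : C(X, Ioo (-1 : ℝ) 1)) :
    positiveSpecialFibre π ≃ₜ {y : positivePart π // (π y.1.blowDown : ℝ) = 0} where
  toFun b := ⟨⟨b, (mem_positiveSpecialFibre_iff.1 b.2).1⟩, (mem_positiveSpecialFibre_iff.1 b.2).2⟩
  invFun y := ⟨y.1, mem_positiveSpecialFibre_iff.2 ⟨y.1.2, y.2⟩⟩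
  left_inv _ := rfl
  right_inv _ := rfl

theorem isClosed_positivePart {X : Type*} [TopologicalSpace X] (π : C(X, Ioo (-1 : ℝ) 1)) :
    IsClosed (positivePart π) :=
  isClosed_range_inr.preimage (continuous_blownUpMap π)

/-- The positive part of the blow-up is trivial over `[0, 1)`, by a trivialisation that preserves
the submanifolds. -/
theorem AdaptedAtlas.exists_homeomorph {n m : ℕ} {X : Type*} [TopologicalSpace X] [T2Space X]
    [ChartedSpace (EuclideanSpace ℝ (Fin n)) X] {π : C(X, Ioo (-1 : ℝ) 1)} (hπ : IsProperMap π)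
    {S : Fin m → Set X} {d : Fin m → ℕ} (hclosed : ∀ i, IsClosed (S i))
    (A : AdaptedAtlas n π S d) :
    ∃ H : ({y : positivePart π // (π y.1.blowDown : ℝ) = 0} × Ico (0 : ℝ) 1) ≃ₜ positivePart π,
      (∀ z, (π (H z).1.blowDown : ℝ) = z.2) ∧
      ∀ (I : Finset (Fin m)) (z), (H z).1.blowDown ∈ ⋂ i ∈ I, S i ↔
        z.1.1.1.blowDown ∈ ⋂ i ∈ I, S i := by
  have hT2 : T2Space (RealOrientedBlowup (specialFibre π)) :=
    RealOrientedBlowup.t2Space fun x => ⟨_, A.mem_source x, A.isSideNeighborhood x⟩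
  have hpos (y : positivePart π) := nonneg_blowDown π y.1 (mem_positivePart_iff.1 y.2)
  have hbd : Continuous fun y : positivePart π => y.1.blowDown :=
    RealOrientedBlowup.continuous_blowDown.comp continuous_subtype_val
  have hproper : IsProperMap fun y : positivePart π => π y.1.blowDown :=
    hπ.comp ((RealOrientedBlowup.isProperMap_blowDown fun x => ⟨_, A.mem_source x,
      A.isSideNeighborhood x, (A.isAdaptedChart x).isCornerChart.finite_components⟩).comp
      (isClosed_positivePart π).isClosedEmbedding_subtypeVal.isProperMap)
  have hgerm (y : positivePart π) : ∃ γ, A.IsFlowGerm y γ := by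
    obtain ⟨N, hN, J, hJ, T, -, hT⟩ := A.exists_flowGermBox y
    have hyJ := mem_of_mem_nhds hJ
    obtain ⟨h1, h2⟩ := hT y ⟨mem_of_mem_nhds hN, hyJ⟩
    have h3 := (h2 _ ⟨hyJ, hpos y, (π y.1.blowDown).2.2⟩).2
    rw [h1] at h3
    exact ⟨_, h3⟩
  choose c hc using hgerm
  have hcpt (a : ℝ) (ha : a < 1) :
      IsCompact ((fun y : positivePart π => (π y.1.blowDown : ℝ)) ⁻¹' Iic a) := by
    have hIcc : IsCompact ((↑) ⁻¹' Icc 0 a : Set (Ioo (-1 : ℝ) 1)) := by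
      rw [Subtype.isCompact_iff, Subtype.image_preimage_coe, inter_eq_right.2]
      · exact isCompact_Icc
      · exact fun x hx => ⟨by linarith [hx.1], hx.2.trans_lt ha⟩
    convert hproper.isCompact_preimage hIcc using 1
    ext y
    exact ⟨fun hy => ⟨hpos y, hy⟩, fun hy => hy.2⟩
  have hbox (b : positivePart π) : ∃ N ∈ 𝓝 b, ∃ J ∈ 𝓝 (π b.1.blowDown : ℝ), ∃ T,
      IsFlow (fun y : positivePart π => (π y.1.blowDown : ℝ)) c
        (N ∩ (fun y : positivePart π => (π y.1.blowDown : ℝ)) ⁻¹' J) (J ∩ Ico 0 1) T := by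
    obtain ⟨N, hN, J, hJ, T, hTc, hT⟩ := A.exists_flowGermBox b
    refine ⟨N, hN, J, hJ, T, hTc, fun y hy => ⟨?_, fun t ht => ((hT y hy).2 t ht).1,
      fun t ht => ?_⟩, fun y hy => (hT y hy).1⟩
    · exact hTc.comp (f := fun t => (y, t)) (by fun_prop) fun t ht => ⟨hy, ht⟩
    · obtain ⟨h1, h2⟩ := (hT y hy).2 t ht
      -- Uniqueness of germs makes every box follow the globally chosen germs `c`.
      have h3 := h2.eventuallyEq (hc (T y t))
      rw [h1] at h3
      exact h3.filter_mono (nhdsWithin_mono t inter_subset_right)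
  obtain ⟨H, hH, hHZ⟩ := exists_homeomorph_of_flowBox
    (continuous_subtype_val.comp (π.continuous.comp hbd))
    (fun y => ⟨hpos y, (π y.1.blowDown).2.2⟩) hcpt hbox
  refine ⟨H, hH, fun I z => ?_⟩
  refine hHZ {y | y.1.blowDown ∈ ⋂ i ∈ I, S i}
    ((isClosed_biInter fun i _ => hclosed i).preimage hbd) (fun y hy => ?_) z
  simp only [mem_ofPred_eq, mem_iInter₂] at hy ⊢
  exact (Filter.eventually_all_finset I).2 fun i hi => (hc y).eventually_mem (hy i hi)

theorem mainTheorem3 {n m : ℕ} {X : Type*} [TopologicalSpace X] [T2Space X]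
    [ChartedSpace (EuclideanSpace ℝ (Fin n)) X] [IsManifold (𝓡 n) ∞ X]
    (π : C(X, Ioo (-1 : ℝ) 1)) (hπ : IsSmoothSemistableDegeneration n π)
    (S : Fin m → Set X) (d : Fin m → ℕ) (hclosed : ∀ i, IsClosed (S i))
    (hsub : ∀ i, IsSubmanifold n (d i) (S i)) (htrans : IsTransversalCollection n π S) :
    (∀ I : Finset (Fin m), (⋂ i ∈ I, S i).Nonempty →
      ∃ (e : ℕ) (_ : ChartedSpace (EuclideanSpace ℝ (Fin e)) ↥(⋂ i ∈ I, S i))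
        (_ : IsManifold (𝓡 e) ∞ ↥(⋂ i ∈ I, S i)),
        Manifold.IsSmoothEmbedding (𝓡 e) (𝓡 n) ∞ (Subtype.val : ↥(⋂ i ∈ I, S i) → X) ∧
        IsSmoothSemistableDegeneration e (restrictTo π (⋂ i ∈ I, S i))) ∧
    (∀ I : Finset (Fin m), IsEmbedding (blowupInclusion π (⋂ i ∈ I, S i))) ∧
    ∃ H : (positiveSpecialFibre π × Ico (0 : ℝ) 1) ≃ₜ positivePart π,
      (∀ z, blownUpMap π (H z : RealOrientedBlowup (specialFibre π)) = Sum.inr z.2) ∧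
      ∀ I : Finset (Fin m),
        Subtype.val '' (H '' {z | (z.1 : RealOrientedBlowup (specialFibre π)) ∈
            blowupInclusion π (⋂ i ∈ I, S i) ''
              positiveSpecialFibre (restrictTo π (⋂ i ∈ I, S i))}) =
          blowupInclusion π (⋂ i ∈ I, S i) '' positivePart (restrictTo π (⋂ i ∈ I, S i)) := by
  refine ⟨fun I _ => isSmoothSemistableDegeneration_restrictTo hπ hclosed hsub htrans I,
    fun I => isEmbedding_blowupInclusion hπ hclosed hsub htrans I, ?_⟩
  obtain ⟨A⟩ := nonempty_adaptedAtlas hπ hclosed hsub htrans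
  obtain ⟨H, hH, hHI⟩ := A.exists_homeomorph hπ.isProperMap hclosed
  let K := ((positiveSpecialFibreHomeomorph π).prodCongr (Homeomorph.refl _)).trans H
  refine ⟨K, fun z => blownUpMap_of_mem_positivePart (K z).2 _ (hH _), fun I => ?_⟩
  unfold positivePart positiveSpecialFibre
  -- Both sides become sets of points over the intersection, and `hHI` says that the trivialisation
  -- preserves lying over it.
  rw [image_blowupInclusion hπ hclosed hsub htrans, image_blowupInclusion hπ hclosed hsub htrans]
  ext b
  constructor
  · rintro ⟨_, ⟨z, hz, rfl⟩, rfl⟩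
    exact ⟨(K z).2, (hHI I _).2 hz.2⟩
  · rintro ⟨hb, hbI⟩
    refine ⟨⟨b, hb⟩, ⟨K.symm ⟨b, hb⟩, ⟨(K.symm ⟨b, hb⟩).1.2, ?_⟩, K.apply_symm_apply _⟩, rfl⟩
    refine (hHI I (H.symm ⟨b, hb⟩)).1 ?_
    rwa [H.apply_symm_apply]
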